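/- Let $q\in\mathbb C^\times$ not be a root of unity. Let $U'_q(\widehat{\mathfrak{sl}}_2)$ be the algebra over $\mathbb C$ with generators $E_i,F_i,K_i^{\pm1}$ ($i=0,1$) and relations $K_iK_i^{-1}=K_i^{-1}K_i=1$, $K_iK_j=K_jK_i$, $K_iE_jK_i^{-1}=q^{a_{ij}}E_j$, $K_iF_jK_i^{-1}=q^{-a_{ij}}F_j$, $[E_i,F_j]=\delta_{ij}\frac{K_i-K_i^{-1}}{q-q^{-1}}$ and the $q$-Serre relations, where $a_{ii}=2$ and $a_{01}=a_{10}=-2$. Its coproduct is $\Delta(E_i)=E_i\otimes K_i+1\otimes E_i$, $\Delta(F_i)=F_i\otimes 1+K_i^{-1}\otimes F_i$, $\Delta(K_i)=K_i\otimes K_i$. For $n\ge 0$ and $b\in\mathbb Z$ let $W_n(b)$ be the evaluation module: as a module over $\langle E_1,F_1,K_1^{\pm1}\rangle\cong U_q(\mathfrak{sl}_2)$ it is the $(n+1)$-dimensional irreducible module with $K_1$-eigenvalues $q^n,q^{n-2},\dots,q^{-n}$, and $E_0=q^bF_1$, $F_0=q^{-b}E_1$, $K_0=K_1^{-1}$.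 Let $V=\mathbb C^2$ with basis $v_1,v_2$, let $V(a)$ be $V$ with $E_1=E^{1,2}$, $F_1=E^{2,1}$, $K_1=q^{E^{1,1}-E^{2,2}}$, $E_0=q^aE^{2,1}$, $F_0=q^{-a}E^{1,2}$, $K_0=K_1^{-1}$, where $E^{i,k}$ are the matrix units ($E^{i,k}v_k=v_i$), and let $\pi^{(N)}_{a_1,\dots,a_N}$ be the action on $\otimes^N V=V(a_1)\otimes\dots\otimes V(a_N)$ given by the coproduct. Let $T$ act on $V\otimes V$ by $T(v_\alpha\otimes v_\beta)=q^2v_\alpha\otimes v_\beta$ if $\alpha=\beta$, $=q\,v_\beta\otimes v_\alpha$ if $\alpha<\beta$, $=q\,v_\beta\otimes v_\alpha+(q^2-1)v_\alpha\otimes v_\beta$ if $\alpha>\beta$; let $S=qT^{-1}$, let $S_{i,j}$ be $S$ acting in the tensor factors $i,j$ of $\otimes^NV$, let $P_{i,j}$ exchange these factors, and let $R_{i,j}(x)=\frac{xS_{i,j}^{-1}-S_{i,j}}{x-1}P_{i,j}$. Let $\theta=\langle m_1,\dots,m_r\rangle$ be the border strip with $r$ columns whose $i$-th column from the right has length $m_i\in\{1,2\}$.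 Put $N=\sum_{i=1}^r m_i$, $$a_{\,l+\sum_{i=j+1}^{r}m_i}=2\Bigl(l-1+\sum_{i=1}^{j-1}m_i\Bigr)\qquad(1\le j\le r,\ 1\le l\le m_j),$$ and $R_\theta=\prod_{1\le i<j\le N}R_{i,j}(q^{a_i-a_j})$, where the factor $(i,j)$ stands to the right of $(i',j')$ if $i<i'$, or if $i=i'$ and $j<j'$. With $m_0=m_{r+1}=2$, let $\{l_1<\dots<l_{r'}\}=\{i\in\{1,\dots,r\}: m_i=1,\ m_{i-1}=2\}$, let $n_i$ be the integer with $m_{l_i}=\dots=m_{l_i+n_i-1}=1$, $m_{l_i+n_i}=2$, and let $$b_i=2\sum_{j=1}^{l_i-1}m_j+n_i-1 .$$ Then $R_\theta\cdot\otimes^N\mathbb C^2$ is invariant under $\pi^{(N)}_{a_1,\dots,a_N}$, and the $U'_q(\widehat{\mathfrak{sl}}_2)$-module $(\pi^{(N)}_{a_1,\dots,a_N},\,R_\theta\cdot\otimes^N\mathbb C^2)$ is isomorphic to $W_{n_1}(b_1)\otimes W_{n_2}(b_2)\otimes\dots\otimes W_{n_{r'}}(b_{r'})$ (the trivial one-dimensional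 module if $r'=0$). -/

import Mathlib

open scoped TensorProduct

noncomputable section

namespace QAffine

/-- The `q`-integer `[n]_q`. -/
def qInt (q : ℂ) (n : ℤ) : ℂ := (q ^ n - q ^ (-n)) / (q - q⁻¹)

/-- The `q`-binomial coefficient `[n]_q [n-1]_q ⋯ [n-r+1]_q / ([r]_q ⋯ [1]_q)`. -/
def qBinom (q : ℂ) (n r : ℕ) : ℂ :=
  ∏ k ∈ Finset.range r, qInt q ((n : ℤ) - k) / qInt q ((k : ℤ) + 1)

/-- Generators `E_i`, `F_i`, `K_i`, `K_i⁻¹` with `i ∈ {0, 1}`. -/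
inductive Gen : Type
  | E (i : Fin 2)
  | F (i : Fin 2)
  | K (i : Fin 2)
  | Kinv (i : Fin 2)

/-- The Cartan matrix of affine type `A₁`. -/
def cartan (i j : Fin 2) : ℤ := if i = j then 2 else -2

/-- A generator as an element of the free algebra. -/
abbrev gen (g : Gen) : FreeAlgebra ℂ Gen := FreeAlgebra.ι ℂ g

/-- The defining relations of `U'_q` of affine `sl_2`. -/
inductive Rel (q : ℂ) : FreeAlgebra ℂ Gen → FreeAlgebra ℂ Gen → Prop
  | K_mul_Kinv (i : Fin 2) : Rel q (gen (.K i) * gen (.Kinv i)) 1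
  | Kinv_mul_K (i : Fin 2) : Rel q (gen (.Kinv i) * gen (.K i)) 1
  | K_comm (i j : Fin 2) : Rel q (gen (.K i) * gen (.K j)) (gen (.K j) * gen (.K i))
  | K_E (i j : Fin 2) :
      Rel q (gen (.K i) * gen (.E j) * gen (.Kinv i)) (q ^ cartan i j • gen (.E j))
  | K_F (i j : Fin 2) :
      Rel q (gen (.K i) * gen (.F j) * gen (.Kinv i)) (q ^ (-cartan i j) • gen (.F j))
  | E_F (i j : Fin 2) :
      Rel q (gen (.E i) * gen (.F j) - gen (.F j) * gen (.E i))
        (if i = j then (q - q⁻¹)⁻¹ • (gen (.K i) - gen (.Kinv i)) else 0)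
  | serre_E (i j : Fin 2) (h : i ≠ j) :
      Rel q (∑ r ∈ Finset.range 4,
        ((-1) ^ r * qBinom q 3 r) • (gen (.E i) ^ r * gen (.E j) * gen (.E i) ^ (3 - r))) 0
  | serre_F (i j : Fin 2) (h : i ≠ j) :
      Rel q (∑ r ∈ Finset.range 4,
        ((-1) ^ r * qBinom q 3 r) • (gen (.F i) ^ r * gen (.F j) * gen (.F i) ^ (3 - r))) 0

/-- The algebra `U'_q` of affine `sl_2`, by generators and relations. -/
abbrev UAff (q : ℂ) : Type := RingQuot (Rel q)

/-- The class of a generator in `U'_q`. -/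
def UAff.of (q : ℂ) (g : Gen) : UAff q := RingQuot.mkAlgHom ℂ (Rel q) (gen g)

/-- The evaluation module `W_n(b)` on `ℂ^{n+1}`, with basis `w_0, …, w_n`:
`K_1 w_k = q^{n-2k} w_k`, `F_1 w_k = [k+1] w_{k+1}`, `E_1 w_k = [n-k+1] w_{k-1}`
(the `(n+1)`-dimensional irreducible module of `U_q(sl_2)`), and
`E_0 = q^b F_1`, `F_0 = q^{-b} E_1`, `K_0 = K_1⁻¹`. -/
def evalAction (q : ℂ) (n : ℕ) (b : ℤ) : Gen → Module.End ℂ (Fin (n + 1) → ℂ) :=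
  let E₁ : Module.End ℂ (Fin (n + 1) → ℂ) := Matrix.toLin' (Matrix.of fun i j =>
    if (i : ℕ) + 1 = j then qInt q ((n : ℤ) - (i : ℕ)) else 0)
  let F₁ : Module.End ℂ (Fin (n + 1) → ℂ) := Matrix.toLin' (Matrix.of fun i j =>
    if (i : ℕ) = j + 1 then qInt q ((j : ℕ) + 1 : ℤ) else 0)
  let K₁ : Module.End ℂ (Fin (n + 1) → ℂ) :=
    Matrix.toLin' (Matrix.diagonal fun i => q ^ ((n : ℤ) - 2 * (i : ℕ)))
  let K₁inv : Module.End ℂ (Fin (n + 1) → ℂ) :=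
    Matrix.toLin' (Matrix.diagonal fun i => q ^ (-((n : ℤ) - 2 * (i : ℕ))))
  fun g => match g with
    | .E 0 => q ^ b • F₁
    | .E 1 => E₁
    | .F 0 => q ^ (-b) • E₁
    | .F 1 => F₁
    | .K 0 => K₁inv
    | .K 1 => K₁
    | .Kinv 0 => K₁
    | .Kinv 1 => K₁inv

/-- The evaluation action with parameter `a` on `V = ℂ²` (basis `v_1, v_2`), by matrix units
`E^{i,k} v_k = v_i`: `E_1 = E^{1,2}`, `F_1 = E^{2,1}`, `K_1 = q^{E^{1,1} - E^{2,2}}`,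
`E_0 = q^a E^{2,1}`, `F_0 = q^{-a} E^{1,2}`, `K_0 = K_1⁻¹`. -/
def vecAction (q : ℂ) (a : ℤ) : Gen → Module.End ℂ (Fin 2 → ℂ)
  | .E 0 => q ^ a • Matrix.toLin' !![0, 0; 1, 0]
  | .E 1 => Matrix.toLin' !![0, 1; 0, 0]
  | .F 0 => q ^ (-a) • Matrix.toLin' !![0, 1; 0, 0]
  | .F 1 => Matrix.toLin' !![0, 0; 1, 0]
  | .K 0 => Matrix.toLin' !![q⁻¹, 0; 0, q]
  | .K 1 => Matrix.toLin' !![q, 0; 0, q⁻¹]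
  | .Kinv 0 => Matrix.toLin' !![q, 0; 0, q⁻¹]
  | .Kinv 1 => Matrix.toLin' !![q⁻¹, 0; 0, q]

section Tensor

variable {ι : Type} [Fintype ι] [LinearOrder ι] {M : ι → Type}
  [∀ k, AddCommGroup (M k)] [∀ k, Module ℂ (M k)]

/-- The action of the generators on the tensor product, in the order of `ι`, of modules `M k`
through the iterated coproduct of `Δ(E_i) = E_i ⊗ K_i + 1 ⊗ E_i`,
`Δ(F_i) = F_i ⊗ 1 + K_i⁻¹ ⊗ F_i`, `Δ(K_i) = K_i ⊗ K_i`: that is,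
`E_i ↦ ∑_j 1 ⊗ ⋯ ⊗ 1 ⊗ E_i ⊗ K_i ⊗ ⋯ ⊗ K_i` and
`F_i ↦ ∑_j K_i⁻¹ ⊗ ⋯ ⊗ K_i⁻¹ ⊗ F_i ⊗ 1 ⊗ ⋯ ⊗ 1` (`E_i`, `F_i` in position `j`).
For empty `ι` this is the trivial module (the counit). -/
def tensorAction (A : ∀ k, Gen → Module.End ℂ (M k)) : Gen → Module.End ℂ (⨂[ℂ] k, M k)
  | .E i => ∑ j, PiTensorProduct.map fun k =>
      if k < j then 1 else if k = j then A k (.E i) else A k (.K i)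
  | .F i => ∑ j, PiTensorProduct.map fun k =>
      if k < j then A k (.Kinv i) else if k = j then A k (.F i) else 1
  | .K i => PiTensorProduct.map fun k => A k (.K i)
  | .Kinv i => PiTensorProduct.map fun k => A k (.Kinv i)

end Tensor

/-- The space `⊗^N V` with `V = ℂ²`. -/
abbrev TensorV (N : ℕ) : Type := ⨂[ℂ] (_ : Fin N), (Fin 2 → ℂ)

/-- The basis `v_{ε_1} ⊗ ⋯ ⊗ v_{ε_N}` of `⊗^N V`. -/
def stdBasis (N : ℕ) : Module.Basis (Fin N → Fin 2) ℂ (TensorV N) :=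
  Basis.piTensorProduct fun _ => Pi.basisFun ℂ (Fin 2)

/-- `π^{(N)}_{a_1, …, a_N}` on the generators. -/
def piAction (q : ℂ) {N : ℕ} (a : Fin N → ℤ) : Gen → Module.End ℂ (TensorV N) :=
  tensorAction fun k => vecAction q (a k)

/-- `P_{i,j}`: exchange of the tensor factors `i` and `j`. -/
def permOp {N : ℕ} (i j : Fin N) : Module.End ℂ (TensorV N) :=
  (stdBasis N).constr ℂ fun e => stdBasis N (e ∘ Equiv.swap i j)

/-- The Hecke operator `T` acting in the tensor factors `i, j` (in this order):
`v_α ⊗ v_β ↦ q² v_α ⊗ v_β` if `α = β`, `q v_β ⊗ v_α` if `α < β`, and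
`q v_β ⊗ v_α + (q² - 1) v_α ⊗ v_β` if `α > β`. -/
def heckeT (q : ℂ) {N : ℕ} (i j : Fin N) : Module.End ℂ (TensorV N) :=
  (stdBasis N).constr ℂ fun e =>
    if e i = e j then q ^ 2 • stdBasis N e
    else if e i < e j then q • stdBasis N (e ∘ Equiv.swap i j)
    else q • stdBasis N (e ∘ Equiv.swap i j) + (q ^ 2 - 1) • stdBasis N e

/-- `S_{i,j}⁻¹ = q⁻¹ T_{i,j}`. -/
def Sinv (q : ℂ) {N : ℕ} (i j : Fin N) : Module.End ℂ (TensorV N) := q⁻¹ • heckeT q i j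

/-- `S_{i,j} = q T_{i,j}⁻¹`, written through the Hecke relation `(T + 1)(T - q²) = 0`. -/
def Sop (q : ℂ) {N : ℕ} (i j : Fin N) : Module.End ℂ (TensorV N) :=
  Sinv q i j - (q - q⁻¹) • (1 : Module.End ℂ (TensorV N))

/-- The operators `Sop` and `Sinv` are inverse to each other. -/
theorem Sop_mul_Sinv (q : ℂ) (hq : q ≠ 0) {N : ℕ} (i j : Fin N) :
    Sop q i j * Sinv q i j = 1 ∧ Sinv q i j * Sop q i j = 1 := by
  have key : Sinv q i j * Sinv q i j - (q - q⁻¹) • Sinv q i j = 1 := by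
    refine (stdBasis N).ext fun e => ?_
    have hs : (e ∘ Equiv.swap i j) ∘ Equiv.swap i j = e := by
      funext k; simp
    have hi : (e ∘ Equiv.swap i j) i = e j := by simp
    have hj : (e ∘ Equiv.swap i j) j = e i := by simp
    rcases lt_trichotomy (e i) (e j) with h | h | h
    · simp only [Sinv, heckeT, LinearMap.sub_apply, Module.End.mul_apply, LinearMap.smul_apply,
        Module.Basis.constr_basis, map_smul, hi, hj, hs, h.ne, h.ne', h.not_gt, h, if_true,
        if_false, Module.End.one_apply]
      match_scalars <;> field_simp <;> ring
    · simp only [Sinv, heckeT, LinearMap.sub_apply, Module.End.mul_apply, LinearMap.smul_apply,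
        Module.Basis.constr_basis, map_smul, h, if_true, Module.End.one_apply]
      match_scalars
      field_simp
      ring
    · simp only [Sinv, heckeT, LinearMap.sub_apply, Module.End.mul_apply, LinearMap.smul_apply,
        Module.Basis.constr_basis, map_smul, map_add, hi, hj, hs, h.ne, h.ne', h.not_gt, h,
        if_true, if_false, Module.End.one_apply]
      match_scalars <;> field_simp <;> ring
  constructor
  · rw [Sop, @sub_mul (Module.End ℂ (TensorV N)) _, smul_mul_assoc, one_mul, key]
  · rw [Sop, @mul_sub (Module.End ℂ (TensorV N)) _, mul_smul_comm, mul_one, key]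

/-- `R_{i,j}(x) = (x S_{i,j}⁻¹ - S_{i,j}) / (x - 1) · P_{i,j}`. -/
def Rop (q : ℂ) {N : ℕ} (i j : Fin N) (x : ℂ) : Module.End ℂ (TensorV N) :=
  ((x - 1)⁻¹ • (x • Sinv q i j - Sop q i j)) * permOp i j

/-- The product of the `R_{i,j}(q^{a_i - a_j})` over `i < j`, where the factor `(i, j)` stands to
the right of `(i', j')` if `i < i'`, or if `i = i'` and `j < j'`. -/
def fusionR (q : ℂ) {N : ℕ} (a : Fin N → ℤ) : Module.End ℂ (TensorV N) :=
  ((List.finRange N).reverse.map fun i =>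
    (((List.finRange N).reverse.filter fun j => i < j).map fun j =>
      Rop q i j (q ^ (a i - a j))).prod).prod

/-- The parameters `a_1, …, a_N` of the border strip `⟨m_1, …, m_r⟩`. The boxes are numbered column
by column from the left (columns are counted from the right), downwards in each column. The
`l`-th box from the top of column `j` has number `l + ∑_{i > j} m_i` and parameter
`2 (l - 1 + ∑_{i < j} m_i)`. Below boxes are counted from `0`; exactly one summand is the
one of the column that holds box number `k`. -/
def stripParam {r : ℕ} (m : Fin r → ℕ) (k : Fin (∑ i, m i)) : ℤ :=
  ∑ j : Fin r, if ∑ i ∈ Finset.Ioi j, m i ≤ k ∧ (k : ℕ) < ∑ i ∈ Finset.Ioi j, m i + m j then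
    2 * (((k : ℕ) : ℤ) - ∑ i ∈ Finset.Ioi j, (m i : ℤ) + ∑ i ∈ Finset.Iio j, (m i : ℤ)) else 0

/-- The defining property of `stripParam`: its value on box `l` (from `0`) of column `j`. -/
theorem stripParam_apply {r : ℕ} (m : Fin r → ℕ) (j : Fin r) (l : ℕ) (hl : l < m j)
    (k : Fin (∑ i, m i)) (hk : (k : ℕ) = l + ∑ i ∈ Finset.Ioi j, m i) :
    stripParam m k = 2 * ((l : ℤ) + ∑ i ∈ Finset.Iio j, (m i : ℤ)) := by
  have mono : ∀ a b : Fin r, a < b →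
      ∑ i ∈ Finset.Ioi b, m i + m b ≤ ∑ i ∈ Finset.Ioi a, m i := by
    intro a b hab
    have hb : b ∉ Finset.Ioi b := by simp
    rw [add_comm, ← Finset.sum_insert hb]
    refine Finset.sum_le_sum_of_subset fun x hx => ?_
    rcases Finset.mem_insert.1 hx with rfl | hx
    · exact Finset.mem_Ioi.2 hab
    · exact Finset.mem_Ioi.2 (hab.trans (Finset.mem_Ioi.1 hx))
  rw [stripParam, Finset.sum_eq_single j]
  · rw [if_pos ⟨by omega, by omega⟩, hk]
    push_cast
    ring
  · intro b _ hb
    refine if_neg fun h => ?_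
    rcases lt_or_gt_of_ne hb with h' | h'
    · have := mono b j h'
      omega
    · have := mono j b h'
      omega
  · simp

/-- The set `{i | m_i = 1, m_{i-1} = 2}` of starting points of the maximal runs of `1`s, with the
convention `m_0 = 2`. -/
abbrev RunStart {r : ℕ} (m : Fin r → ℕ) : Type :=
  {i : Fin r // m i = 1 ∧ ∀ j : Fin r, (j : ℕ) + 1 = i → m j = 2}

/-- The length of the run of `1`s that starts at `l`. -/
def runLength {r : ℕ} (m : Fin r → ℕ) (l : Fin r) : ℕ :=
  (Finset.univ.filter fun k : Fin r => l ≤ k ∧ ∀ j, l ≤ j → j ≤ k → m j = 1).card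

/-- The defining property of `runLength`: the entries of the run are `1`, and the run is maximal. -/
theorem runLength_spec {r : ℕ} (m : Fin r → ℕ) (l : Fin r) :
    (l : ℕ) + runLength m l ≤ r ∧
    (∀ k : Fin r, l ≤ k → (k : ℕ) < l + runLength m l → m k = 1) ∧
    ∀ k : Fin r, (k : ℕ) = l + runLength m l → m k ≠ 1 := by
  classical
  set s := Finset.univ.filter fun k : Fin r => l ≤ k ∧ ∀ j, l ≤ j → j ≤ k → m j = 1 with hs
  have hcard : s.card = runLength m l := rfl
  have hmem : ∀ k, k ∈ s ↔ l ≤ k ∧ ∀ j, l ≤ j → j ≤ k → m j = 1 := by simp [hs]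
  have hsub : s ⊆ Finset.Ici l := fun k hk => Finset.mem_Ici.2 ((hmem k).1 hk).1
  have hr := Finset.card_le_card hsub
  rw [Fin.card_Ici, hcard] at hr
  have hin : ∀ k : Fin r, l ≤ k → (k : ℕ) < l + runLength m l → k ∈ s := by
    intro k hlk hk
    by_contra hks
    have hlt : s ⊆ Finset.Ico l k := by
      intro x hx
      have hx' := (hmem x).1 hx
      refine Finset.mem_Ico.2 ⟨hx'.1, ?_⟩
      by_contra hkx
      exact hks ((hmem k).2 ⟨hlk, fun j h1 h2 => hx'.2 j h1 (h2.trans (not_lt.1 hkx))⟩)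
    have := Finset.card_le_card hlt
    rw [Fin.card_Ico, hcard] at this
    have h' : (l : ℕ) ≤ k := hlk
    omega
  refine ⟨by have := l.2; omega, fun k hlk hk => ((hmem k).1 (hin k hlk hk)).2 k hlk le_rfl, ?_⟩
  intro k hk h1
  have hlk : l ≤ k := by
    rw [Fin.le_def]
    omega
  have hsup : Finset.Icc l k ⊆ s := by
    intro x hx
    obtain ⟨hlx, hxk⟩ := Finset.mem_Icc.1 hx
    rcases hxk.lt_or_eq with h | rfl
    · exact hin x hlx (by rw [← hk]; exact h)
    · refine (hmem x).2 ⟨hlx, fun j hj hjk => ?_⟩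
      rcases hjk.lt_or_eq with h | rfl
      · exact ((hmem j).1 (hin j hj (by rw [← hk]; exact h))).2 j hj le_rfl
      · exact h1
  have := Finset.card_le_card hsup
  rw [Fin.card_Icc, hcard] at this
  omega

/-- The evaluation parameter `2 ∑_{i < l} m_i + n - 1` of the run of length `n` that starts
at `l`. -/
def runParam {r : ℕ} (m : Fin r → ℕ) (l : Fin r) : ℤ :=
  2 * ∑ i ∈ Finset.Iio l, (m i : ℤ) + runLength m l - 1

end QAffine

end

open QAffine

set_option linter.unusedSectionVars false
set_option linter.unusedSimpArgs false
set_option linter.unnecessarySeqFocus false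

noncomputable section

/-! ### The relations of `U'_q` and the coproduct -/

namespace QAffine

/-! The operator `R_{i,j}(q^{a_i-a_j})` carries the action on `V(a_j) ⊗ V(a_i)` to the one on
`V(a_i) ⊗ V(a_j)`. Hence the fusion operator `R_θ` carries the tensor product in the reversed order
of factors to the given one (`fus_intertwine`), and its image is a submodule.

To identify the image, cut the strip into blocks: the maximal runs of columns of length one, and the
single columns of length two. The Yang-Baxter equation regroups `R_θ` as a product of cross factors
between different blocks, applied after the fusion operators of the blocks (`fus_append`,
`fus_allSites`). Along a run the parameters descend by 2, every adjacent factor is `R(q^2)`, and the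
image of the fusion operator is the space of `q`-symmetric tensors, a copy of `W_n(b)`
(`act_symWt`). A column of length two contributes `R(q^{-2})`, whose image is spanned by the
`q`-antisymmetric tensor, the trivial module (`act_pair`). So the image of the fusion operators of
all blocks is a copy of the tensor product of the `W_{n_i}(b_i)` (`BlockData.range_fusAll`). One
inclusion comes from the symmetry of the image. For the other, the highest weight vector is in the
image and the operators `F_1` of the single runs generate everything from it.

The cross factors are injective on that image (`keeps_crossAll`). `R(x)` is singular only at `x =
q^{±2}`, and two different runs are separated by a column of length two, which keeps `x` away from
these values. Against a column of length two single factors may be singular, but the two factors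
that meet the column multiply to a nonzero scalar on antisymmetric tensors (`rop_pair_right`,
`rop_pair_left`).

The cross factors also reverse the order of the blocks. Boxes are numbered from the left and columns
from the right, so the evaluation modules appear in the order `n_1, n_2, …`.

Everything is computed on functions of configurations, the coefficients in the standard basis. There
each tensor factor keeps its label, operators at different labels commute, and the order in the
coproduct is the order of a list of labels. -/

/-- The cubic `q`-Serre expression. -/
def serre {A : Type*} [Ring A] [Algebra ℂ A] (c : ℂ) (x y : A) : A :=
  y * x ^ 3 - c • (x * y * x ^ 2) + c • (x ^ 2 * y * x) - x ^ 3 * y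

/-- A family of elements indexed by the generators that satisfies the relations of `U'_q`. -/
structure IsRep {A : Type*} [Ring A] [Algebra ℂ A] (q : ℂ) (u : Gen → A) : Prop where
  K_Kinv : ∀ i, u (.K i) * u (.Kinv i) = 1
  Kinv_K : ∀ i, u (.Kinv i) * u (.K i) = 1
  K_comm : ∀ i j, u (.K i) * u (.K j) = u (.K j) * u (.K i)
  K_E : ∀ i j, u (.K i) * u (.E j) = q ^ cartan i j • (u (.E j) * u (.K i))
  K_F : ∀ i j, u (.K i) * u (.F j) = q ^ (-cartan i j) • (u (.F j) * u (.K i))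
  E_F : ∀ i j, u (.E i) * u (.F j) - u (.F j) * u (.E i) =
    if i = j then (q - q⁻¹)⁻¹ • (u (.K i) - u (.Kinv i)) else 0
  serre_E : ∀ i j, i ≠ j → serre (q ^ 2 + 1 + q⁻¹ ^ 2) (u (.E i)) (u (.E j)) = 0
  serre_F : ∀ i j, i ≠ j → serre (q ^ 2 + 1 + q⁻¹ ^ 2) (u (.F i)) (u (.F j)) = 0

/-- The action on a tensor product through the coproduct, for commuting actions `u` and `v`. -/
def coprod {A : Type*} [Ring A] (u v : Gen → A) : Gen → A
  | .E i => u (.E i) * v (.K i) + v (.E i)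
  | .F i => u (.F i) + u (.Kinv i) * v (.F i)
  | .K i => u (.K i) * v (.K i)
  | .Kinv i => u (.Kinv i) * v (.Kinv i)

/-- The trivial action. -/
def counit {A : Type*} [Ring A] : Gen → A
  | .E _ => 0
  | .F _ => 0
  | .K _ => 1
  | .Kinv _ => 1

section

variable {A : Type*} [Ring A] [Algebra ℂ A] {q : ℂ}

/-- This is the `q`-binomial mechanism behind the coproduct of a Serre relation: after the primed
letters are moved to the left, the coefficients of all mixed monomials cancel because the constant
is `[3]_q`. -/
theorem serre_add (hq : q ≠ 0) {x x' y y' : A} (hx : x * x' = q ^ 2 • (x' * x))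
    (hxy : x * y' = (q ^ 2)⁻¹ • (y' * x)) (hyx : y * x' = (q ^ 2)⁻¹ • (x' * y))
    (h : serre (q ^ 2 + 1 + q⁻¹ ^ 2) x y = 0) (h' : serre (q ^ 2 + 1 + q⁻¹ ^ 2) x' y' = 0) :
    serre (q ^ 2 + 1 + q⁻¹ ^ 2) (x + x') (y + y') = 0 := by
  have hx2 : ∀ z, x * (x' * z) = q ^ 2 • (x' * (x * z)) := fun z => by
    rw [← mul_assoc, hx, smul_mul_assoc, mul_assoc]
  have hxy2 : ∀ z, x * (y' * z) = (q ^ 2)⁻¹ • (y' * (x * z)) := fun z => by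
    rw [← mul_assoc, hxy, smul_mul_assoc, mul_assoc]
  have hyx2 : ∀ z, y * (x' * z) = (q ^ 2)⁻¹ • (x' * (y * z)) := fun z => by
    rw [← mul_assoc, hyx, smul_mul_assoc, mul_assoc]
  have key : serre (q ^ 2 + 1 + q⁻¹ ^ 2) (x + x') (y + y') =
      serre (q ^ 2 + 1 + q⁻¹ ^ 2) x y + serre (q ^ 2 + 1 + q⁻¹ ^ 2) x' y' := by
    simp only [serre, pow_succ, pow_zero, one_mul, mul_add, add_mul, mul_assoc, hx, hxy, hyx,
      hx2, hxy2, hyx2, smul_mul_assoc, mul_smul_comm, smul_add, smul_smul]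
    match_scalars <;> field_simp <;> ring
  rw [key, h, h', add_zero]

theorem serre_mul {c : ℂ} {x y k l : A} (hkl : k * l = l * k) (hkx : k * x = x * k)
    (hky : k * y = y * k) (hlx : l * x = x * l)
    (h : serre c x y = 0) : serre c (x * k) (y * l) = 0 := by
  have hkl2 : ∀ z, k * (l * z) = l * (k * z) := fun z => by simp only [← mul_assoc, hkl]
  have hkx2 : ∀ z, k * (x * z) = x * (k * z) := fun z => by simp only [← mul_assoc, hkx]
  have hky2 : ∀ z, k * (y * z) = y * (k * z) := fun z => by simp only [← mul_assoc, hky]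
  have hlx2 : ∀ z, l * (x * z) = x * (l * z) := fun z => by simp only [← mul_assoc, hlx]
  have key : serre c (x * k) (y * l) = serre c x y * (l * k ^ 3) := by
    simp only [serre, pow_succ, pow_zero, one_mul, add_mul, sub_mul, mul_assoc, hkx, hky,
      hlx, hkx2, hky2, hlx2, hkl, hkl2, smul_mul_assoc, mul_smul_comm]
  rw [key, h, zero_mul]

theorem cartan_symm (i j : Fin 2) : cartan i j = cartan j i := by
  simp [cartan, eq_comm]

theorem IsRep.E_Kinv {u : Gen → A} (h : IsRep q u) (i j : Fin 2) :
    u (.E j) * u (.Kinv i) = q ^ cartan i j • (u (.Kinv i) * u (.E j)) := by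
  have := congrArg (fun z => u (.Kinv i) * z * u (.Kinv i)) (h.K_E i j)
  simp only [mul_smul_comm, smul_mul_assoc] at this
  rw [← mul_assoc, h.Kinv_K, one_mul, mul_assoc, mul_assoc, h.K_Kinv, mul_one] at this
  exact this

theorem IsRep.F_Kinv {u : Gen → A} (h : IsRep q u) (i j : Fin 2) :
    u (.F j) * u (.Kinv i) = q ^ (-cartan i j) • (u (.Kinv i) * u (.F j)) := by
  have := congrArg (fun z => u (.Kinv i) * z * u (.Kinv i)) (h.K_F i j)
  simp only [mul_smul_comm, smul_mul_assoc] at this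
  rw [← mul_assoc, h.Kinv_K, one_mul, mul_assoc, mul_assoc, h.K_Kinv, mul_one] at this
  exact this

theorem IsRep.Kinv_comm {u : Gen → A} (h : IsRep q u) (i j : Fin 2) :
    u (.Kinv i) * u (.Kinv j) = u (.Kinv j) * u (.Kinv i) := by
  have e : ∀ i j, (u (.K j) * u (.K i)) * (u (.Kinv i) * u (.Kinv j)) = 1 := fun i j => by
    rw [mul_assoc, ← mul_assoc (u (.K i)), h.K_Kinv, one_mul, h.K_Kinv]
  have e' : ∀ i j, (u (.Kinv i) * u (.Kinv j)) * (u (.K j) * u (.K i)) = 1 := fun i j => by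
    rw [mul_assoc, ← mul_assoc (u (.Kinv j)), h.Kinv_K, one_mul, h.Kinv_K]
  exact left_inv_eq_right_inv (e' i j) (by rw [h.K_comm]; exact e j i)

theorem isRep_counit : IsRep q (counit : Gen → A) := by
  constructor <;> intros <;> simp [counit, serre]

theorem IsRep.coprod (hq : q ≠ 0) {u v : Gen → A} (hu : IsRep q u) (hv : IsRep q v)
    (hc : ∀ g g', u g * v g' = v g' * u g) : IsRep q (coprod u v) := by
  have c2 : ∀ g g' z, v g' * (u g * z) = u g * (v g' * z) := fun g g' z => by
    simp only [← mul_assoc, hc]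
  constructor
  · intro i
    simp only [QAffine.coprod]
    rw [mul_assoc, c2, hv.K_Kinv, mul_one, hu.K_Kinv]
  · intro i
    simp only [QAffine.coprod]
    rw [mul_assoc, c2, hv.Kinv_K, mul_one, hu.Kinv_K]
  · intro i j
    simp only [QAffine.coprod]
    rw [mul_assoc, c2, hv.K_comm, ← mul_assoc, hu.K_comm, mul_assoc, mul_assoc, c2]
  · intro i j
    simp only [QAffine.coprod, mul_add, add_mul, smul_add]
    congr 1
    · rw [mul_assoc, c2, ← mul_assoc, hu.K_E, hv.K_comm, smul_mul_assoc, mul_assoc, mul_assoc, c2]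
    · rw [mul_assoc, hv.K_E, mul_smul_comm, ← mul_assoc, hc, mul_assoc]
  · intro i j
    simp only [QAffine.coprod, mul_add, add_mul, smul_add]
    congr 1
    · rw [mul_assoc, ← hc, ← mul_assoc, hu.K_F, smul_mul_assoc, mul_assoc]
    · have : u (.K i) * u (.Kinv j) = u (.Kinv j) * u (.K i) := by
        have := congrArg (fun z => u (.Kinv j) * z * u (.Kinv j)) (hu.K_comm j i)
        rw [← mul_assoc, hu.Kinv_K, one_mul, mul_assoc, mul_assoc, hu.K_Kinv, mul_one] at this
        exact this
      rw [mul_assoc, c2, hv.K_F, ← mul_assoc, this, mul_smul_comm, mul_assoc,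
        mul_assoc, c2]
  · intro i j
    -- In the mixed commutator, moving `K_i` past `F_j` and `E_i` past `K_j⁻¹` produces inverse
    -- powers of `q`, so only the two unmixed commutators survive.
    have e : ∀ i j, u (.E i) * (u (.Kinv j) * (v (.K i) * v (.F j))) =
        u (.Kinv j) * (u (.E i) * (v (.F j) * v (.K i))) := fun i j => by
      rw [hv.K_F, ← mul_assoc, hu.E_Kinv, smul_mul_assoc, mul_smul_comm, smul_smul,
        cartan_symm j i, ← zpow_add₀ hq, add_neg_cancel, zpow_zero, one_smul, mul_assoc]
    have e1 := hu.E_F i j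
    have e2 := hv.E_F i j
    have e3 : (u (.E i) * v (.K i) + v (.E i)) * (u (.F j) + u (.Kinv j) * v (.F j)) -
        (u (.F j) + u (.Kinv j) * v (.F j)) * (u (.E i) * v (.K i) + v (.E i)) =
        (u (.E i) * u (.F j) - u (.F j) * u (.E i)) * v (.K i) +
        u (.Kinv j) * (v (.E i) * v (.F j) - v (.F j) * v (.E i)) := by
      simp only [mul_add, add_mul, mul_sub, sub_mul, mul_assoc, c2, e, ← hc]
      abel
    simp only [QAffine.coprod]
    rw [e3, e1, e2]
    split_ifs with h
    · subst h
      simp only [smul_mul_assoc, mul_smul_comm, ← smul_add]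
      congr 1
      noncomm_ring
    · simp
  · intro i j hij
    have cij : cartan i j = -2 := by simp [cartan, hij]
    have cji : cartan j i = -2 := by simp [cartan, hij.symm]
    have cii : cartan i i = 2 := by simp [cartan]
    simp only [QAffine.coprod]
    refine serre_add hq ?_ ?_ ?_ (serre_mul (hv.K_comm _ _) (hc _ _).symm (hc _ _).symm
      (hc _ _).symm (hu.serre_E i j hij)) (hv.serre_E i j hij)
    · rw [mul_assoc, hv.K_E, mul_smul_comm, ← mul_assoc, hc, mul_assoc, cii]; norm_cast
    · rw [mul_assoc, hv.K_E, mul_smul_comm, ← mul_assoc, hc, mul_assoc, cij, zpow_neg]; norm_cast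
    · rw [mul_assoc, hv.K_E, mul_smul_comm, ← mul_assoc, hc, mul_assoc, cji, zpow_neg]; norm_cast
  · intro i j hij
    have cij : cartan i j = -2 := by simp [cartan, hij]
    have cji : cartan j i = -2 := by simp [cartan, hij.symm]
    have cii : cartan i i = 2 := by simp [cartan]
    simp only [QAffine.coprod]
    -- The summands are exchanged because in `Δ(F)` it is the second one that must play the role of
    -- the unprimed letter in `serre_add`.
    rw [add_comm (u (.F i)), add_comm (u (.F j)), hc, hc]
    have e : ∀ i j, v (.F i) * u (.Kinv i) * u (.F j) = q ^ cartan i j •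
        (u (.F j) * (v (.F i) * u (.Kinv i))) := fun i j => by
      rw [mul_assoc, ← mul_assoc (u (.F j)), hc, mul_assoc, hu.F_Kinv, mul_smul_comm, smul_smul,
        ← zpow_add₀ hq, add_neg_cancel, zpow_zero, one_smul]
    refine serre_add hq ?_ ?_ ?_ (serre_mul (hu.Kinv_comm _ _) (hc _ _) (hc _ _)
      (hc _ _) (hv.serre_F i j hij)) (hu.serre_F i j hij)
    · rw [e, cii]; norm_cast
    · rw [e, cij, zpow_neg]; norm_cast
    · rw [e, cji, zpow_neg]; norm_cast

theorem coprod_assoc (u v w : Gen → A) : coprod (coprod u v) w = coprod u (coprod v w) := by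
  funext g
  cases g <;> simp [coprod, add_mul, mul_add, mul_assoc, add_assoc]

theorem counit_coprod (u : Gen → A) : coprod counit u = u := by
  funext g
  cases g <;> simp [coprod, counit]

theorem coprod_counit (u : Gen → A) : coprod u counit = u := by
  funext g
  cases g <;> simp [coprod, counit]

theorem coprod_intertwine {T : A} {u u' v v' : Gen → A} (hu : ∀ g, T * u g = u' g * T)
    (hv : ∀ g, T * v g = v' g * T) (g : Gen) : T * coprod u v g = coprod u' v' g * T := by
  cases g <;> simp only [coprod, mul_add, add_mul, ← mul_assoc, hu] <;>
    simp only [mul_assoc, hv]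

end

/-! ### Iterated coproducts over lists of tensor factors -/

section

variable {A : Type*} [Ring A] [Algebra ℂ A] {q : ℂ} {ι : Type*} (G : ι → Gen → A)

/-- The action on the tensor product of the modules `G i`, in the order of the list `L`. -/
def act : List ι → Gen → A
  | [] => counit
  | i :: L => coprod (G i) (act L)

@[simp] theorem act_nil : act G [] = counit := rfl

theorem act_cons (i : ι) (L : List ι) : act G (i :: L) = coprod (G i) (act G L) := rfl

theorem act_append (L L' : List ι) : act G (L ++ L') = coprod (act G L) (act G L') := by
  induction L with
  | nil => simp [counit_coprod]
  | cons i L ih => rw [List.cons_append, act_cons, ih, act_cons, coprod_assoc]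

theorem act_singleton (i : ι) : act G [i] = G i := by
  rw [act_cons, act_nil, coprod_counit]

theorem commute_act {T : A} {L : List ι} (h : ∀ i ∈ L, ∀ g, T * G i g = G i g * T) (g : Gen) :
    T * act G L g = act G L g * T := by
  induction L generalizing g with
  | nil => cases g <;> simp [counit]
  | cons i L ih =>
    exact coprod_intertwine (h i (by simp)) (ih fun j hj => h j (by simp [hj])) g

theorem isRep_act (hq : q ≠ 0) (hG : ∀ i, IsRep q (G i))
    (hc : ∀ i j, i ≠ j → ∀ g g', G i g * G j g' = G j g' * G i g) {L : List ι} (hL : L.Nodup) :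
    IsRep q (act G L) := by
  induction L with
  | nil => exact isRep_counit
  | cons i L ih =>
    obtain ⟨h1, h2⟩ := List.nodup_cons.1 hL
    refine (hG i).coprod hq (ih h2) fun g g' => ?_
    exact commute_act G (fun j hj g' => hc i j (fun h => h1 (h ▸ hj)) g g') g'

/-- If `T` exchanges the action in the order `M` for the one in the order `M'` and commutes with
the other tensor factors, it does so inside a longer tensor product. -/
theorem act_intertwine {T : A} {M M' : List ι} (h : ∀ g, T * act G M g = act G M' g * T)
    {L L' : List ι} (hL : ∀ i ∈ L, ∀ g, T * G i g = G i g * T)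
    (hL' : ∀ i ∈ L', ∀ g, T * G i g = G i g * T) (g : Gen) :
    T * act G (L ++ M ++ L') g = act G (L ++ M' ++ L') g * T := by
  rw [act_append, act_append, act_append, act_append]
  exact coprod_intertwine (coprod_intertwine (commute_act G hL) h) (commute_act G hL') g

end

/-! ### From the relations in commutator form to `U'_q` -/

section

variable {A : Type*} [Ring A] [Algebra ℂ A] {q : ℂ}

/-- The `q`-binomials are quotients of `q`-integers, so `[2]` and `[3]` must be nonzero; this
excludes roots of unity of order dividing 4 or 6. -/
theorem qBinom_three (hq : ∀ k : ℕ, 0 < k → q ^ k ≠ 1) (hq0 : q ≠ 0) :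
    qBinom q 3 0 = 1 ∧ qBinom q 3 1 = q ^ 2 + 1 + q⁻¹ ^ 2 ∧
    qBinom q 3 2 = q ^ 2 + 1 + q⁻¹ ^ 2 ∧ qBinom q 3 3 = 1 := by
  have h2 := hq 2 (by norm_num)
  have h4 := hq 4 (by norm_num)
  have h6 := hq 6 (by norm_num)
  have e0 : q - q⁻¹ ≠ 0 := fun h => h2 (by field_simp at h; linear_combination h)
  have e2 : q ^ 2 - q⁻¹ ^ 2 ≠ 0 := fun h => h4 (by field_simp at h; linear_combination h)
  have e3 : q ^ 3 - q⁻¹ ^ 3 ≠ 0 := fun h => h6 (by field_simp at h; linear_combination h)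
  have i1 : qInt q 1 = 1 := by simp [qInt, e0]
  have i2 : qInt q 2 ≠ 0 := by
    have : qInt q 2 = (q ^ 2 - q⁻¹ ^ 2) / (q - q⁻¹) := by rw [qInt, zpow_neg, inv_pow]; norm_cast
    rw [this]; exact div_ne_zero e2 e0
  have i3' : qInt q 3 = (q ^ 3 - q⁻¹ ^ 3) / (q - q⁻¹) := by
    rw [qInt, zpow_neg, inv_pow]; norm_cast
  have i3 : qInt q 3 ≠ 0 := by rw [i3']; exact div_ne_zero e3 e0
  have i3'' : qInt q 3 = q ^ 2 + 1 + q⁻¹ ^ 2 := by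
    rw [i3', div_eq_iff e0]; field_simp; ring
  rw [← i3'']
  refine ⟨by simp [qBinom], ?_, ?_, ?_⟩ <;>
    simp [qBinom, Finset.prod_range_succ] <;> norm_num [i1] <;> field_simp

theorem IsRep.lift_eq (hq : ∀ k : ℕ, 0 < k → q ^ k ≠ 1) (hq0 : q ≠ 0) {u : Gen → A}
    (hu : IsRep q u) {a b : FreeAlgebra ℂ Gen} (h : Rel q a b) :
    FreeAlgebra.lift ℂ u a = FreeAlgebra.lift ℂ u b := by
  obtain ⟨b0, b1, b2, b3⟩ := qBinom_three hq hq0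
  cases h with
  | K_mul_Kinv i => simp [hu.K_Kinv]
  | Kinv_mul_K i => simp [hu.Kinv_K]
  | K_comm i j => simp [hu.K_comm i j]
  | K_E i j => simp only [map_mul, map_smul, FreeAlgebra.lift_ι_apply]; rw [hu.K_E, smul_mul_assoc, mul_assoc, hu.K_Kinv, mul_one]
  | K_F i j => simp only [map_mul, map_smul, FreeAlgebra.lift_ι_apply]; rw [hu.K_F, smul_mul_assoc, mul_assoc, hu.K_Kinv, mul_one]
  | E_F i j =>
    have := hu.E_F i j
    split_ifs at this ⊢ <;> simp [this]
  | serre_E i j hij =>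
    have := hu.serre_E i j hij
    simp only [serre] at this
    simp only [Finset.sum_range_succ, Finset.sum_range_zero, map_add, map_smul, map_mul, map_pow,
      FreeAlgebra.lift_ι_apply, b0, b1, b2, b3, map_zero]
    refine Eq.trans ?_ this
    simp only [zero_add, Nat.sub_zero, Nat.reduceSub, Nat.sub_self, pow_zero, pow_one, one_mul, mul_one]
    module
  | serre_F i j hij =>
    have := hu.serre_F i j hij
    simp only [serre] at this
    simp only [Finset.sum_range_succ, Finset.sum_range_zero, map_add, map_smul, map_mul, map_pow,
      FreeAlgebra.lift_ι_apply, b0, b1, b2, b3, map_zero]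
    refine Eq.trans ?_ this
    simp only [zero_add, Nat.sub_zero, Nat.reduceSub, Nat.sub_self, pow_zero, pow_one, one_mul, mul_one]
    module

end

/-! ### Tensor products in coordinates -/

section Site

variable {ι : Type} [DecidableEq ι] {X : ι → Type} [∀ k, Fintype (X k)] [∀ k, DecidableEq (X k)]

/-- The operator on functions of configurations that acts by a matrix in the variable `k`. -/
def site (k : ι) (A : Matrix (X k) (X k) ℂ) : Module.End ℂ ((∀ k, X k) → ℂ) where
  toFun f e := ∑ y, A (e k) y * f (Function.update e k y)
  map_add' f g := by
    funext e
    simp [mul_add, Finset.sum_add_distrib]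
  map_smul' c f := by
    funext e
    simp [Finset.mul_sum, mul_left_comm]

theorem site_apply (k : ι) (A : Matrix (X k) (X k) ℂ) (f : (∀ k, X k) → ℂ) (e : ∀ k, X k) :
    site k A f e = ∑ y, A (e k) y * f (Function.update e k y) := rfl

theorem site_one (k : ι) : site k (1 : Matrix (X k) (X k) ℂ) = 1 := by
  ext1 f
  funext e
  simp [site_apply, Matrix.one_apply]

theorem site_mul (k : ι) (A B : Matrix (X k) (X k) ℂ) : site k (A * B) = site k A * site k B := by
  ext1 f
  funext e
  simp only [site_apply, Module.End.mul_apply, Matrix.mul_apply, Function.update_self,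
    Function.update_idem, Finset.mul_sum, Finset.sum_mul]
  rw [Finset.sum_comm]
  simp only [mul_assoc]

theorem site_add (k : ι) (A B : Matrix (X k) (X k) ℂ) : site k (A + B) = site k A + site k B := by
  ext1 f
  funext e
  simp [site_apply, add_mul, Finset.sum_add_distrib]

theorem site_smul (k : ι) (c : ℂ) (A : Matrix (X k) (X k) ℂ) :
    site k (c • A) = c • site k A := by
  ext1 f
  funext e
  simp [site_apply, mul_assoc, Finset.mul_sum]

/-- `site k` as an algebra homomorphism. -/
def siteHom (k : ι) : Matrix (X k) (X k) ℂ →ₐ[ℂ] Module.End ℂ ((∀ k, X k) → ℂ) :=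
  AlgHom.ofLinearMap
    { toFun := site k, map_add' := site_add k, map_smul' := site_smul k } (site_one k) (site_mul k)

theorem site_comm {k l : ι} (h : k ≠ l) (A : Matrix (X k) (X k) ℂ) (B : Matrix (X l) (X l) ℂ) :
    site k A * site l B = site l B * site k A := by
  ext1 f
  funext e
  simp only [site_apply, Module.End.mul_apply, Function.update_of_ne h, Function.update_of_ne h.symm,
    Finset.mul_sum]
  rw [Finset.sum_comm]
  refine Finset.sum_congr rfl fun y _ => Finset.sum_congr rfl fun z _ => ?_
  rw [Function.update_comm h, mul_left_comm]

variable [Fintype ι]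

theorem site_prod (k : ι) (A : Matrix (X k) (X k) ℂ) (v : ∀ k, X k → ℂ) :
    site k A (fun e => ∏ l, v l (e l)) =
      fun e => ∏ l, Function.update v k (A.mulVec (v k)) l (e l) := by
  funext e
  rw [site_apply, ← Finset.mul_prod_erase _ _ (Finset.mem_univ k), Function.update_self,
    Matrix.mulVec, dotProduct, Finset.sum_mul]
  refine Finset.sum_congr rfl fun y _ => ?_
  rw [← Finset.mul_prod_erase _ _ (Finset.mem_univ k), Function.update_self, mul_assoc]
  congr 2
  refine Finset.prod_congr rfl fun l hl => ?_
  rw [Function.update_of_ne (Finset.ne_of_mem_erase hl), Function.update_of_ne (Finset.ne_of_mem_erase hl)]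

/-- Pure tensors become products of functions of one variable; on these a product of operators at
distinct sites acts factor by factor. -/
theorem list_prod_site (A : ∀ k, Matrix (X k) (X k) ℂ) {L : List ι} (hL : L.Nodup)
    (v : ∀ k, X k → ℂ) :
    (L.map fun k => site k (A k)).prod (fun e => ∏ l, v l (e l)) =
      fun e => ∏ l, (if l ∈ L then (A l).mulVec (v l) else v l) (e l) := by
  induction L with
  | nil => simp
  | cons k L ih =>
    obtain ⟨h1, h2⟩ := List.nodup_cons.1 hL
    rw [List.map_cons, List.prod_cons, Module.End.mul_apply, ih h2,
      site_prod k (A k) (fun l => if l ∈ L then (A l).mulVec (v l) else v l)]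
    funext e
    refine Finset.prod_congr rfl fun l _ => ?_
    by_cases h : l = k
    · subst h; simp [h1]
    · simp [h, Function.update_of_ne h]

/-- Coordinates on a tensor product of coordinate spaces. -/
def coord (X : ι → Type) [∀ k, Fintype (X k)] [∀ k, DecidableEq (X k)] :
    (⨂[ℂ] k, (X k → ℂ)) ≃ₗ[ℂ] ((∀ k, X k) → ℂ) :=
  (Basis.piTensorProduct fun k => Pi.basisFun ℂ (X k)).equivFun

theorem coord_tprod (v : ∀ k, X k → ℂ) :
    coord X (PiTensorProduct.tprod ℂ v) = fun e => ∏ k, v k (e k) := by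
  funext e
  simp [coord, Module.Basis.equivFun_apply]

theorem coord_map (A : ∀ k, Matrix (X k) (X k) ℂ) {L : List ι} (hL : L.Nodup)
    (hL' : ∀ k, k ∈ L) (x : ⨂[ℂ] k, (X k → ℂ)) :
    coord X (PiTensorProduct.map (fun k => Matrix.toLin' (A k)) x) =
      (L.map fun k => site k (A k)).prod (coord X x) := by
  have : (coord X).toLinearMap ∘ₗ PiTensorProduct.map (fun k => Matrix.toLin' (A k)) =
      (L.map fun k => site k (A k)).prod ∘ₗ (coord X).toLinearMap := by
    refine PiTensorProduct.ext (MultilinearMap.ext fun v => ?_)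
    simp only [LinearMap.compMultilinearMap_apply, LinearMap.comp_apply, LinearEquiv.coe_coe,
      PiTensorProduct.map_tprod, coord_tprod, list_prod_site A hL]
    simp [hL']
  exact LinearMap.congr_fun this x

/-- The action at each site, in coordinates. -/
def local_ (A : ∀ k, Gen → Module.End ℂ (X k → ℂ)) (k : ι) (g : Gen) :
    Module.End ℂ ((∀ k, X k) → ℂ) :=
  site k (LinearMap.toMatrix' (A k g))

end Site

section

variable {A : Type*} [Ring A] [Algebra ℂ A] {ι : Type*} (G : ι → Gen → A)

theorem act_K (L : List ι) (i : Fin 2) : act G L (.K i) = (L.map fun k => G k (.K i)).prod := by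
  induction L with
  | nil => rfl
  | cons k L ih => simp [act_cons, coprod, ih]

theorem act_Kinv (L : List ι) (i : Fin 2) :
    act G L (.Kinv i) = (L.map fun k => G k (.Kinv i)).prod := by
  induction L with
  | nil => rfl
  | cons k L ih => simp [act_cons, coprod, ih]

variable [LinearOrder ι]

theorem act_E {L : List ι} (hL : L.Pairwise (· < ·)) (i : Fin 2) :
    act G L (.E i) = (L.map fun j => (L.map fun k =>
      if k < j then 1 else if k = j then G k (.E i) else G k (.K i)).prod).sum := by
  induction L with
  | nil => rfl
  | cons k L ih =>
    obtain ⟨h1, h2⟩ := List.pairwise_cons.1 hL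
    rw [act_cons, coprod, ih h2, act_K, List.map_cons, List.sum_cons]
    congr 1
    · rw [List.map_cons, List.prod_cons]
      simp only [lt_irrefl, if_false, if_true]
      congr 2
      refine List.map_congr_left fun l hl => ?_
      rw [if_neg (h1 l hl).not_gt, if_neg (h1 l hl).ne']
    · congr 1
      refine List.map_congr_left fun j hj => ?_
      rw [List.map_cons, List.prod_cons, if_pos (h1 j hj), one_mul]

theorem act_F {L : List ι} (hL : L.Pairwise (· < ·)) (i : Fin 2) :
    act G L (.F i) = (L.map fun j => (L.map fun k =>
      if k < j then G k (.Kinv i) else if k = j then G k (.F i) else 1).prod).sum := by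
  induction L with
  | nil => rfl
  | cons k L ih =>
    obtain ⟨h1, h2⟩ := List.pairwise_cons.1 hL
    rw [act_cons, coprod, ih h2, List.map_cons, List.sum_cons]
    congr 1
    · rw [List.map_cons, List.prod_cons]
      simp only [lt_irrefl, if_false, if_true]
      have : ∀ l ∈ L, (if l < k then G l (.Kinv i) else if l = k then G l (.F i) else 1) = 1 :=
        fun l hl => by rw [if_neg (h1 l hl).not_gt, if_neg (h1 l hl).ne']
      rw [List.map_congr_left this]
      simp
    · rw [← List.sum_map_mul_left]
      congr 1
      refine List.map_congr_left fun j hj => ?_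
      rw [List.map_cons, List.prod_cons, if_pos (h1 j hj)]

end

section

variable {ι : Type} [Fintype ι] [LinearOrder ι] {X : ι → Type} [∀ k, Fintype (X k)]
  [∀ k, DecidableEq (X k)]

theorem sum_list_eq {M : Type*} [AddCommMonoid M] {L : List ι} (hL : L.Nodup) (hL' : ∀ k, k ∈ L)
    (f : ι → M) : ∑ k, f k = (L.map f).sum := by
  rw [← List.sum_toFinset f hL]
  congr 1
  ext k
  simp [hL']

/-- Links the explicit sums in `tensorAction` with the recursive coproduct `act`, so that all later
arguments can be inductions on lists. -/
theorem coord_tensorAction (A : ∀ k, Gen → Module.End ℂ (X k → ℂ)) {L : List ι}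
    (hL : L.Pairwise (· < ·)) (hL' : ∀ k, k ∈ L) (g : Gen) (x : ⨂[ℂ] k, (X k → ℂ)) :
    coord X (tensorAction A g x) = act (local_ A) L g (coord X x) := by
  have hn : L.Nodup := hL.imp fun h => h.ne
  have key : ∀ B : ∀ k, Module.End ℂ (X k → ℂ), coord X (PiTensorProduct.map B x) =
      (L.map fun k => site k (LinearMap.toMatrix' (B k))).prod (coord X x) := fun B => by
    rw [← coord_map _ hn hL']
    simp
  have ap : ∀ (M : List ι) (T : ι → Module.End ℂ ((∀ k, X k) → ℂ)) (f : (∀ k, X k) → ℂ),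
      (M.map T).sum f = (M.map fun j => T j f).sum := fun M T f => by
    induction M with
    | nil => simp
    | cons k M ih => simp [ih]
  cases g with
  | K i => rw [tensorAction, key, act_K]; rfl
  | Kinv i => rw [tensorAction, key, act_Kinv]; rfl
  | E i =>
    rw [tensorAction, act_E _ hL, LinearMap.sum_apply, map_sum, sum_list_eq hn hL', ap]
    congr 1
    refine List.map_congr_left fun j _ => ?_
    rw [key]
    congr 2
    refine List.map_congr_left fun k _ => ?_
    split_ifs
    · rw [LinearMap.toMatrix'_one, site_one]
    · rfl
    · rfl
  | F i =>
    rw [tensorAction, act_F _ hL, LinearMap.sum_apply, map_sum, sum_list_eq hn hL', ap]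
    congr 1
    refine List.map_congr_left fun j _ => ?_
    rw [key]
    congr 2
    refine List.map_congr_left fun k _ => ?_
    split_ifs
    · rfl
    · rfl
    · rw [LinearMap.toMatrix'_one, site_one]

end

/-! ### The vector representation and the R-matrix in coordinates -/

/-- The action on `ℂ²` by matrices. -/
def vecMat (q : ℂ) (a : ℤ) : Gen → Matrix (Fin 2) (Fin 2) ℂ
  | .E 0 => q ^ a • !![0, 0; 1, 0]
  | .E 1 => !![0, 1; 0, 0]
  | .F 0 => q ^ (-a) • !![0, 1; 0, 0]
  | .F 1 => !![0, 0; 1, 0]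
  | .K 0 => !![q⁻¹, 0; 0, q]
  | .K 1 => !![q, 0; 0, q⁻¹]
  | .Kinv 0 => !![q, 0; 0, q⁻¹]
  | .Kinv 1 => !![q⁻¹, 0; 0, q]

theorem toMatrix_vecAction (q : ℂ) (a : ℤ) (g : Gen) :
    LinearMap.toMatrix' (vecAction q a g) = vecMat q a g := by
  rcases g with i | i | i | i <;> fin_cases i <;> simp [vecAction, vecMat]

theorem isRep_vecMat {q : ℂ} (hq : q ≠ 0) (hq2 : q ^ 2 ≠ 1) (a : ℤ) : IsRep q (vecMat q a) := by
  have h : q - q⁻¹ ≠ 0 := fun h => hq2 (by field_simp at h; linear_combination h)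
  have ha : q ^ a ≠ 0 := zpow_ne_zero _ hq
  constructor
  · intro i; fin_cases i <;> simp [vecMat, hq, Matrix.one_fin_two]
  · intro i; fin_cases i <;> simp [vecMat, hq, Matrix.one_fin_two]
  · intro i j; fin_cases i <;> fin_cases j <;> simp [vecMat, hq]
  · intro i j
    fin_cases i <;> fin_cases j <;> ext i j <;> fin_cases i <;> fin_cases j <;>
      simp [vecMat, cartan] <;> field_simp
  · intro i j
    fin_cases i <;> fin_cases j <;> ext i j <;> fin_cases i <;> fin_cases j <;>
      simp [vecMat, cartan] <;> field_simp
  · intro i j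
    fin_cases i <;> fin_cases j <;> ext i j <;> fin_cases i <;> fin_cases j <;>
      simp [vecMat, cartan, ha] <;> field_simp <;> ring
  · intro i j hij
    have : vecMat q a (.E i) ^ 2 = 0 := by
      fin_cases i <;> ext i j <;> fin_cases i <;> fin_cases j <;> simp [vecMat, pow_two]
    simp [serre, pow_succ _ 2, this]
  · intro i j hij
    have : vecMat q a (.F i) ^ 2 = 0 := by
      fin_cases i <;> ext i j <;> fin_cases i <;> fin_cases j <;> simp [vecMat, pow_two]
    simp [serre, pow_succ _ 2, this]

section

variable {ι : Type} [DecidableEq ι]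

/-- A matrix unit acting in the variable `k`. -/
abbrev unitAt (k : ι) (α β : Fin 2) : Module.End ℂ ((ι → Fin 2) → ℂ) :=
  site (X := fun _ => Fin 2) k (Matrix.single α β 1)

theorem unitAt_apply (k : ι) (α β : Fin 2) (f : (ι → Fin 2) → ℂ) (e : ι → Fin 2) :
    unitAt k α β f e = if e k = α then f (Function.update e k β) else 0 := by
  rw [site_apply]
  simp only [Matrix.single_apply]
  split_ifs with h
  · rw [Finset.sum_eq_single β]
    · simp [h]
    · intro b _ hb
      rw [if_neg (fun h' => hb h'.2.symm), zero_mul]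
    · simp
  · refine Finset.sum_eq_zero fun y _ => ?_
    rw [if_neg (fun h' => h h'.1.symm), zero_mul]

/-- The eigenvalue of `R(x)` on `v_α ⊗ v_α`. -/
def rDiag (q x : ℂ) : ℂ := (x * q - q⁻¹) / (x - 1)

/-- The off-diagonal coefficient of `R(x)`. -/
def rOff (q x : ℂ) : ℂ := (q - q⁻¹) / (x - 1)

/-- The operator `R_{i,j}(x)` on functions of configurations. -/
def rop (q x : ℂ) (i j : ι) : Module.End ℂ ((ι → Fin 2) → ℂ) :=
  rDiag q x • (unitAt i 0 0 * unitAt j 0 0 + unitAt i 1 1 * unitAt j 1 1) +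
    unitAt i 0 0 * unitAt j 1 1 + unitAt i 1 1 * unitAt j 0 0 +
    rOff q x • (unitAt i 0 1 * unitAt j 1 0) + (rOff q x * x) • (unitAt i 1 0 * unitAt j 0 1)

theorem commute_rop {T : Module.End ℂ ((ι → Fin 2) → ℂ)} {i j : ι}
    (hi : ∀ α β, T * unitAt i α β = unitAt i α β * T)
    (hj : ∀ α β, T * unitAt j α β = unitAt j α β * T) (q x : ℂ) :
    T * rop q x i j = rop q x i j * T := by
  have h : ∀ α β γ δ, T * (unitAt i α β * unitAt j γ δ) = (unitAt i α β * unitAt j γ δ) * T :=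
    fun α β γ δ => by rw [← mul_assoc, hi, mul_assoc, hj, mul_assoc]
  simp only [rop, mul_add, add_mul, mul_smul_comm, smul_mul_assoc, h]

theorem site_rop {i j k : ι} (hi : k ≠ i) (hj : k ≠ j) (A : Matrix (Fin 2) (Fin 2) ℂ) (q x : ℂ) :
    site (X := fun _ => Fin 2) k A * rop q x i j = rop q x i j * site (X := fun _ => Fin 2) k A :=
  commute_rop (fun _ _ => site_comm hi _ _) (fun _ _ => site_comm hj _ _) q x

theorem rop_comm {i j k l : ι} (hik : i ≠ k) (hil : i ≠ l) (hjk : j ≠ k) (hjl : j ≠ l)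
    (q x y : ℂ) : rop q x i j * rop q y k l = rop q y k l * rop q x i j :=
  commute_rop (fun _ _ => (site_rop hik.symm hjk.symm _ q x).symm)
    (fun _ _ => (site_rop hil.symm hjl.symm _ q x).symm) q y

theorem rop_apply (q x : ℂ) {i j : ι} (h : i ≠ j) (f : (ι → Fin 2) → ℂ) (e : ι → Fin 2) :
    rop q x i j f e = if e i = 0
      then (if e j = 0 then rDiag q x * f e
        else f e + rOff q x * f (Function.update (Function.update e i 1) j 0))
      else (if e j = 0 then f e + rOff q x * x * f (Function.update (Function.update e i 0) j 1)
        else rDiag q x * f e) := by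
  simp only [rop, LinearMap.add_apply, LinearMap.smul_apply, Module.End.mul_apply, Pi.add_apply,
    Pi.smul_apply, unitAt_apply, Function.update_of_ne h, Function.update_of_ne h.symm,
    smul_eq_mul]
  have e0 : ∀ α, e i = α → Function.update e i α = e := fun α h => by
    rw [← h, Function.update_eq_self]
  have e1 : ∀ α, e j = α → Function.update e j α = e := fun α h => by
    rw [← h, Function.update_eq_self]
  obtain hi | hi : e i = 0 ∨ e i = 1 := by omega
  all_goals obtain hj | hj : e j = 0 ∨ e j = 1 := by omega
  all_goals simp [hi, hj, e0 _ hi, e1 _ hj]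

/-- Configurations with prescribed values at two places. -/
theorem exists_slice₂ {i j : ι} (hij : i ≠ j) (e : ι → Fin 2) :
    ∃ S : Fin 2 → Fin 2 → ι → Fin 2, S (e i) (e j) = e ∧
      (∀ α β, S α β i = α) ∧ (∀ α β, S α β j = β) ∧
      (∀ α β x, Function.update (S α β) i x = S x β) ∧
      (∀ α β x, Function.update (S α β) j x = S α x) := by
  refine ⟨fun α β => Function.update (Function.update e i α) j β, by simp, ?_, ?_, ?_, ?_⟩
  · intro α β; simp [hij]
  · intro α β; simp
  · intro α β x; rw [Function.update_comm hij.symm]; simp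
  · intro α β x; simp

theorem exists_slice₃ {i j k : ι} (hij : i ≠ j) (hik : i ≠ k) (hjk : j ≠ k) (e : ι → Fin 2) :
    ∃ S : Fin 2 → Fin 2 → Fin 2 → ι → Fin 2, S (e i) (e j) (e k) = e ∧
      (∀ α β γ, S α β γ i = α) ∧ (∀ α β γ, S α β γ j = β) ∧ (∀ α β γ, S α β γ k = γ) ∧
      (∀ α β γ x, Function.update (S α β γ) i x = S x β γ) ∧
      (∀ α β γ x, Function.update (S α β γ) j x = S α x γ) ∧
      (∀ α β γ x, Function.update (S α β γ) k x = S α β x) := by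
  refine ⟨fun α β γ => Function.update (Function.update (Function.update e i α) j β) k γ, by simp,
    ?_, ?_, ?_, ?_, ?_, ?_⟩
  · intro α β γ; simp [hij, hik]
  · intro α β γ; simp [hjk]
  · intro α β γ; simp
  · intro α β γ x
    rw [Function.update_comm hik.symm, Function.update_comm hij.symm]; simp
  · intro α β γ x
    rw [Function.update_comm hjk.symm]; simp
  · intro α β γ x; simp

/-- Only the entries at `i`, `j`, `k` matter, so on a slice of eight configurations this is an
identity of rational functions for each of the eight values of the entries. -/
theorem yang_baxter {q x y : ℂ} (hq : q ≠ 0) (hx : x ≠ 1) (hy : y ≠ 1) (hxy : x * y ≠ 1)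
    {i j k : ι} (hij : i ≠ j) (hik : i ≠ k) (hjk : j ≠ k) :
    rop q y j k * (rop q (x * y) i k * rop q x i j) =
      rop q x i j * (rop q (x * y) i k * rop q y j k) := by
  ext1 f
  funext e
  obtain ⟨S, hS, s1, s2, s3, u1, u2, u3⟩ := exists_slice₃ hij hik hjk e
  rw [← hS]
  have hx' := sub_ne_zero.2 hx
  have hy' := sub_ne_zero.2 hy
  have hxy' := sub_ne_zero.2 hxy
  have hyx' : y * x - 1 ≠ 0 := by rwa [mul_comm]
  generalize e i = α
  generalize e j = β
  generalize e k = γ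
  clear hS
  simp only [Module.End.mul_apply, rop_apply q _ hij, rop_apply q _ hik, rop_apply q _ hjk,
    s1, s2, s3, u1, u2, u3]
  fin_cases α <;> fin_cases β <;> fin_cases γ <;> simp [rDiag, rOff] <;> field_simp <;> ring

/-- The fused R-matrix of `V` with the one-dimensional module spanned by the `q`-antisymmetric
tensor is a scalar. The scalar stays nonzero at points where one of the two factors alone is
singular. -/
theorem rop_pair_right {q x y : ℂ} (hq : q ≠ 0) (hx : x ≠ 1) (hy : y ≠ 1) (h : x = y * q ^ 2)
    {i j k : ι} (hij : i ≠ j) (hik : i ≠ k) (hjk : j ≠ k) {f : (ι → Fin 2) → ℂ}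
    (h0 : ∀ e, e j = e k → f e = 0)
    (h1 : ∀ e, e j = 1 → e k = 0 →
      f e = -q⁻¹ * f (Function.update (Function.update e j 0) k 1)) :
    rop q x i j (rop q y i k f) = rDiag q x • f := by
  funext e
  obtain ⟨S, hS, s1, s2, s3, u1, u2, u3⟩ := exists_slice₃ hij hik hjk e
  have h0' : ∀ α β, f (S α β β) = 0 := fun α β => h0 _ (by rw [s2, s3])
  have h1' : ∀ α, f (S α 1 0) = -q⁻¹ * f (S α 0 1) := fun α => by
    rw [h1 _ (s2 _ _ _) (s3 _ _ _), u2, u3]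
  rw [← hS]
  have hx' := sub_ne_zero.2 hx
  have hy' := sub_ne_zero.2 hy
  subst h
  have hc := hx'
  rw [mul_comm] at hc
  generalize e i = α
  generalize e j = β
  generalize e k = γ
  clear hS
  simp only [Pi.smul_apply, smul_eq_mul, rop_apply q _ hij, rop_apply q _ hik, s1, s2, s3, u1, u2, u3]
  fin_cases α <;> fin_cases β <;> fin_cases γ <;> simp [h0', h1', rDiag, rOff] <;>
    field_simp <;> ring

/-- The mirror image of `rop_pair_right`, with the antisymmetric pair on the left. -/
theorem rop_pair_left {q x y : ℂ} (hq : q ≠ 0) (hx : x ≠ 1) (hy : y ≠ 1) (h : y = x * q ^ 2)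
    {i j k : ι} (hij : i ≠ j) (hik : i ≠ k) (hjk : j ≠ k) {f : (ι → Fin 2) → ℂ}
    (h0 : ∀ e, e i = e j → f e = 0)
    (h1 : ∀ e, e i = 1 → e j = 0 →
      f e = -q⁻¹ * f (Function.update (Function.update e i 0) j 1)) :
    rop q y j k (rop q x i k f) = rDiag q y • f := by
  funext e
  obtain ⟨S, hS, s1, s2, s3, u1, u2, u3⟩ := exists_slice₃ hij hik hjk e
  have h0' : ∀ α γ, f (S α α γ) = 0 := fun α β => h0 _ (by rw [s1, s2])
  have h1' : ∀ γ, f (S 1 0 γ) = -q⁻¹ * f (S 0 1 γ) := fun α => by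
    rw [h1 _ (s1 _ _ _) (s2 _ _ _), u1, u2]
  rw [← hS]
  have hx' := sub_ne_zero.2 hx
  have hy' := sub_ne_zero.2 hy
  subst h
  have hc := hy'
  rw [mul_comm] at hc
  generalize e i = α
  generalize e j = β
  generalize e k = γ
  clear hS
  simp only [Pi.smul_apply, smul_eq_mul, rop_apply q _ hjk, rop_apply q _ hik, s1, s2, s3, u1, u2, u3]
  fin_cases α <;> fin_cases β <;> fin_cases γ <;> simp [h0', h1', rDiag, rOff] <;>
    field_simp <;> ring

theorem rop_injective {q x : ℂ} (hq : q ≠ 0) (hx : x ≠ 1) (h1 : x * q ^ 2 ≠ 1) (h2 : x ≠ q ^ 2)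
    {i j : ι} (hij : i ≠ j) : Function.Injective (rop q x i j) := by
  rw [← LinearMap.ker_eq_bot, LinearMap.ker_eq_bot']
  intro f hf
  funext e
  obtain ⟨S, hS, s1, s2, u1, u2⟩ := exists_slice₂ hij e
  have hx' := sub_ne_zero.2 hx
  have key : ∀ α β, rop q x i j f (S α β) = 0 := fun α β => by rw [hf]; rfl
  have hd : rDiag q x ≠ 0 := by
    refine div_ne_zero (fun h => h1 ?_) hx'
    field_simp at h
    linear_combination h
  have k00 := key 0 0
  have k01 := key 0 1
  have k10 := key 1 0
  have k11 := key 1 1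
  simp only [rop_apply q _ hij, s1, s2, u1, u2] at k00 k01 k10 k11
  simp [hd] at k00 k01 k10 k11
  -- Up to the factor `q^2 (x - 1)^2`, this is the determinant of `R(x)` on the span of `v_1 ⊗ v_2`
  -- and `v_2 ⊗ v_1`.
  have hdet : (x - q ^ 2) * (x * q ^ 2 - 1) ≠ 0 :=
    mul_ne_zero (sub_ne_zero.2 h2) (sub_ne_zero.2 h1)
  have d : f (S 0 1) = 0 := by
    have : (x - q ^ 2) * (x * q ^ 2 - 1) * f (S 0 1) = 0 := by
      simp only [rOff] at k01 k10
      field_simp at k01 k10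
      linear_combination q * (x - 1) * k01 - (q ^ 2 - 1) * k10
    exact (mul_eq_zero.1 this).resolve_left hdet
  have d' : f (S 1 0) = 0 := by rw [d] at k10; simpa using k10
  rw [← hS]
  rw [Pi.zero_apply]
  generalize e i = α
  generalize e j = β
  fin_cases α <;> fin_cases β
  exacts [k00, d, d', k11]

end

section

variable {ι : Type} [DecidableEq ι] (q : ℂ) (a : ι → ℤ)

/-- The actions of the generators on the tensor factors of `V(a_1) ⊗ ⋯ ⊗ V(a_N)`, on functions of
configurations. -/
def vecSite (k : ι) (g : Gen) : Module.End ℂ ((ι → Fin 2) → ℂ) :=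
  site (X := fun _ => Fin 2) k (vecMat q (a k) g)

theorem vecSite_comm {k l : ι} (h : k ≠ l) (g g' : Gen) :
    vecSite q a k g * vecSite q a l g' = vecSite q a l g' * vecSite q a k g :=
  site_comm h _ _

theorem isRep_vecSite {q : ℂ} (hq : q ≠ 0) (hq2 : q ^ 2 ≠ 1) (k : ι) :
    IsRep q (vecSite q a k) := by
  have h := isRep_vecMat hq hq2 (a k)
  let φ := siteHom (X := fun _ : ι => Fin 2) k
  have e : vecSite q a k = fun g => φ (vecMat q (a k) g) := rfl
  rw [e]
  constructor
  · intro i; rw [← map_mul, h.K_Kinv, map_one]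
  · intro i; rw [← map_mul, h.Kinv_K, map_one]
  · intro i j; rw [← map_mul, h.K_comm, map_mul]
  · intro i j; rw [← map_mul, h.K_E, map_smul, map_mul]
  · intro i j; rw [← map_mul, h.K_F, map_smul, map_mul]
  · intro i j
    rw [← map_mul, ← map_mul, ← map_sub, h.E_F]
    split_ifs <;> simp
  · intro i j hij
    have := congrArg φ (h.serre_E i j hij)
    simpa [serre] using this
  · intro i j hij
    have := congrArg φ (h.serre_F i j hij)
    simpa [serre] using this

/-- `R_{i,j}(q^{a_i - a_j})` on functions of configurations. -/
def rr (i j : ι) : Module.End ℂ ((ι → Fin 2) → ℂ) := rop q (q ^ (a i - a j)) i j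

/-- The defining property of the R-matrix: it exchanges the two orders of the coproduct. It is
checked generator by generator on the four configurations of a slice. -/
theorem rr_intertwine {q : ℂ} (hq : q ≠ 0) {i j : ι} (hij : i ≠ j) (hx : q ^ (a i - a j) ≠ 1)
    (g : Gen) :
    rr q a i j * act (vecSite q a) [j, i] g = act (vecSite q a) [i, j] g * rr q a i j := by
  rw [act_cons, act_singleton, act_cons, act_singleton]
  ext1 f
  funext e
  obtain ⟨S, hS, s1, s2, u1, u2⟩ := exists_slice₂ hij e
  rw [← hS]
  have hx' : q ^ a i - q ^ a j ≠ 0 := by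
    rw [zpow_sub₀ hq] at hx
    refine fun h => hx ?_
    rw [sub_eq_zero.1 h, div_self (zpow_ne_zero _ hq)]
  have hi : q ^ a i ≠ 0 := zpow_ne_zero _ hq
  have hj : q ^ a j ≠ 0 := zpow_ne_zero _ hq
  have hd : rDiag q (q ^ (a i - a j)) = (q ^ a i * q - q ^ a j * q⁻¹) / (q ^ a i - q ^ a j) := by
    rw [rDiag, zpow_sub₀ hq]; field_simp
  have ho : rOff q (q ^ (a i - a j)) = (q - q⁻¹) * q ^ a j / (q ^ a i - q ^ a j) := by
    rw [rOff, zpow_sub₀ hq]; field_simp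
  generalize e i = α
  generalize e j = β
  clear hS
  simp only [rr]
  rcases g with g | g | g | g <;> fin_cases g <;>
    simp only [coprod, vecSite, Module.End.mul_apply, LinearMap.add_apply, Pi.add_apply,
      rop_apply q _ hij, site_apply, s1, s2, u1, u2, Fin.sum_univ_two, hd, ho] <;>
    fin_cases α <;> fin_cases β <;> simp [vecMat, zpow_sub₀ hq] <;>
    (try field_simp) <;> (try ring)

end

/-! ### Ordered products of R-matrices and the fusion operator -/

theorem zpow_ne_one {q : ℂ} (hq : ∀ k : ℕ, 0 < k → q ^ k ≠ 1) {d : ℤ} (hd : d ≠ 0) :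
    q ^ d ≠ 1 := by
  obtain ⟨n, rfl | rfl⟩ := d.eq_nat_or_neg
  · rw [zpow_natCast]; exact hq n (by omega)
  · rw [zpow_neg, zpow_natCast, Ne, inv_eq_one]; exact hq n (by omega)

section

variable {ι : Type} [DecidableEq ι] (q : ℂ) (a : ι → ℤ)

/-- `T` acts only in the tensor factors in `S`. -/
def LocalOn (S : List ι) (T : Module.End ℂ ((ι → Fin 2) → ℂ)) : Prop :=
  ∀ k ∉ S, ∀ A, T * site (X := fun _ => Fin 2) k A = site (X := fun _ => Fin 2) k A * T

variable {q a} in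
theorem LocalOn.mul {S : List ι} {T T' : Module.End ℂ ((ι → Fin 2) → ℂ)} (h : LocalOn S T)
    (h' : LocalOn S T') : LocalOn S (T * T') := fun k hk A => by
  rw [mul_assoc, h' k hk, ← mul_assoc, h k hk, mul_assoc]

theorem LocalOn.one (S : List ι) : LocalOn S (1 : Module.End ℂ ((ι → Fin 2) → ℂ)) :=
  fun _ _ _ => by rw [one_mul, mul_one]

theorem localOn_rr {i j : ι} {S : List ι} (hi : i ∈ S) (hj : j ∈ S) : LocalOn S (rr q a i j) :=
  fun k hk A => (site_rop (by rintro rfl; exact hk hi) (by rintro rfl; exact hk hj) A q _).symm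

variable {q a} in
theorem LocalOn.rr {S : List ι} {T : Module.End ℂ ((ι → Fin 2) → ℂ)} (h : LocalOn S T) {i j : ι}
    (hi : i ∉ S) (hj : j ∉ S) : T * rr q a i j = rr q a i j * T :=
  commute_rop (fun _ _ => h i hi _) (fun _ _ => h j hj _) _ _

/-- The product of the `R_{i,j}` over `j` in a list, the first factor on the right. -/
def rowR (i : ι) : List ι → Module.End ℂ ((ι → Fin 2) → ℂ)
  | [] => 1
  | j :: L => rowR i L * rr q a i j

/-- The product of the `R_{i,j}` over `j` in a list, the first factor on the left. -/
def rowL (i : ι) : List ι → Module.End ℂ ((ι → Fin 2) → ℂ)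
  | [] => 1
  | j :: L => rr q a i j * rowL i L

/-- The fusion operator of the tensor factors in a list. -/
def fus : List ι → Module.End ℂ ((ι → Fin 2) → ℂ)
  | [] => 1
  | i :: L => fus L * rowR q a i L

/-- The product of the `R_{i,j}` with `i` in the first and `j` in the second list. -/
def cross : List ι → List ι → Module.End ℂ ((ι → Fin 2) → ℂ)
  | [], _ => 1
  | i :: L, L' => cross L L' * rowL q a i L'

theorem rowR_append (i : ι) (L L' : List ι) :
    rowR q a i (L ++ L') = rowR q a i L' * rowR q a i L := by
  induction L with
  | nil => simp [rowR]
  | cons j L ih => rw [List.cons_append, rowR, ih, rowR, mul_assoc]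

theorem rowL_append (i : ι) (L L' : List ι) :
    rowL q a i (L ++ L') = rowL q a i L * rowL q a i L' := by
  induction L with
  | nil => simp [rowL]
  | cons j L ih => rw [List.cons_append, rowL, ih, rowL, mul_assoc]

theorem localOn_rowR {i : ι} {L S : List ι} (hi : i ∈ S) (hL : L ⊆ S) :
    LocalOn S (rowR q a i L) := by
  induction L with
  | nil => exact .one S
  | cons j L ih =>
    rw [List.cons_subset] at hL
    exact (ih hL.2).mul (localOn_rr q a hi hL.1)

theorem localOn_rowL {i : ι} {L S : List ι} (hi : i ∈ S) (hL : L ⊆ S) :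
    LocalOn S (rowL q a i L) := by
  induction L with
  | nil => exact .one S
  | cons j L ih =>
    rw [List.cons_subset] at hL
    exact (localOn_rr q a hi hL.1).mul (ih hL.2)

theorem localOn_fus {L S : List ι} (hL : L ⊆ S) : LocalOn S (fus q a L) := by
  induction L with
  | nil => exact .one S
  | cons j L ih =>
    rw [List.cons_subset] at hL
    exact (ih hL.2).mul (localOn_rowR q a hL.1 hL.2)

variable {q a}

theorem LocalOn.rowR {S : List ι} {T : Module.End ℂ ((ι → Fin 2) → ℂ)} (h : LocalOn S T) {i : ι}
    {L : List ι} (hi : i ∉ S) (hL : ∀ j ∈ L, j ∉ S) :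
    T * rowR q a i L = rowR q a i L * T := by
  induction L with
  | nil => rw [QAffine.rowR, mul_one, one_mul]
  | cons j L ih =>
    rw [QAffine.rowR, ← mul_assoc, ih fun k hk => hL k (by simp [hk]), mul_assoc,
      h.rr hi (hL j (by simp)), mul_assoc]

theorem LocalOn.fus {S : List ι} {T : Module.End ℂ ((ι → Fin 2) → ℂ)} (h : LocalOn S T)
    {L : List ι} (hL : ∀ j ∈ L, j ∉ S) :
    T * fus q a L = fus q a L * T := by
  induction L with
  | nil => rw [QAffine.fus, mul_one, one_mul]
  | cons j L ih =>
    rw [QAffine.fus, ← mul_assoc, ih fun k hk => hL k (by simp [hk]), mul_assoc,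
      h.rowR (hL j (by simp)) fun k hk => hL k (by simp [hk]), mul_assoc]

theorem LocalOn.vecSite {S : List ι} {T : Module.End ℂ ((ι → Fin 2) → ℂ)} (h : LocalOn S T) {k : ι}
    (hk : k ∉ S) (g : Gen) : T * vecSite q a k g = vecSite q a k g * T := h k hk _

section

variable (hq : q ≠ 0) (hx : ∀ i j, i ≠ j → q ^ (a i - a j) ≠ 1)
include hq hx

theorem yang_baxter_rr {i j k : ι} (hij : i ≠ j) (hik : i ≠ k) (hjk : j ≠ k) :
    rr q a j k * (rr q a i k * rr q a i j) = rr q a i j * (rr q a i k * rr q a j k) := by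
  have h : q ^ (a i - a k) = q ^ (a i - a j) * q ^ (a j - a k) := by
    rw [← zpow_add₀ hq]; congr 1; ring
  have := hx _ _ hik
  simp only [rr]
  rw [h] at this ⊢
  exact yang_baxter hq (hx _ _ hij) (hx _ _ hjk) this hij hik hjk

/-- The Yang-Baxter equation iterated along `L`: the factor `R_{i,j}` passes through both rows and
exchanges them. -/
theorem rowR_rowR {i j : ι} {L : List ι} (hij : i ≠ j) (hi : i ∉ L) (hj : j ∉ L)
    (hL : L.Nodup) :
    rowR q a j L * (rowR q a i L * rr q a i j) = rr q a i j * (rowR q a i L * rowR q a j L) := by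
  induction L with
  | nil => simp [rowR]
  | cons k L ih =>
    rw [List.mem_cons, not_or] at hi hj
    obtain ⟨h1, h2⟩ := List.nodup_cons.1 hL
    have c : rr q a j k * rowR q a i L = rowR q a i L * rr q a j k :=
      (localOn_rr q a (S := [j, k]) (by simp) (by simp)).rowR (by simp [hij, hi.1])
        fun l hl => by
          simp only [List.mem_cons, List.not_mem_nil, or_false, not_or]
          exact ⟨fun h => hj.2 (h ▸ hl), fun h => h1 (h ▸ hl)⟩
    have c' : rr q a i k * rowR q a j L = rowR q a j L * rr q a i k :=
      (localOn_rr q a (S := [i, k]) (by simp) (by simp)).rowR (by simp [hij.symm, hj.1])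
        fun l hl => by
          simp only [List.mem_cons, List.not_mem_nil, or_false, not_or]
          exact ⟨fun h => hi.2 (h ▸ hl), fun h => h1 (h ▸ hl)⟩
    calc rowR q a j (k :: L) * (rowR q a i (k :: L) * rr q a i j)
        = rowR q a j L * ((rr q a j k * rowR q a i L) * (rr q a i k * rr q a i j)) := by
          simp only [rowR, mul_assoc]
      _ = rowR q a j L * (rowR q a i L * (rr q a j k * (rr q a i k * rr q a i j))) := by
          rw [c, mul_assoc]
      _ = (rowR q a j L * (rowR q a i L * rr q a i j)) * (rr q a i k * rr q a j k) := by
          rw [yang_baxter_rr hq hx hij hi.1 hj.1]; simp only [mul_assoc]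
      _ = rr q a i j * (rowR q a i L * ((rowR q a j L * rr q a i k) * rr q a j k)) := by
          rw [ih hi.2 hj.2 h2]; simp only [mul_assoc]
      _ = _ := by rw [← c']; simp only [rowR, mul_assoc]

/-- Moving the fusion operator of `L` through a row reverses the order of the factors of the row.
This is why both `rowR` and `rowL` are needed. -/
theorem fus_rowR {i : ι} {L : List ι} (hi : i ∉ L) (hL : L.Nodup) :
    fus q a L * rowR q a i L = rowL q a i L * fus q a L := by
  induction L with
  | nil => simp [rowL, rowR]
  | cons j L ih =>
    rw [List.mem_cons, not_or] at hi
    obtain ⟨h1, h2⟩ := List.nodup_cons.1 hL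
    have c : rr q a i j * fus q a L = fus q a L * rr q a i j :=
      (localOn_rr q a (S := [i, j]) (by simp) (by simp)).fus
        fun l hl => by
          simp only [List.mem_cons, List.not_mem_nil, or_false, not_or]
          exact ⟨fun h => hi.2 (h ▸ hl), fun h => h1 (h ▸ hl)⟩
    calc fus q a (j :: L) * rowR q a i (j :: L)
        = fus q a L * (rowR q a j L * (rowR q a i L * rr q a i j)) := by
          simp only [fus, rowR, mul_assoc]
      _ = (fus q a L * rr q a i j) * (rowR q a i L * rowR q a j L) := by
          rw [rowR_rowR hq hx hi.1 hi.2 h1 h2, mul_assoc]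
      _ = rr q a i j * ((fus q a L * rowR q a i L) * rowR q a j L) := by
          rw [← c]; simp only [mul_assoc]
      _ = _ := by rw [ih hi.2 h2]; simp only [fus, rowL, mul_assoc]

/-- Each row of `L` splits into a part inside `L` and a part towards `L'`; the latter is pulled to
the left through `fus L` (disjoint factors) and through `fus L'` (by `fus_rowR`). -/
theorem fus_append {L L' : List ι} (h : (L ++ L').Nodup) :
    fus q a (L ++ L') = cross q a L L' * (fus q a L' * fus q a L) := by
  induction L with
  | nil => simp [cross, fus]
  | cons i L ih =>
    rw [List.cons_append, List.nodup_cons, List.mem_append, not_or] at h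
    obtain ⟨⟨h1, h2⟩, h3⟩ := h
    obtain ⟨h4, h5, h6⟩ := List.nodup_append.1 h3
    have c : fus q a L * rowR q a i L' = rowR q a i L' * fus q a L :=
      (localOn_fus q a (List.Subset.refl L)).rowR h1 fun j hj hj' => h6 j hj' j hj rfl
    calc fus q a (i :: L ++ L')
        = cross q a L L' * (fus q a L' * ((fus q a L * rowR q a i L') * rowR q a i L)) := by
          rw [List.cons_append, fus, ih h3, rowR_append]; simp only [mul_assoc]
      _ = cross q a L L' * ((fus q a L' * rowR q a i L') * (fus q a L * rowR q a i L)) := by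
          rw [c]; simp only [mul_assoc]
      _ = _ := by rw [fus_rowR hq hx h2 h5]; simp only [cross, fus, mul_assoc]

/-- An adjacent factor can be brought to the far left, so the image of the fusion operator lies in
the image of every adjacent `R`. -/
theorem exists_fus_eq {j k : ι} {L L' : List ι} (h : (L ++ j :: k :: L').Nodup) :
    ∃ T, fus q a (L ++ j :: k :: L') = rr q a j k * T := by
  induction L with
  | nil =>
    simp only [List.nil_append, List.nodup_cons, List.mem_cons, not_or] at h
    obtain ⟨⟨h1, h2⟩, h3, h4⟩ := h
    have c : rr q a j k * fus q a L' = fus q a L' * rr q a j k :=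
      (localOn_rr q a (S := [j, k]) (by simp) (by simp)).fus
        fun l hl => by
          simp only [List.mem_cons, List.not_mem_nil, or_false, not_or]
          exact ⟨fun h => h2 (h ▸ hl), fun h => h3 (h ▸ hl)⟩
    refine ⟨fus q a L' * (rowR q a j L' * rowR q a k L'), ?_⟩
    rw [← mul_assoc, c, mul_assoc, ← rowR_rowR hq hx h1 h2 h3 h4]
    simp only [List.nil_append, fus, rowR, mul_assoc]
  | cons i L ih =>
    obtain ⟨T, hT⟩ := ih (List.nodup_cons.1 h).2
    exact ⟨T * rowR q a i (L ++ j :: k :: L'), by rw [List.cons_append, fus, hT, mul_assoc]⟩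

/-- The row moves the factor `i` from the last place to the first, one exchange at a time. -/
theorem rowR_intertwine {i : ι} {L : List ι} (hi : i ∉ L) (hL : L.Nodup) (g : Gen) :
    rowR q a i L * act (vecSite q a) (L.reverse ++ [i]) g =
      act (vecSite q a) (i :: L.reverse) g * rowR q a i L := by
  induction L generalizing g with
  | nil => simp [rowR]
  | cons j L ih =>
    rw [List.mem_cons, not_or] at hi
    obtain ⟨h1, h2⟩ := List.nodup_cons.1 hL
    have e := act_intertwine (vecSite q a) (T := rr q a i j) (M := [j, i]) (M' := [i, j])
      (rr_intertwine a hq hi.1 (hx _ _ hi.1)) (L := L.reverse) (L' := []) (fun k hk g =>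
        (localOn_rr q a (S := [i, j]) (by simp) (by simp)).vecSite (by
          rw [List.mem_reverse] at hk
          simp only [List.mem_cons, List.not_mem_nil, or_false, not_or]
          exact ⟨fun h => hi.2 (h ▸ hk), fun h => h1 (h ▸ hk)⟩) g) (by simp)
    have e' := act_intertwine (vecSite q a) (T := rowR q a i L) (ih hi.2 h2) (L := []) (L' := [j])
      (by simp) (fun k hk g => (localOn_rowR q a (S := i :: L) (by simp) (by simp)).vecSite (by
        rw [List.mem_singleton] at hk
        subst hk
        simp [Ne.symm hi.1, h1]) g)
    simp only [List.append_assoc, List.cons_append, List.nil_append, List.append_nil] at e e'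
    rw [rowR, mul_assoc, List.reverse_cons, List.append_assoc, List.cons_append, List.nil_append,
      e, ← mul_assoc, e', mul_assoc]

theorem fus_intertwine {L : List ι} (hL : L.Nodup) (g : Gen) :
    fus q a L * act (vecSite q a) L.reverse g = act (vecSite q a) L g * fus q a L := by
  induction L generalizing g with
  | nil => simp [fus]
  | cons i L ih =>
    obtain ⟨h1, h2⟩ := List.nodup_cons.1 hL
    rw [fus, List.reverse_cons, mul_assoc, rowR_intertwine hq hx h1 h2, ← mul_assoc, act_cons,
      coprod_intertwine (u' := vecSite q a i) (v' := act (vecSite q a) L)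
        (fun g => (localOn_fus q a (List.Subset.refl L)).vecSite h1 g) (ih h2), act_cons, mul_assoc]

end

end

/-! ### Factorization of the fusion operator along blocks -/

/-- A border strip is cut into maximal runs of columns of length one, labelled by `κ`, and columns
of length two. -/
inductive Block (ι κ : Type)
  | run (l : κ) (L : List ι)
  | pair (i j : ι)

/-- The tensor factors of a block. -/
def Block.sites {ι κ : Type} : Block ι κ → List ι
  | .run _ L => L
  | .pair i j => [i, j]

section

variable {ι κ : Type} [DecidableEq ι] (q : ℂ) (a : ι → ℤ)

/-- The tensor factors of a list of blocks. -/
abbrev allSites (Bs : List (Block ι κ)) : List ι := Bs.flatMap Block.sites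

/-- The product of the `R_{i,j}` between different blocks. -/
def crossAll : List (Block ι κ) → Module.End ℂ ((ι → Fin 2) → ℂ)
  | [] => 1
  | B :: Bs => cross q a B.sites (allSites Bs) * crossAll Bs

/-- The product of the fusion operators of the blocks. -/
def fusAll : List (Block ι κ) → Module.End ℂ ((ι → Fin 2) → ℂ)
  | [] => 1
  | B :: Bs => fusAll Bs * fus q a B.sites

theorem localOn_fusAll {Bs : List (Block ι κ)} {S : List ι} (h : allSites Bs ⊆ S) :
    LocalOn S (fusAll q a Bs) := by
  induction Bs with
  | nil => exact .one S
  | cons B Bs ih =>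
    rw [allSites, List.flatMap_cons, List.append_subset] at h
    exact (ih h.2).mul (localOn_fus q a h.1)

variable {q a} (hq : q ≠ 0) (hx : ∀ i j, i ≠ j → q ^ (a i - a j) ≠ 1)
include hq hx

theorem fus_allSites {Bs : List (Block ι κ)} (h : (allSites Bs).Nodup) :
    fus q a (allSites Bs) = crossAll q a Bs * fusAll q a Bs := by
  induction Bs with
  | nil => simp [fus, crossAll, fusAll]
  | cons B Bs ih =>
    rw [allSites, List.flatMap_cons] at h ⊢
    rw [fus_append hq hx h, ih (List.nodup_append.1 h).2.1]
    simp only [crossAll, fusAll, mul_assoc]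

/-- The block operators restore the order inside each block but leave the order of the blocks
reversed; the remaining reversal is the work of the cross factors. -/
theorem fusAll_intertwine {Bs : List (Block ι κ)} (h : (allSites Bs).Nodup) (g : Gen) :
    fusAll q a Bs * act (vecSite q a) (allSites Bs).reverse g =
      act (vecSite q a) (allSites Bs.reverse) g * fusAll q a Bs := by
  induction Bs generalizing g with
  | nil => simp [fusAll]
  | cons B Bs ih =>
    rw [allSites, List.flatMap_cons] at h
    obtain ⟨h1, h2, h3⟩ := List.nodup_append.1 h
    have e := act_intertwine (vecSite q a) (T := fus q a B.sites) (fus_intertwine hq hx h1)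
      (L := (allSites Bs).reverse) (L' := []) (fun k hk g =>
        (localOn_fus q a (List.Subset.refl B.sites)).vecSite
          (fun h => h3 k h k (List.mem_reverse.1 hk) rfl) g) (by simp)
    have e' := act_intertwine (vecSite q a) (T := fusAll q a Bs) (ih h2) (L := [])
      (L' := B.sites) (by simp) (fun k hk g =>
        (localOn_fusAll q a (List.Subset.refl _)).vecSite (fun h => h3 k hk k h rfl) g)
    simp only [List.append_nil, List.nil_append] at e e'
    have e2 : allSites (B :: Bs).reverse = allSites Bs.reverse ++ B.sites := by simp [allSites]
    rw [e2, allSites, List.flatMap_cons, List.reverse_append, fusAll, mul_assoc, e, ← mul_assoc, e',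
      mul_assoc]

end

/-! ### Symmetry at `q^{±2}` and injectivity of the cross factors -/

section

variable {ι κ : Type} [DecidableEq ι] {q : ℂ} {a : ι → ℤ}

theorem rr_apply_pair (hq : q ≠ 0) (hq2 : q ^ 2 ≠ 1) {i j : ι} (hij : i ≠ j) (h : a j = a i + 2)
    (f : (ι → Fin 2) → ℂ) (e : ι → Fin 2) :
    rr q a i j f e = if e i = 0
      then (if e j = 0 then 0 else f e - q * f (Function.update (Function.update e i 1) j 0))
      else (if e j = 0 then f e - q⁻¹ * f (Function.update (Function.update e i 0) j 1)
        else 0) := by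
  have e1 : q ^ (a i - a j) = (q ^ 2)⁻¹ := by
    rw [h, show a i - (a i + 2) = -2 by ring, zpow_neg]; norm_cast
  have h2 : q ^ 2 - 1 ≠ 0 := sub_ne_zero.2 hq2
  have h3 : 1 - q ^ 2 ≠ 0 := sub_ne_zero.2 hq2.symm
  have d : rDiag q (q ^ 2)⁻¹ = 0 := by rw [rDiag]; field_simp; simp
  have o : rOff q (q ^ 2)⁻¹ = -q := by rw [rOff]; field_simp; ring
  rw [rr, rop_apply _ _ hij, e1, d, o]
  split_ifs
  · ring
  · ring
  · field_simp; ring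
  · ring

theorem rr_apply_run (hq : q ≠ 0) (hq2 : q ^ 2 ≠ 1) {i j : ι} (hij : i ≠ j) (h : a i = a j + 2)
    (f : (ι → Fin 2) → ℂ) (e : ι → Fin 2) :
    rr q a i j f e = if e i = 0
      then (if e j = 0 then rDiag q (q ^ 2) * f e
        else f e + q⁻¹ * f (Function.update (Function.update e i 1) j 0))
      else (if e j = 0 then f e + q * f (Function.update (Function.update e i 0) j 1)
        else rDiag q (q ^ 2) * f e) := by
  have e1 : q ^ (a i - a j) = q ^ 2 := by
    rw [h, show a j + 2 - a j = 2 by ring]; norm_cast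
  have h2 : q ^ 2 - 1 ≠ 0 := sub_ne_zero.2 hq2
  have o : rOff q (q ^ 2) = q⁻¹ := by rw [rOff]; field_simp
  rw [rr, rop_apply _ _ hij, e1, o]
  split_ifs
  · rfl
  · rfl
  · field_simp
  · rfl

/-- `f` is `q`-antisymmetric in the tensor factors `i`, `j`. -/
def IsAnti (q : ℂ) (i j : ι) (f : (ι → Fin 2) → ℂ) : Prop :=
  (∀ e, e i = e j → f e = 0) ∧ ∀ e, e i = 1 → e j = 0 →
    f e = -q⁻¹ * f (Function.update (Function.update e i 0) j 1)

/-- `f` is `q`-symmetric in the tensor factors `i`, `j`. -/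
def IsSymm (q : ℂ) (i j : ι) (f : (ι → Fin 2) → ℂ) : Prop :=
  ∀ e, e i = 1 → e j = 0 → f e = q * f (Function.update (Function.update e i 0) j 1)

theorem isSymm_rr (hq : q ≠ 0) (hq2 : q ^ 2 ≠ 1) {i j : ι} (hij : i ≠ j) (h : a i = a j + 2)
    (f : (ι → Fin 2) → ℂ) : IsSymm q i j (rr q a i j f) := by
  intro e hi hj
  have u : Function.update (Function.update (Function.update (Function.update e i 0) j 1) i 1) j 0
      = e := by
    rw [Function.update_comm hij.symm, Function.update_idem, Function.update_idem, ← hi,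
      Function.update_eq_self, ← hj, Function.update_eq_self]
  rw [rr_apply_run hq hq2 hij h, rr_apply_run hq hq2 hij h, u]
  simp [hi, hj, hij]
  field_simp
  ring

theorem isAnti_rr (hq : q ≠ 0) (hq2 : q ^ 2 ≠ 1) {i j : ι} (hij : i ≠ j) (h : a j = a i + 2)
    (f : (ι → Fin 2) → ℂ) : IsAnti q i j (rr q a i j f) := by
  refine ⟨fun e he => ?_, fun e hi hj => ?_⟩
  · rw [rr_apply_pair hq hq2 hij h, he]
    split_ifs <;> rfl
  · have u : Function.update (Function.update (Function.update (Function.update e i 0) j 1) i 1) j 0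
        = e := by
      rw [Function.update_comm hij.symm, Function.update_idem, Function.update_idem, ← hi,
        Function.update_eq_self, ← hj, Function.update_eq_self]
    rw [rr_apply_pair hq hq2 hij h, rr_apply_pair hq hq2 hij h, u]
    simp [hi, hj, hij]
    field_simp
    ring

/-- `R(q^{-2})` is twice a projection onto the antisymmetric functions. As an eigenvalue equation,
antisymmetry passes through every operator that commutes with this `R`. -/
theorem isAnti_iff (hq : q ≠ 0) (hq2 : q ^ 2 ≠ 1) {i j : ι} (hij : i ≠ j) (h : a j = a i + 2)
    {f : (ι → Fin 2) → ℂ} : IsAnti q i j f ↔ rr q a i j f = (2 : ℂ) • f := by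
  constructor
  · rintro ⟨h0, h1⟩
    funext e
    rw [rr_apply_pair hq hq2 hij h, Pi.smul_apply, smul_eq_mul]
    obtain hi | hi : e i = 0 ∨ e i = 1 := by omega
    all_goals obtain hj | hj : e j = 0 ∨ e j = 1 := by omega
    · simp [hi, hj, h0 e (hi.trans hj.symm)]
    · have u : Function.update (Function.update (Function.update (Function.update e i 1) j 0) i 0) j 1
          = e := by
        rw [Function.update_comm hij.symm, Function.update_idem, Function.update_idem, ← hi,
          Function.update_eq_self, ← hj, Function.update_eq_self]
      have := h1 (Function.update (Function.update e i 1) j 0) (by simp [hij]) (by simp)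
      rw [u] at this
      simp [hi, hj, this]
      field_simp
      ring
    · have := h1 e hi hj
      simp [hi, hj]
      linear_combination -this
    · simp [hi, hj, h0 e (hi.trans hj.symm)]
  · intro h'
    -- An eigenvector for the eigenvalue 2 is the image of its own half.
    have := isAnti_rr hq hq2 hij h ((2 : ℂ)⁻¹ • f)
    rwa [map_smul, h', smul_smul, inv_mul_cancel₀ two_ne_zero, one_smul] at this

/-- `T` maps the functions that are antisymmetric in all pairs of `P` injectively to such
functions. -/
def Keeps (q : ℂ) (P : ι → ι → Prop) (T : Module.End ℂ ((ι → Fin 2) → ℂ)) : Prop :=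
  ∀ f, (∀ i j, P i j → IsAnti q i j f) →
    (∀ i j, P i j → IsAnti q i j (T f)) ∧ (T f = 0 → f = 0)

theorem Keeps.one (P : ι → ι → Prop) : Keeps q P (1 : Module.End ℂ ((ι → Fin 2) → ℂ)) :=
  fun _ hf => ⟨hf, fun h => h⟩

theorem Keeps.mul {P : ι → ι → Prop} {T T' : Module.End ℂ ((ι → Fin 2) → ℂ)} (h : Keeps q P T)
    (h' : Keeps q P T') : Keeps q P (T * T') := fun f hf =>
  ⟨(h _ (h' f hf).1).1, fun h0 => (h' f hf).2 ((h _ (h' f hf).1).2 h0)⟩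

theorem IsAnti.smul {i j : ι} {f : (ι → Fin 2) → ℂ} (h : IsAnti q i j f) (c : ℂ) :
    IsAnti q i j (c • f) :=
  ⟨fun e he => by simp [h.1 e he], fun e hi hj => by
    simp only [Pi.smul_apply, smul_eq_mul]; rw [h.2 e hi hj]; ring⟩

theorem Keeps.of_smul {P : ι → ι → Prop} {T : Module.End ℂ ((ι → Fin 2) → ℂ)} {c : ℂ}
    (hc : c ≠ 0) (h : ∀ f, (∀ i j, P i j → IsAnti q i j f) → T f = c • f) : Keeps q P T :=
  fun f hf => by
    rw [h f hf]
    exact ⟨fun i j hP => (hf i j hP).smul c, fun h => (smul_eq_zero.1 h).resolve_left hc⟩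

/-- Any two blocks of a border strip are separated by their parameters. -/
def Block.Apart (a : ι → ℤ) (B B' : Block ι κ) : Prop :=
  ∀ i ∈ B.sites, ∀ j ∈ B'.sites, a j < a i ∧
    ∀ l L l' L', B = .run l L → B' = .run l' L' → a i ≠ a j + 2

variable (hq0 : q ≠ 0) (hq : ∀ k : ℕ, 0 < k → q ^ k ≠ 1) (ha : Function.Injective a)
include hq0 hq

/-- The numerator vanishes only if `q^(d+2) = 1`, that is for `d = -2`, which positivity excludes.
-/
theorem rDiag_ne_zero {d : ℤ} (hd : 0 < d) : rDiag q (q ^ d) ≠ 0 := by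
  have h1 : q ^ d ≠ 1 := zpow_ne_one hq hd.ne'
  have h2 : q ^ (d + 2) ≠ 1 := zpow_ne_one hq (by omega)
  rw [zpow_add₀ hq0] at h2
  have h3 : q ^ (2 : ℤ) = q ^ 2 := by norm_cast
  rw [h3] at h2
  refine div_ne_zero (fun h => h2 ?_) (sub_ne_zero.2 h1)
  field_simp at h
  linear_combination h

include ha

theorem param_ne (i j : ι) (h : i ≠ j) : q ^ (a i - a j) ≠ 1 :=
  zpow_ne_one hq (sub_ne_zero.2 fun h' => h (ha h'))

variable {P : ι → ι → Prop} (hP : ∀ i j, P i j → i ≠ j ∧ a j = a i + 2)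
include hP

/-- A factor between two runs does not touch the pairs, so it commutes with their projections. It is
invertible because the exponent `a i - a j` is positive and different from 2. -/
theorem keeps_rr {i j : ι} (hij : i ≠ j) (hi : ∀ k l, P k l → i ≠ k ∧ i ≠ l)
    (hj : ∀ k l, P k l → j ≠ k ∧ j ≠ l) (h1 : a j < a i) (h2 : a i ≠ a j + 2) :
    Keeps q P (rr q a i j) := by
  intro f hf
  refine ⟨fun k l hkl => ?_, fun h => ?_⟩
  · obtain ⟨n, e⟩ := hP k l hkl
    have hq2 := hq 2 (by norm_num)
    have hf' := hf k l hkl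
    rw [isAnti_iff hq0 hq2 n e] at hf' ⊢
    have c : rr q a k l * rr q a i j = rr q a i j * rr q a k l :=
      rop_comm (hi k l hkl).1.symm (hj k l hkl).1.symm (hi k l hkl).2.symm (hj k l hkl).2.symm _ _ _
    have := LinearMap.congr_fun c f
    rw [Module.End.mul_apply, Module.End.mul_apply, hf', map_smul] at this
    exact this
  · have e2 : q ^ (2 : ℤ) = q ^ 2 := by norm_cast
    refine rop_injective hq0 (param_ne hq0 hq ha i j hij) ?_ ?_ hij (h.trans (map_zero _).symm)
    · rw [← e2, ← zpow_add₀ hq0]; exact zpow_ne_one hq (by omega)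
    · rw [← e2]
      intro h
      have h4 : q ^ (a i - a j - 2) = 1 := by
        rw [zpow_sub₀ hq0, h, div_self (zpow_ne_zero _ hq0)]
      exact zpow_ne_one hq (by omega) h4

theorem pow_add_two {m n : ℤ} (h : m = n + 2) : q ^ m = q ^ n * q ^ 2 := by
  rw [h, zpow_add₀ hq0]; norm_cast

/-- The row of a box of a run is processed block by block: factors towards another run are
invertible one by one, the two factors towards a pair only together. -/
theorem keeps_rowL {i : ι} (hi : ∀ k l, P k l → i ≠ k ∧ i ≠ l) {Bs : List (Block ι κ)}
    (hn : i ∉ allSites Bs) (hp : ∀ j k, .pair j k ∈ Bs → P j k)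
    (hr : ∀ l L, .run l L ∈ Bs → ∀ j ∈ L, ∀ k l, P k l → j ≠ k ∧ j ≠ l)
    (h1 : ∀ j ∈ allSites Bs, a j < a i)
    (h2 : ∀ l L, .run l L ∈ Bs → ∀ j ∈ L, a i ≠ a j + 2) :
    Keeps q P (rowL q a i (allSites Bs)) := by
  induction Bs with
  | nil => exact .one P
  | cons B Bs ih =>
    rw [allSites, List.flatMap_cons] at hn h1 ⊢
    rw [List.mem_append, not_or] at hn
    rw [rowL_append]
    refine Keeps.mul ?_ (ih hn.2 (fun j k h => hp j k (by simp [h]))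
      (fun l L h => hr l L (by simp [h])) (fun j hj => h1 j (by simp [hj]))
      (fun l L h => h2 l L (by simp [h])))
    have h1' : ∀ j ∈ B.sites, a j < a i := fun j hj => h1 j (by simp [hj])
    cases B with
    | run l L =>
      have hr' := hr l L (by simp)
      have h2' := h2 l L (by simp)
      simp only [Block.sites] at h1' hn ⊢
      replace hn := hn.1
      clear ih h1 h2 hr hp
      induction L with
      | nil => exact .one P
      | cons j L ih =>
        rw [List.mem_cons, not_or] at hn
        rw [rowL]
        exact (keeps_rr hq0 hq ha hP hn.1 hi (hr' j (by simp)) (h1' j (by simp))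
          (h2' j (by simp))).mul (ih (fun j hj => h1' j (by simp [hj]))
          (fun j hj => hr' j (by simp [hj])) (fun j hj => h2' j (by simp [hj])) hn.2)
    | pair j k =>
      have hjk := hp j k (by simp)
      obtain ⟨n, e⟩ := hP j k hjk
      simp only [Block.sites] at h1' hn ⊢
      obtain ⟨hn1, hn2⟩ : i ≠ j ∧ i ≠ k := by simpa using hn.1
      simp only [rowL, mul_one]
      refine Keeps.of_smul (rDiag_ne_zero hq0 hq (d := a i - a j)
        (by have := h1' j (by simp); omega)) fun f hf => ?_
      obtain ⟨f0, f1⟩ := hf j k hjk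
      exact rop_pair_right hq0 (param_ne hq0 hq ha i j hn1) (param_ne hq0 hq ha i k hn2)
        (pow_add_two hq0 hq ha hP (by omega)) hn1 hn2 n f0 f1

/-- The two rows of a pair are interleaved so that the two factors meeting each `k` stand together
and act by a scalar. The nature of the block containing `k` is then irrelevant. -/
theorem keeps_rowL_pair {i j : ι} (hij : P i j) {L : List ι} (hi : i ∉ L) (hj : j ∉ L)
    (hL : L.Nodup) (h1 : ∀ k ∈ L, a k < a i) :
    Keeps q P (rowL q a j L * rowL q a i L) := by
  obtain ⟨n, e⟩ := hP i j hij
  induction L with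
  | nil => exact Keeps.mul (.one P) (.one P)
  | cons k L ih =>
    rw [List.mem_cons, not_or] at hi hj
    obtain ⟨h3, h4⟩ := List.nodup_cons.1 hL
    have c : rowL q a j L * rr q a i k = rr q a i k * rowL q a j L :=
      (localOn_rowL q a (S := j :: L) (by simp) (by simp)).rr (by simp [n, hi.2])
        (by simp [Ne.symm hj.1, h3])
    have : rowL q a j (k :: L) * rowL q a i (k :: L) =
        (rr q a j k * rr q a i k) * (rowL q a j L * rowL q a i L) := by
      rw [rowL, rowL, mul_assoc, ← mul_assoc (rowL q a j L), c]
      simp only [mul_assoc]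
    rw [this]
    refine Keeps.mul ?_ (ih hi.2 hj.2 h4 fun k hk => h1 k (by simp [hk]))
    have h1' := h1 k (by simp)
    refine Keeps.of_smul (rDiag_ne_zero hq0 hq (d := a j - a k) (by omega)) fun f hf => ?_
    obtain ⟨f0, f1⟩ := hf i j hij
    exact rop_pair_left hq0 (param_ne hq0 hq ha i k hi.1) (param_ne hq0 hq ha j k hj.1)
      (pow_add_two hq0 hq ha hP (by omega)) n hi.1 hj.1 f0 f1

theorem keeps_crossAll {Bs : List (Block ι κ)}
    (hn : (allSites Bs).Nodup) (hp : ∀ j k, .pair j k ∈ Bs → P j k)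
    (hr : ∀ l L, .run l L ∈ Bs → ∀ j ∈ L, ∀ k l, P k l → j ≠ k ∧ j ≠ l)
    (hs : Bs.Pairwise (Block.Apart a)) : Keeps q P (crossAll q a Bs) := by
  induction Bs with
  | nil => exact .one P
  | cons B Bs ih =>
    rw [allSites, List.flatMap_cons, List.nodup_append] at hn
    obtain ⟨n1, n2, n3⟩ := hn
    obtain ⟨s1, s2⟩ := List.pairwise_cons.1 hs
    refine Keeps.mul ?_ (ih n2 (fun j k h => hp j k (by simp [h]))
      (fun l L h => hr l L (by simp [h])) s2)
    have s3 : ∀ i ∈ B.sites, ∀ j ∈ allSites Bs, a j < a i := fun i hi j hj => by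
      obtain ⟨B', hB', hj'⟩ := List.mem_flatMap.1 hj
      exact (s1 B' hB' i hi j hj').1
    cases B with
    | run l L =>
      have hr' := hr l L (by simp)
      have key : ∀ i ∈ L, Keeps q P (rowL q a i (allSites Bs)) := fun i hi =>
        keeps_rowL hq0 hq ha hP (hr' i hi) (fun h => n3 i hi i h rfl)
          (fun j k h => hp j k (by simp [h])) (fun l L h => hr l L (by simp [h])) (s3 i hi)
          (fun l' L' h j hj => (s1 _ h i hi j hj).2 l L l' L' rfl rfl)
      simp only [Block.sites]
      clear ih hr n1 n3 s1 hs s3 hr' hp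
      induction L with
      | nil => exact .one P
      | cons i L ih => exact (ih fun j hj => key j (by simp [hj])).mul (key i (by simp))
    | pair i j =>
      simp only [Block.sites, cross, one_mul]
      exact keeps_rowL_pair hq0 hq ha hP (hp i j (by simp))
        (fun h => n3 i (by simp [Block.sites]) i h rfl)
        (fun h => n3 j (by simp [Block.sites]) j h rfl) n2 (s3 i (by simp [Block.sites]))

end

/-! ### Symmetric tensors as evaluation modules -/

section

variable {ι : Type} [DecidableEq ι] {q : ℂ} {a : ι → ℤ}

/-- The number of entries `v_2` in the tensor factors of a list. -/
def ones (L : List ι) (e : ι → Fin 2) : ℕ := L.countP fun j => e j = 1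

/-- The coefficients of the `q`-symmetric tensors. -/
def symWt (q : ℂ) : List ι → (ι → Fin 2) → ℂ
  | [], _ => 1
  | i :: L, e => (if e i = 0 then q ^ (-(ones L e : ℤ)) else 1) * symWt q L e

@[simp] theorem ones_nil (e : ι → Fin 2) : ones [] e = 0 := rfl

theorem ones_cons (i : ι) (L : List ι) (e : ι → Fin 2) :
    ones (i :: L) e = ones L e + if e i = 0 then 0 else 1 := by
  rw [ones, List.countP_cons, ones]
  obtain h | h : e i = 0 ∨ e i = 1 := by omega
  all_goals simp [h]

theorem ones_le (L : List ι) (e : ι → Fin 2) : ones L e ≤ L.length := List.countP_le_length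

theorem ones_congr {L : List ι} {e e' : ι → Fin 2} (h : ∀ i ∈ L, e i = e' i) :
    ones L e = ones L e' := by
  induction L with
  | nil => rfl
  | cons i L ih => rw [ones_cons, ones_cons, h i (by simp), ih fun j hj => h j (by simp [hj])]

theorem symWt_congr {L : List ι} {e e' : ι → Fin 2} (h : ∀ i ∈ L, e i = e' i) :
    symWt q L e = symWt q L e' := by
  induction L with
  | nil => rfl
  | cons i L ih =>
    rw [symWt, symWt, h i (by simp), ih fun j hj => h j (by simp [hj]),
      ones_congr fun j hj => h j (by simp [hj])]

theorem update_congr {L : List ι} {i : ι} (hi : i ∉ L) (e : ι → Fin 2) (y : Fin 2) :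
    ∀ j ∈ L, Function.update e i y j = e j := fun j hj =>
  Function.update_of_ne (by rintro rfl; exact hi hj) _ _

theorem ones_update {L : List ι} {i : ι} (hi : i ∉ L) (e : ι → Fin 2) (y : Fin 2) :
    ones L (Function.update e i y) = ones L e := ones_congr (update_congr hi e y)

theorem symWt_update {L : List ι} {i : ι} (hi : i ∉ L) (e : ι → Fin 2) (y : Fin 2) :
    symWt q L (Function.update e i y) = symWt q L e := symWt_congr (update_congr hi e y)

/-- The parameters of consecutive boxes of a row: the evaluation parameter is `b`. -/
def RunParam (a : ι → ℤ) : ℤ → List ι → Prop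
  | _, [] => True
  | b, i :: L => a i = b + L.length ∧ RunParam a (b - 1) L

/-- The evaluation module in terms of functions of an integer weight. -/
def evalZ (q : ℂ) (n b : ℤ) (g : Gen) (G : ℤ → ℂ) (k : ℤ) : ℂ :=
  match g with
  | .E 0 => q ^ b * (qInt q k * G (k - 1))
  | .E 1 => qInt q (n - k) * G (k + 1)
  | .F 0 => q ^ (-b) * (qInt q (n - k) * G (k + 1))
  | .F 1 => qInt q k * G (k - 1)
  | .K 0 => q ^ (-(n - 2 * k)) * G k
  | .K 1 => q ^ (n - 2 * k) * G k
  | .Kinv 0 => q ^ (n - 2 * k) * G k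
  | .Kinv 1 => q ^ (-(n - 2 * k)) * G k

/-- The `q`-symmetric tensors on a run form the evaluation module. `G` may depend on the
configuration outside `L`; this makes the induction work and later accommodates the other blocks.
The values of `G` outside `0, …, n` play no role, since `[k]` vanishes at `k = 0` and `[n - k]` at
`k = n`. -/
theorem act_symWt (hq : q ≠ 0) (hq2 : q ^ 2 ≠ 1) {L : List ι} (hL : L.Nodup) {b : ℤ}
    (hb : RunParam a b L)
    {G : ℤ → (ι → Fin 2) → ℂ} (hG : ∀ i ∈ L, ∀ k e y, G k (Function.update e i y) = G k e)
    (g : Gen) (e : ι → Fin 2) :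
    act (vecSite q a) L g (fun e => symWt q L e * G (ones L e) e) e =
      symWt q L e * evalZ q L.length b g (fun k => G k e) (ones L e) := by
  have h2 : q - q⁻¹ ≠ 0 := fun h => hq2 (by field_simp at h; linear_combination h)
  have h3 : q ^ 2 - 1 ≠ 0 := sub_ne_zero.2 hq2
  induction L generalizing b G g e with
  | nil =>
    rcases g with g | g | g | g <;> fin_cases g <;> simp [counit, evalZ, symWt, qInt]
  | cons i L ih =>
    obtain ⟨h1, h4⟩ := List.nodup_cons.1 hL
    obtain ⟨hb1, hb2⟩ := hb
    have hf : (fun e => symWt q (i :: L) e * G (ones (i :: L) e) e) = fun e => symWt q L e *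
        (fun (k : ℤ) (e : ι → Fin 2) => (if e i = 0 then q ^ (-k) else 1) *
          G (k + if e i = 0 then 0 else 1) e) (ones L e) e := by
      funext e
      rw [symWt, ones_cons]
      push_cast
      ring
    -- The entry at `i` now lies outside the shorter list, so its weight factor and its contribution
    -- to the number of entries `v_2` are absorbed in `G`.
    have ih' := ih h4 hb2 (G := fun (k : ℤ) (e : ι → Fin 2) =>
      (if e i = 0 then q ^ (-k) else 1) * G (k + if e i = 0 then 0 else 1) e)
      (fun j hj k e y => by
        have : i ≠ j := fun h => h1 (h ▸ hj)
        simp only [Function.update_of_ne this, hG j (by simp [hj])])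
    rw [← hf] at ih'
    have hGi : ∀ k e y, G k (Function.update e i y) = G k e := hG i (by simp)
    have hLe := ones_le L e
    -- `z` counts the entries `v_1`; with it all exponents are sums, and the claim becomes a Laurent
    -- polynomial identity in `q`.
    obtain ⟨z, hz⟩ := Nat.exists_eq_add_of_le hLe
    have hqz : q ^ (z : ℤ) ≠ 0 := zpow_ne_zero _ hq
    have hqo : q ^ (ones L e : ℤ) ≠ 0 := zpow_ne_zero _ hq
    have hqb : q ^ b ≠ 0 := zpow_ne_zero _ hq
    obtain ⟨F, hF⟩ : ∃ F, F = fun e => symWt q (i :: L) e * G (ones (i :: L) e) e := ⟨_, rfl⟩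
    have hfe : ∀ e, F e = symWt q L e *
        ((if e i = 0 then q ^ (-(ones L e : ℤ)) else 1) *
          G (ones L e + if e i = 0 then 0 else 1) e) := fun e => by rw [hF]; exact congrFun hf e
    rw [← hF] at ih' ⊢
    clear hf hF ih hG hb2
    have c1 : ∀ o : ℤ, o + 1 - 1 = o := fun o => by ring
    have c2 : ∀ o : ℤ, o - 1 + 1 = o := fun o => by ring
    have c3 : ∀ o z : ℤ, o + z - o = z := fun o z => by ring
    have c4 : ∀ o z : ℤ, o + z + 1 - o = z + 1 := fun o z => by ring
    have c5 : ∀ o z : ℤ, o + z + 1 - (o + 1) = z := fun o z => by ring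
    obtain hi | hi : e i = 0 ∨ e i = 1 := by omega
    all_goals
      rcases g with g | g | g | g <;> fin_cases g <;>
      simp [act_cons, coprod, vecSite, Module.End.mul_apply, LinearMap.add_apply, Pi.add_apply,
        site_apply, Fin.sum_univ_two, ih', vecMat, hi, evalZ, symWt, ones_cons, ones_update h1,
        symWt_update h1, hGi, hfe, hb1, hz, c1, c2, c3, c4, c5, -zpow_natCast] <;>
      simp only [qInt, zpow_add₀ hq, zpow_sub₀ hq, zpow_neg, two_mul, zpow_one, neg_sub, neg_add] <;>
      field_simp <;> ring

end

/-! ### Embedding of the tensor product of evaluation modules -/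

section

variable {ι : Type} [DecidableEq ι] {q : ℂ} {a : ι → ℤ}

/-- The `q`-antisymmetric tensor is annihilated by `E_1` and `F_1` for any parameters; for `E_0` and
`F_0` the shift `a j = a i + 2` is what makes the two terms cancel. -/
theorem act_pair (hq : q ≠ 0) {i j : ι} (hij : i ≠ j) (h : a j = a i + 2) {f : (ι → Fin 2) → ℂ}
    (hf : IsAnti q i j f) (g : Gen) : act (vecSite q a) [i, j] g f =
      (counit g : Module.End ℂ ((ι → Fin 2) → ℂ)) f := by
  obtain ⟨h0, h1⟩ := hf
  funext e
  obtain ⟨S, hS, s1, s2, u1, u2⟩ := exists_slice₂ hij e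
  have h0' : ∀ α, f (S α α) = 0 := fun α => h0 _ (by rw [s1, s2])
  have h1' : f (S 1 0) = -q⁻¹ * f (S 0 1) := by
    rw [h1 _ (s1 _ _) (s2 _ _), u1, u2]
  rw [← hS]
  have hi : q ^ a i ≠ 0 := zpow_ne_zero _ hq
  have e1 : q ^ (a i + 2) = q ^ a i * q ^ 2 := by rw [zpow_add₀ hq]; norm_cast
  have e2 : q ^ (-(a i + 2)) = (q ^ a i * q ^ 2)⁻¹ := by rw [zpow_neg, e1]
  generalize e i = α
  generalize e j = β
  clear hS
  rw [act_cons, act_singleton]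
  rcases g with g | g | g | g <;> fin_cases g <;> fin_cases α <;> fin_cases β <;>
    simp [coprod, counit, vecSite, Module.End.mul_apply, site_apply, s1, s2, u1, u2, vecMat, h0',
      h1', h, e1, e2, hq, -neg_add_rev] <;>
    (try field_simp) <;> (try ring)

/-- The coefficients of the `q`-antisymmetric tensor. -/
def antiWt (q : ℂ) (i j : ι) (e : ι → Fin 2) : ℂ :=
  if e i = e j then 0 else if e i = 0 then 1 else -q⁻¹

theorem antiWt_congr {i j : ι} {e e' : ι → Fin 2} (hi : e i = e' i) (hj : e j = e' j) :
    antiWt q i j e = antiWt q i j e' := by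
  rw [antiWt, antiWt, hi, hj]

variable {κ : Type}

/-- The coefficients of the distinguished tensors of a block. -/
def Block.wt (q : ℂ) (B : Block ι κ) (e : ι → Fin 2) : ℂ :=
  match B with
  | .run _ L => symWt q L e
  | .pair i j => antiWt q i j e

/-- The coefficients of the distinguished tensors of a list of blocks. -/
def blockWt (q : ℂ) (Bs : List (Block ι κ)) (e : ι → Fin 2) : ℂ := (Bs.map fun B => B.wt q e).prod

theorem Block.wt_congr {B : Block ι κ} {e e' : ι → Fin 2} (h : ∀ i ∈ B.sites, e i = e' i) :
    B.wt q e = B.wt q e' := by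
  cases B with
  | run l L => exact symWt_congr h
  | pair i j => exact antiWt_congr (h i (by simp [Block.sites])) (h j (by simp [Block.sites]))

theorem blockWt_congr {Bs : List (Block ι κ)} {e e' : ι → Fin 2}
    (h : ∀ i ∈ allSites Bs, e i = e' i) : blockWt q Bs e = blockWt q Bs e' := by
  rw [blockWt, blockWt]
  congr 1
  exact List.map_congr_left fun B hB => B.wt_congr fun i hi => h i (List.mem_flatMap.2 ⟨B, hB, hi⟩)

/-- The labels of the runs. -/
def labels (Bs : List (Block ι κ)) : List κ :=
  Bs.flatMap fun B => match B with
    | .run l _ => [l]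
    | .pair _ _ => []

/-- A border strip cut into blocks: the runs are labelled by `κ`, the run `l` occupies the tensor
factors `S l`, has length `n l` and evaluation parameter `b l`. -/
structure BlockData (a : ι → ℤ) (n : κ → ℕ) (b : κ → ℤ) (S : κ → List ι)
    (Bs : List (Block ι κ)) : Prop where
  inj : Function.Injective a
  nodup : (allSites Bs).Nodup
  complete : ∀ i, i ∈ allSites Bs
  apart : Bs.Pairwise (Block.Apart a)
  run : ∀ l L, .run l L ∈ Bs → L = S l
  mem : ∀ l, .run l (S l) ∈ Bs
  pair : ∀ i j, .pair i j ∈ Bs → a j = a i + 2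
  param : ∀ l, RunParam a (b l) (S l)
  length : ∀ l, (S l).length = n l

/-- The weight of a configuration. -/
def weight {n : κ → ℕ} {S : κ → List ι} (hS : ∀ l, (S l).length = n l) (e : ι → Fin 2) (l : κ) :
    Fin (n l + 1) := ⟨ones (S l) e, by have := ones_le (S l) e; rw [hS] at this; omega⟩

/-- The embedding of a tensor product of evaluation modules in `V ⊗ ⋯ ⊗ V`, on functions. -/
def embed (q : ℂ) {n : κ → ℕ} {S : κ → List ι} (hS : ∀ l, (S l).length = n l)
    (Bs : List (Block ι κ)) : ((∀ l, Fin (n l + 1)) → ℂ) →ₗ[ℂ] ((ι → Fin 2) → ℂ) where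
  toFun G e := blockWt q Bs e * G (weight hS e)
  map_add' G G' := by funext e; simp [mul_add]
  map_smul' c G := by funext e; simp [mul_left_comm]

theorem embed_apply {n : κ → ℕ} {S : κ → List ι} (hS : ∀ l, (S l).length = n l)
    (Bs : List (Block ι κ)) (G : (∀ l, Fin (n l + 1)) → ℂ) (e : ι → Fin 2) :
    embed q hS Bs G e = blockWt q Bs e * G (weight hS e) := rfl

variable {n : κ → ℕ} {b : κ → ℤ} {S : κ → List ι} {Bs : List (Block ι κ)}

theorem BlockData.disjoint (h : BlockData a n b S Bs) {B B' : Block ι κ} (hB : B ∈ Bs)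
    (hB' : B' ∈ Bs) (hne : B ≠ B') {i : ι} (hi : i ∈ B.sites) (hi' : i ∈ B'.sites) : False := by
  have := (List.nodup_flatMap.1 h.nodup).2
  have hs : Std.Symm (Function.onFun List.Disjoint (Block.sites : Block ι κ → List ι)) :=
    ⟨fun _ _ h => List.Disjoint.symm h⟩
  exact (this.forall hB hB' hne) hi hi'

theorem BlockData.nodup_sites (h : BlockData a n b S Bs) {B : Block ι κ} (hB : B ∈ Bs) :
    B.sites.Nodup := (List.nodup_flatMap.1 h.nodup).1 B hB

theorem BlockData.ne_pair (h : BlockData a n b S Bs) {i j : ι} (hij : .pair i j ∈ Bs) : i ≠ j := by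
  simpa [Block.sites] using h.nodup_sites hij

theorem BlockData.mem_unique (h : BlockData a n b S Bs) {l l' : κ} (hl : l ≠ l') {i : ι}
    (hi : i ∈ S l) : i ∉ S l' := fun hi' =>
  h.disjoint (h.mem l) (h.mem l') (fun h => hl (Block.run.inj h).1) hi hi'

/-- A block can be singled out from a list of blocks. -/
theorem BlockData.exists_blockWt (h : BlockData a n b S Bs) {B : Block ι κ} (hB : B ∈ Bs) :
    ∃ W : (ι → Fin 2) → ℂ, (∀ e, blockWt q Bs e = B.wt q e * W e) ∧
      ∀ e e', (∀ i ∉ B.sites, e i = e' i) → W e = W e' := by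
  obtain ⟨Bs₁, Bs₂, rfl⟩ := List.append_of_mem hB
  refine ⟨fun e => blockWt q Bs₁ e * blockWt q Bs₂ e, fun e => ?_, fun e e' he => ?_⟩
  · simp only [blockWt, List.map_append, List.map_cons, List.prod_append, List.prod_cons]
    ring
  · have hn := h.nodup
    rw [allSites, List.flatMap_append, List.flatMap_cons, List.nodup_append, List.nodup_append] at hn
    obtain ⟨-, ⟨-, -, h2⟩, h1⟩ := hn
    have e1 : blockWt q Bs₁ e = blockWt q Bs₁ e' := blockWt_congr fun i hi =>
      he i fun hi' => h1 i hi i (List.mem_append_left _ hi') rfl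
    have e2 : blockWt q Bs₂ e = blockWt q Bs₂ e' := blockWt_congr fun i hi =>
      he i fun hi' => h2 i hi' i hi rfl
    simp only [e1, e2]

theorem BlockData.weight_congr (h : BlockData a n b S Bs) {i j : ι} (hij : .pair i j ∈ Bs)
    {e e' : ι → Fin 2} (he : ∀ k, k ≠ i → k ≠ j → e k = e' k) :
    weight h.length e = weight h.length e' := by
  funext l
  apply Fin.ext
  refine ones_congr fun k hk => he k ?_ ?_ <;> rintro rfl
  · exact h.disjoint (h.mem l) hij (by simp) hk (by simp [Block.sites])
  · exact h.disjoint (h.mem l) hij (by simp) hk (by simp [Block.sites])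

theorem BlockData.isAnti_embed (h : BlockData a n b S Bs) {i j : ι} (hij : .pair i j ∈ Bs)
    (G : (∀ l, Fin (n l + 1)) → ℂ) : IsAnti q i j (embed q h.length Bs G) := by
  obtain ⟨W, hW, hW'⟩ := h.exists_blockWt (q := q) hij
  have hne := h.ne_pair hij
  refine ⟨fun e he => ?_, fun e hi hj => ?_⟩
  · rw [embed_apply, hW, Block.wt, antiWt, if_pos he, zero_mul, zero_mul]
  · have hk : ∀ k, k ≠ i → k ≠ j → e k = Function.update (Function.update e i 0) j 1 k :=
      fun k h1 h2 => by simp [h1, h2]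
    rw [embed_apply, embed_apply, hW, hW, Block.wt, Block.wt, h.weight_congr hij hk,
      hW' e _ fun k hk' => by
        simp only [Block.sites, List.mem_cons, List.not_mem_nil, or_false, not_or] at hk'
        exact hk k hk'.1 hk'.2]
    simp [antiWt, hi, hj, hne]
    ring

variable [DecidableEq κ]

/-- The action of the generators on a tensor product of evaluation modules, on functions. -/
def evalSite (q : ℂ) (n : κ → ℕ) (b : κ → ℤ) (l : κ) (g : Gen) :
    Module.End ℂ ((∀ l, Fin (n l + 1)) → ℂ) :=
  local_ (fun l => evalAction q (n l) (b l)) l g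

/-- A function of the weight at one label, extended by zero to all integers. -/
def extend (c : ∀ l, Fin (n l + 1)) (l : κ) (G : (∀ l, Fin (n l + 1)) → ℂ) (k : ℤ) : ℂ :=
  if h : 0 ≤ k ∧ k < n l + 1 then G (Function.update c l ⟨k.toNat, by omega⟩) else 0

theorem extend_coe (c : ∀ l, Fin (n l + 1)) (l : κ) (G : (∀ l, Fin (n l + 1)) → ℂ)
    (x : Fin (n l + 1)) : extend c l G ((x : ℕ) : ℤ) = G (Function.update c l x) := by
  rw [extend, dif_pos ⟨by omega, by omega⟩]
  rfl

theorem sum_raise (c : ∀ l, Fin (n l + 1)) (l : κ) (G : (∀ l, Fin (n l + 1)) → ℂ) (v : ℂ) :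
    ∑ y : Fin (n l + 1), (if ((c l : Fin _) : ℕ) + 1 = y then v else 0) *
      G (Function.update c l y) = v * extend c l G (((c l : Fin _) : ℕ) + 1) := by
  by_cases h : (c l : ℕ) + 1 < n l + 1
  · rw [Finset.sum_eq_single ⟨(c l : ℕ) + 1, h⟩]
    · rw [if_pos rfl, ← extend_coe c l G]
      push_cast
      rfl
    · intro y _ hy
      rw [if_neg fun h' => hy (Fin.ext h'.symm), zero_mul]
    · simp
  · rw [extend, dif_neg (by omega), mul_zero]
    refine Finset.sum_eq_zero fun y _ => ?_
    rw [if_neg (by omega), zero_mul]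

theorem sum_lower (c : ∀ l, Fin (n l + 1)) (l : κ) (G : (∀ l, Fin (n l + 1)) → ℂ)
    (v : ℕ → ℂ) :
    ∑ y : Fin (n l + 1), (if ((c l : Fin _) : ℕ) = (y : ℕ) + 1 then v y else 0) *
      G (Function.update c l y) =
      v ((c l : ℕ) - 1) * extend c l G (((c l : Fin _) : ℕ) - 1) := by
  by_cases h : 0 < (c l : ℕ)
  · have hc := (c l).2
    rw [Finset.sum_eq_single ⟨(c l : ℕ) - 1, by omega⟩]
    · rw [if_pos (by simp only; omega), ← extend_coe c l G]
      congr 2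
      simp only
      omega
    · intro y _ hy
      rw [if_neg fun h' => hy (Fin.ext (by simp only; omega)), zero_mul]
    · simp
  · rw [extend, dif_neg (by omega), mul_zero]
    refine Finset.sum_eq_zero fun y _ => ?_
    rw [if_neg (by omega), zero_mul]

theorem sum_diagonal (c : ∀ l, Fin (n l + 1)) (l : κ) (G : (∀ l, Fin (n l + 1)) → ℂ)
    (v : Fin (n l + 1) → ℂ) :
    ∑ y, Matrix.diagonal v (c l) y * G (Function.update c l y) = v (c l) * G c := by
  rw [Finset.sum_eq_single (c l)]
  · simp
  · intro y _ hy
    rw [Matrix.diagonal_apply_ne' _ hy, zero_mul]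
  · simp

theorem evalSite_apply (q : ℂ) (b : κ → ℤ) (l : κ) (g : Gen) (G : (∀ l, Fin (n l + 1)) → ℂ)
    (c : ∀ l, Fin (n l + 1)) :
    evalSite q n b l g G c = evalZ q (n l) (b l) g (extend c l G) ((c l : ℕ) : ℤ) := by
  have hc : extend c l G ((c l : ℕ) : ℤ) = G c := by rw [extend_coe, Function.update_eq_self]
  -- At weight 0 the truncated subtraction gives the wrong argument of `v`, but there `extend`
  -- vanishes at `-1` and both sides are zero.
  have hv : ∀ v : ℤ → ℂ, v ((((c l : ℕ) - 1 : ℕ) : ℤ) + 1) * extend c l G (((c l : Fin _) : ℕ) - 1) =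
      v ((c l : ℕ) : ℤ) * extend c l G (((c l : Fin _) : ℕ) - 1) := fun v => by
    by_cases h : 0 < (c l : ℕ)
    · congr 2; omega
    · rw [extend, dif_neg (by omega), mul_zero, mul_zero]
  have hF := sum_lower c l G (fun y => qInt q ((y : ℤ) + 1))
  rw [hv (qInt q)] at hF
  have hE := sum_raise c l G (qInt q ((n l : ℤ) - ((c l : ℕ) : ℤ)))
  rw [evalSite, local_, site_apply]
  rcases g with g | g | g | g <;> fin_cases g
  · simp only [evalAction, evalZ, map_smul, LinearMap.toMatrix'_toLin', Matrix.smul_apply, smul_eq_mul,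
      Matrix.of_apply, mul_assoc, ← Finset.mul_sum]
    rw [hF]
  · simp only [evalAction, evalZ, map_smul, LinearMap.toMatrix'_toLin', Matrix.smul_apply, smul_eq_mul,
      Matrix.of_apply, mul_assoc, ← Finset.mul_sum]
    exact hE
  · simp only [evalAction, evalZ, map_smul, LinearMap.toMatrix'_toLin', Matrix.smul_apply, smul_eq_mul,
      Matrix.of_apply, mul_assoc, ← Finset.mul_sum]
    rw [hE]
  · simp only [evalAction, evalZ, map_smul, LinearMap.toMatrix'_toLin', Matrix.smul_apply, smul_eq_mul,
      Matrix.of_apply, mul_assoc, ← Finset.mul_sum]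
    exact hF
  all_goals
    simp only [evalAction, evalZ, LinearMap.toMatrix'_toLin', hc]
    exact sum_diagonal c l G _

/-- The weights of the other runs and the coefficients of the other blocks do not see the factors in
`S l`, so they enter `act_symWt` as dependence on the outside. -/
theorem BlockData.embed_run (h : BlockData a n b S Bs) (hq : q ≠ 0) (hq2 : q ^ 2 ≠ 1) (l : κ)
    (g : Gen) (G : (∀ l, Fin (n l + 1)) → ℂ) :
    act (vecSite q a) (S l) g (embed q h.length Bs G) =
      embed q h.length Bs (evalSite q n b l g G) := by
  obtain ⟨W, hW, hW'⟩ := h.exists_blockWt (q := q) (h.mem l)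
  have hw : ∀ i ∈ S l, ∀ e y, ∀ l', l' ≠ l →
      weight h.length (Function.update e i y) l' = weight h.length e l' := fun i hi e y l' hl' =>
    Fin.ext (ones_update (h.mem_unique hl'.symm hi) e y)
  have hu : ∀ i ∈ S l, ∀ e y x, Function.update (weight h.length (Function.update e i y)) l x =
      Function.update (weight h.length e) l x := fun i hi e y x => by
    funext l'
    by_cases hl' : l' = l
    · subst hl'; simp
    · rw [Function.update_of_ne hl', Function.update_of_ne hl', hw i hi e y l' hl']
  have hf : embed q h.length Bs G = fun e => symWt q (S l) e *
      (fun (k : ℤ) (e : ι → Fin 2) => W e * extend (weight h.length e) l G k) (ones (S l) e) e := by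
    funext e
    have := extend_coe (weight h.length e) l G (weight h.length e l)
    rw [Function.update_eq_self] at this
    rw [embed_apply, hW, ← this]
    simp only [Block.wt, weight]
    ring
  have hl : ((S l).length : ℤ) = n l := by rw [h.length l]
  funext e
  have hn : (S l).Nodup := h.nodup_sites (h.mem l)
  rw [hf, act_symWt hq hq2 hn (h.param l)
    (G := fun (k : ℤ) (e : ι → Fin 2) => W e * extend (weight h.length e) l G k), embed_apply, evalSite_apply, hW, hl]
  · have : ∀ e, evalZ q (n l) (b l) g (fun k => W e * extend (weight h.length e) l G k)
        (ones (S l) e) =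
        W e * evalZ q (n l) (b l) g (extend (weight h.length e) l G) (weight h.length e l) := by
      intro e
      rcases g with g | g | g | g <;> fin_cases g <;> simp only [evalZ, weight] <;> ring
    simp only [this, Block.wt]
    ring
  · intro i hi k e y
    have e1 : W (Function.update e i y) = W e := hW' _ _ fun j hj =>
      Function.update_of_ne (by rintro rfl; exact hj hi) _ _
    simp only [e1, extend, hu i hi]

/-- The embedding intertwines the actions for consecutive blocks. -/
theorem BlockData.embed_act (h : BlockData a n b S Bs) (hq : q ≠ 0) (hq2 : q ^ 2 ≠ 1)
    {Bs' : List (Block ι κ)} (hBs' : Bs' ⊆ Bs) (g : Gen) (G : (∀ l, Fin (n l + 1)) → ℂ) :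
    act (vecSite q a) (allSites Bs') g (embed q h.length Bs G) =
      embed q h.length Bs (act (evalSite q n b) (labels Bs') g G) := by
  induction Bs' generalizing g G with
  | nil => cases g <;> simp [counit, labels]
  | cons B Bs' ih =>
    rw [List.cons_subset] at hBs'
    have ih' := ih hBs'.2
    cases B with
    | run l L =>
      have hL := h.run l L hBs'.1
      subst hL
      have e := h.embed_run hq hq2 l
      have e1 : labels (.run l (S l) :: Bs') = l :: labels Bs' := rfl
      have e2 : allSites (.run l (S l) :: Bs') = S l ++ allSites Bs' := rfl
      rw [e1, e2, act_append, act_cons]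
      cases g <;> simp [coprod, ih', e]
    | pair i j =>
      -- An antisymmetric pair acts through the counit and drops out of the coproduct; accordingly
      -- it carries no label.
      have hA := fun G => h.isAnti_embed (q := q) hBs'.1 G
      have e := fun g G => act_pair hq (h.ne_pair hBs'.1) (h.pair i j hBs'.1) (hA G) g
      have e1 : labels (.pair i j :: Bs') = labels Bs' := rfl
      have e2 : allSites (.pair i j :: Bs') = [i, j] ++ allSites Bs' := rfl
      rw [e1, e2, act_append]
      cases g <;> simp [coprod, ih', e] <;> simp [counit]

end

/-! ### Distinguished configurations, one for each weight -/

section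

variable {ι : Type} [DecidableEq ι] {q : ℂ} {a : ι → ℤ}

/-- The entries `v_2` stand in front of the entries `v_1`. -/
def SortedOn (L : List ι) (e : ι → Fin 2) : Prop := L.Pairwise fun i j => e i = 0 → e j = 0

theorem SortedOn.congr {L : List ι} {e e' : ι → Fin 2} (h : ∀ i ∈ L, e i = e' i)
    (hs : SortedOn L e) : SortedOn L e' :=
  List.Pairwise.imp_of_mem (fun hi hj h' => by rwa [← h _ hi, ← h _ hj]) hs

theorem ones_eq_zero {L : List ι} {e : ι → Fin 2} : ones L e = 0 ↔ ∀ i ∈ L, e i = 0 := by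
  rw [ones, List.countP_eq_zero]
  refine forall₂_congr fun i _ => ?_
  simp only [decide_eq_true_eq]
  omega

/-- A function that is `q`-symmetric in adjacent tensor factors and vanishes at sorted
configurations vanishes. -/
theorem eq_zero_of_sorted (hq : q ≠ 0) {f : (ι → Fin 2) → ℂ} {L : List ι} (hL : L.Nodup)
    (hf : ∀ L₁ i j L₂, L = L₁ ++ i :: j :: L₂ → IsSymm q i j f) (Q : (ι → Fin 2) → Prop)
    (hQ : ∀ i ∈ L, ∀ e y, Q e → Q (Function.update e i y))
    (h0 : ∀ e, Q e → SortedOn L e → f e = 0) (e : ι → Fin 2) (he : Q e) : f e = 0 := by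
  induction L generalizing Q e with
  | nil => exact h0 e he List.Pairwise.nil
  | cons i L ih =>
    obtain ⟨h1, h2⟩ := List.nodup_cons.1 hL
    have ih' := ih h2 fun L₁ j k L₂ h => hf (i :: L₁) j k L₂ (by rw [h]; rfl)
    have hne : ∀ j ∈ L, i ≠ j := fun j hj h => h1 (h ▸ hj)
    have one : ∀ e, Q e → e i = 1 → f e = 0 := fun e he hi =>
      ih' (fun e => Q e ∧ e i = 1)
        (fun j hj e y h => ⟨hQ j (by simp [hj]) e y h.1, by
          rw [Function.update_of_ne (hne j hj)]; exact h.2⟩)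
        (fun e h hs => h0 e h.1 (List.pairwise_cons.2 ⟨fun j _ h' => by simp [h.2] at h', hs⟩))
        e ⟨he, hi⟩
    obtain hi | hi : e i = 0 ∨ e i = 1 := by omega
    · refine ih' (fun e => Q e ∧ e i = 0)
        (fun j hj e y h => ⟨hQ j (by simp [hj]) e y h.1, by
          rw [Function.update_of_ne (hne j hj)]; exact h.2⟩)
        (fun e h hs => ?_) e ⟨he, hi⟩
      cases L with
      | nil => exact h0 e h.1 (List.pairwise_singleton _ _)
      | cons j L =>
        obtain hj | hj : e j = 0 ∨ e j = 1 := by omega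
        · refine h0 e h.1 (List.pairwise_cons.2 ⟨fun k hk _ => ?_, hs⟩)
          rw [List.mem_cons] at hk
          obtain rfl | hk := hk
          · exact hj
          · exact (List.pairwise_cons.1 hs).1 k hk hj
        · have hij : i ≠ j := hne j (by simp)
          -- Symmetry relates `e`, which has `v_1` in front of `v_2` here, to the configuration with
          -- these two entries exchanged. The latter starts with `v_2`, a case already settled.
          have s := hf [] i j L rfl (Function.update (Function.update e i 1) j 0) (by simp [hij])
            (by simp)
          have u : Function.update (Function.update (Function.update (Function.update e i 1) j 0)
              i 0) j 1 = e := by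
            rw [Function.update_comm hij.symm, Function.update_idem, Function.update_idem, ← h.2,
              Function.update_eq_self, ← hj, Function.update_eq_self]
          rw [u, one _ (hQ j (by simp) _ _ (hQ i (by simp) _ _ h.1)) (by simp [hij])] at s
          exact (mul_eq_zero.1 s.symm).resolve_left hq
    · exact one e he hi

theorem symWt_sorted {L : List ι} {e : ι → Fin 2} (hs : SortedOn L e) : symWt q L e = 1 := by
  induction L with
  | nil => rfl
  | cons i L ih =>
    obtain ⟨h1, h2⟩ := List.pairwise_cons.1 hs
    rw [symWt, ih h2, mul_one]
    split_ifs with h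
    · rw [ones_eq_zero.2 fun j hj => h1 j hj h]
      simp
    · rfl

theorem sorted_unique {L : List ι} {e e' : ι → Fin 2} (hs : SortedOn L e) (hs' : SortedOn L e')
    (h : ones L e = ones L e') : ∀ i ∈ L, e i = e' i := by
  induction L with
  | nil => simp
  | cons i L ih =>
    obtain ⟨h1, h2⟩ := List.pairwise_cons.1 hs
    obtain ⟨h3, h4⟩ := List.pairwise_cons.1 hs'
    have key : e i = e' i := by
      rw [ones_cons, ones_cons] at h
      obtain hi | hi : e i = 0 ∨ e i = 1 := by omega
      all_goals obtain hi' | hi' : e' i = 0 ∨ e' i = 1 := by omega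
      · rw [hi, hi']
      · have := ones_eq_zero.2 fun j hj => h1 j hj hi
        simp [hi, hi', this] at h
      · have := ones_eq_zero.2 fun j hj => h3 j hj hi'
        simp [hi, hi', this] at h
      · rw [hi, hi']
    rw [ones_cons, ones_cons, key] at h
    intro j hj
    rw [List.mem_cons] at hj
    obtain rfl | hj := hj
    · exact key
    · exact ih h2 h4 (by omega) j hj

theorem exists_sorted {L : List ι} (hL : L.Nodup) {c : ℕ} (hc : c ≤ L.length) :
    ∃ e : ι → Fin 2, SortedOn L e ∧ ones L e = c := by
  induction L generalizing c with
  | nil => exact ⟨0, List.Pairwise.nil, by simp at hc; simp [hc]⟩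
  | cons i L ih =>
    obtain ⟨h1, h2⟩ := List.nodup_cons.1 hL
    cases c with
    | zero => exact ⟨0, List.Pairwise.imp_of_mem (R := fun _ _ => True) (fun _ _ _ _ => rfl)
        (List.pairwise_of_forall fun _ _ => trivial), ones_eq_zero.2 fun _ _ => rfl⟩
    | succ c =>
      obtain ⟨e, he, he'⟩ := ih h2 (c := c) (by simpa using hc)
      refine ⟨Function.update e i 1, List.pairwise_cons.2 ⟨fun j _ h => ?_, ?_⟩, ?_⟩
      · simp at h
      · exact he.congr fun j hj => (update_congr h1 e 1 j hj).symm
      · rw [ones_cons, ones_update h1, he']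
        simp

/-- The exchange puts one more `v_2` behind a `v_1`, which costs one factor `q⁻¹`; all other pairs
of entries contribute the same as before. -/
theorem symWt_swap (hq : q ≠ 0) {L L' : List ι} {i j : ι} (hL : (L ++ i :: j :: L').Nodup)
    {e : ι → Fin 2} (hi : e i = 1) (hj : e j = 0) :
    ones (L ++ i :: j :: L') (Function.update (Function.update e i 0) j 1) =
      ones (L ++ i :: j :: L') e ∧
    symWt q (L ++ i :: j :: L') e =
      q * symWt q (L ++ i :: j :: L') (Function.update (Function.update e i 0) j 1) := by
  induction L with
  | nil =>
    simp only [List.nil_append, List.nodup_cons, List.mem_cons, not_or] at hL ⊢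
    obtain ⟨⟨h1, h2⟩, h3, h4⟩ := hL
    refine ⟨?_, ?_⟩
    · simp [ones_cons, ones_update h2, ones_update h3, hi, hj, h1]
    · have e1 : q ^ (-(((ones L' e : ℕ) : ℤ) + 1)) = q⁻¹ * q ^ (-((ones L' e : ℕ) : ℤ)) := by
        rw [neg_add, zpow_add₀ hq, zpow_neg_one, mul_comm]
      simp [symWt, ones_cons, ones_update h2, ones_update h3, symWt_update h2, symWt_update h3, hi,
        hj, h1, e1, -neg_add_rev]
      field_simp
  | cons k L ih =>
    obtain ⟨h1, h2⟩ := List.nodup_cons.1 hL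
    obtain ⟨i1, i2⟩ := ih h2
    have hki : k ≠ i := by rintro rfl; exact h1 (by simp)
    have hkj : k ≠ j := by rintro rfl; exact h1 (by simp)
    rw [List.cons_append, ones_cons, ones_cons, symWt, symWt, i1, i2, Function.update_of_ne hkj,
      Function.update_of_ne hki]
    exact ⟨rfl, by ring⟩

variable {κ : Type} {n : κ → ℕ} {b : κ → ℤ} {S : κ → List ι} {Bs : List (Block ι κ)}

/-- The distinguished configurations: one for each weight. -/
def IsCanon (S : κ → List ι) (Bs : List (Block ι κ)) (e : ι → Fin 2) : Prop :=
  (∀ l, SortedOn (S l) e) ∧ ∀ i j, .pair i j ∈ Bs → e i = 0 ∧ e j = 1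

theorem BlockData.isSymm_embed (h : BlockData a n b S Bs) (hq : q ≠ 0) (l : κ) {L₁ L₂ : List ι}
    {i j : ι} (hS : S l = L₁ ++ i :: j :: L₂) (G : (∀ l, Fin (n l + 1)) → ℂ) :
    IsSymm q i j (embed q h.length Bs G) := by
  intro e hi hj
  obtain ⟨W, hW, hW'⟩ := h.exists_blockWt (q := q) (h.mem l)
  have hn : (S l).Nodup := h.nodup_sites (h.mem l)
  have hi' : i ∈ S l := by simp [hS]
  have hj' : j ∈ S l := by simp [hS]
  obtain ⟨s1, s2⟩ := symWt_swap (L := L₁) (L' := L₂) hq (hS ▸ hn) hi hj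
  rw [← hS] at s1 s2
  have hw : weight h.length (Function.update (Function.update e i 0) j 1) = weight h.length e := by
    funext l'
    apply Fin.ext
    by_cases hl : l' = l
    · subst hl; exact s1
    · simp only [weight]
      rw [ones_update (h.mem_unique (Ne.symm hl) hj'), ones_update (h.mem_unique (Ne.symm hl) hi')]
  have hW2 : W (Function.update (Function.update e i 0) j 1) = W e := hW' _ _ fun k hk => by
    rw [Function.update_of_ne (by rintro rfl; exact hk hj'),
      Function.update_of_ne (by rintro rfl; exact hk hi')]
  rw [embed_apply, embed_apply, hW, hW, hw, hW2, Block.wt, Block.wt, s2]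
  ring

theorem blockWt_canon (hr : ∀ l L, .run l L ∈ Bs → L = S l) {e : ι → Fin 2}
    (he : IsCanon S Bs e) : blockWt q Bs e = 1 := by
  refine List.prod_eq_one fun x hx => ?_
  obtain ⟨B, hB, rfl⟩ := List.mem_map.1 hx
  cases B with
  | run l L =>
    rw [hr l L hB]
    exact symWt_sorted (he.1 l)
  | pair i j =>
    obtain ⟨h1, h2⟩ := he.2 i j hB
    simp [Block.wt, antiWt, h1, h2]

theorem BlockData.canon_unique (h : BlockData a n b S Bs) {e e' : ι → Fin 2} (he : IsCanon S Bs e)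
    (he' : IsCanon S Bs e') (hw : weight h.length e = weight h.length e') : e = e' := by
  funext i
  obtain ⟨B, hB, hi⟩ := List.mem_flatMap.1 (h.complete i)
  cases B with
  | run l L =>
    have := h.run l L hB
    subst this
    exact sorted_unique (he.1 l) (he'.1 l) (Fin.ext_iff.1 (congrFun hw l)) i hi
  | pair j k =>
    simp only [Block.sites, List.mem_cons, List.not_mem_nil, or_false] at hi
    obtain rfl | rfl := hi
    · rw [(he.2 _ _ hB).1, (he'.2 _ _ hB).1]
    · rw [(he.2 _ _ hB).2, (he'.2 _ _ hB).2]

theorem BlockData.exists_canon (h : BlockData a n b S Bs) (c : ∀ l, Fin (n l + 1)) :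
    ∃ e : ι → Fin 2, IsCanon S Bs e ∧ weight h.length e = c := by
  have key : ∀ l, ∃ e : ι → Fin 2, SortedOn (S l) e ∧ ones (S l) e = c l := fun l =>
    exists_sorted (L := S l) (h.nodup_sites (h.mem l)) (by rw [h.length l]; have := (c l).2; omega)
  choose E hE hE' using key
  classical
  let e : ι → Fin 2 := fun i => if hi : ∃ l, i ∈ S l then E hi.choose i else
    if ∃ j, Block.pair j i ∈ Bs then 1 else 0
  have he : ∀ l, ∀ i ∈ S l, E l i = e i := fun l i hi => by
    have hex : ∃ l, i ∈ S l := ⟨l, hi⟩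
    have : hex.choose = l := by
      by_contra hne
      exact h.mem_unique hne hex.choose_spec hi
    simp only [e, dif_pos hex]
    rw [this]
  have hp : ∀ {i j}, Block.pair i j ∈ Bs → ∀ k ∈ [i, j], ¬ ∃ l, k ∈ S l := fun hij k hk ⟨l, hl⟩ =>
    h.disjoint (h.mem l) hij (by simp) hl hk
  refine ⟨e, ⟨fun l => (hE l).congr (he l), fun i j hij => ⟨?_, ?_⟩⟩, ?_⟩
  · have : ¬ ∃ k, Block.pair k i ∈ Bs := by
      rintro ⟨k, hk⟩
      by_cases h' : Block.pair k i = (Block.pair i j : Block ι κ)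
      · have := Block.pair.inj h'
        exact h.ne_pair hij (this.2)
      · exact h.disjoint hk hij h' (i := i) (by simp [Block.sites]) (by simp [Block.sites])
    simp only [e, dif_neg (hp hij i (by simp)), if_neg this]
  · simp only [e, dif_neg (hp hij j (by simp)), if_pos (⟨i, hij⟩ : ∃ i, Block.pair i j ∈ Bs)]
  · funext l
    apply Fin.ext
    simp only [weight]
    rw [← hE' l, ones_congr (he l)]

/-- Every weight is attained at a distinguished configuration, where the coefficient is 1. -/
theorem BlockData.embed_injective (h : BlockData a n b S Bs) :
    Function.Injective (embed q h.length Bs) := by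
  intro G G' hG
  funext c
  obtain ⟨e, he, rfl⟩ := h.exists_canon c
  have := congrFun hG e
  rwa [embed_apply, embed_apply, blockWt_canon h.run he, one_mul, one_mul] at this

/-- A function that is symmetric on the runs, antisymmetric on the pairs and vanishes at the
distinguished configurations vanishes. -/
theorem BlockData.eq_zero_of_canon (h : BlockData a n b S Bs) (hq : q ≠ 0)
    {f : (ι → Fin 2) → ℂ} (hs : ∀ l L₁ i j L₂, S l = L₁ ++ i :: j :: L₂ → IsSymm q i j f)
    (hp : ∀ i j, .pair i j ∈ Bs → IsAnti q i j f) (h0 : ∀ e, IsCanon S Bs e → f e = 0) : f = 0 := by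
  -- Induction on the blocks `Bs'` on which `e` is still arbitrary; on `Bs''` it already has the
  -- distinguished form.
  have key : ∀ Bs' Bs'' : List (Block ι κ), Bs = Bs'' ++ Bs' → ∀ e,
      ((∀ l, Block.run l (S l) ∈ Bs'' → SortedOn (S l) e) ∧
        ∀ i j, .pair i j ∈ Bs'' → e i = 0 ∧ e j = 1) → f e = 0 := by
    intro Bs'
    induction Bs' with
    | nil =>
      intro Bs'' hB e he
      rw [List.append_nil] at hB
      subst hB
      exact h0 e ⟨fun l => he.1 l (h.mem l), he.2⟩
    | cons B Bs' ih =>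
      intro Bs'' hB e he
      have ih' := ih (Bs'' ++ [B]) (by simp [hB])
      have hB' : B ∈ Bs := by simp [hB]
      have hsub : ∀ B' ∈ Bs'', B' ∈ Bs := fun B' h' => by simp [hB, h']
      have hdis : ∀ i ∈ B.sites, ∀ j ∈ allSites Bs'', j ≠ i := fun i hi j hj => by
        have hn := h.nodup
        rw [hB, allSites, List.flatMap_append, List.flatMap_cons, List.nodup_append] at hn
        exact hn.2.2 j hj i (List.mem_append_left _ hi)
      have hdis' : ∀ i ∈ B.sites, ∀ B' ∈ Bs'', ∀ j ∈ B'.sites, j ≠ i := fun i hi B' hB' j hj =>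
        hdis i hi j (List.mem_flatMap.2 ⟨B', hB', hj⟩)
      have hQ : ∀ i ∈ B.sites, ∀ e y, ((∀ l, Block.run l (S l) ∈ Bs'' → SortedOn (S l) e) ∧
          ∀ i j, .pair i j ∈ Bs'' → e i = 0 ∧ e j = 1) →
          ((∀ l, Block.run l (S l) ∈ Bs'' → SortedOn (S l) (Function.update e i y)) ∧
          ∀ j k, .pair j k ∈ Bs'' → Function.update e i y j = 0 ∧ Function.update e i y k = 1) := by
        intro i hi e y he
        refine ⟨fun l hl => (he.1 l hl).congr fun j hj => ?_, fun j k hjk => ?_⟩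
        · rw [Function.update_of_ne (hdis' i hi _ hl j hj)]
        · rw [Function.update_of_ne (hdis' i hi _ hjk j (by simp [Block.sites])),
            Function.update_of_ne (hdis' i hi _ hjk k (by simp [Block.sites]))]
          exact he.2 j k hjk
      cases B with
      | run l L =>
        have := h.run l L hB'
        subst this
        refine eq_zero_of_sorted hq (h.nodup_sites hB') (hs l) _ hQ (fun e he he' => ?_) e he
        refine ih' e ⟨fun l' hl' => ?_, fun i j hij => ?_⟩
        · rw [List.mem_append, List.mem_singleton] at hl'
          obtain hl' | hl' := hl'
          · exact he.1 l' hl'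
          · rw [(Block.run.inj hl').1]
            exact he'
        · rw [List.mem_append, List.mem_singleton] at hij
          obtain hij | hij := hij
          · exact he.2 i j hij
          · cases hij
      | pair i j =>
        have hne := h.ne_pair hB'
        have main : ∀ e, ((∀ l, Block.run l (S l) ∈ Bs'' → SortedOn (S l) e) ∧
          ∀ i j, .pair i j ∈ Bs'' → e i = 0 ∧ e j = 1) → e i = 0 → e j = 1 → f e = 0 := by
          intro e he hi hj
          refine ih' e ⟨fun l hl => ?_, fun i' j' hij => ?_⟩
          · rw [List.mem_append, List.mem_singleton] at hl
            obtain hl | hl := hl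
            · exact he.1 l hl
            · cases hl
          · rw [List.mem_append, List.mem_singleton] at hij
            obtain hij | hij := hij
            · exact he.2 i' j' hij
            · obtain ⟨rfl, rfl⟩ := Block.pair.inj hij
              exact ⟨hi, hj⟩
        obtain ⟨p0, p1⟩ := hp i j hB'
        obtain hi | hi : e i = 0 ∨ e i = 1 := by omega
        all_goals obtain hj | hj : e j = 0 ∨ e j = 1 := by omega
        · exact p0 e (hi.trans hj.symm)
        · exact main e he hi hj
        · rw [p1 e hi hj, main _ (hQ j (by simp [Block.sites]) _ _
            (hQ i (by simp [Block.sites]) _ _ he)) (by simp [hne]) (by simp), mul_zero]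
        · exact p0 e (hi.trans hj.symm)
  funext e
  exact key Bs [] rfl e ⟨by simp, by simp⟩

theorem IsSymm.sub {i j : ι} {f g : (ι → Fin 2) → ℂ} (hf : IsSymm q i j f) (hg : IsSymm q i j g) :
    IsSymm q i j (f - g) := fun e hi hj => by
  rw [Pi.sub_apply, Pi.sub_apply, hf e hi hj, hg e hi hj]; ring

theorem IsAnti.sub {i j : ι} {f g : (ι → Fin 2) → ℂ} (hf : IsAnti q i j f) (hg : IsAnti q i j g) :
    IsAnti q i j (f - g) :=
  ⟨fun e he => by rw [Pi.sub_apply, hf.1 e he, hg.1 e he, sub_zero], fun e hi hj => by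
    rw [Pi.sub_apply, Pi.sub_apply, hf.2 e hi hj, hg.2 e hi hj]; ring⟩

/-- A function with all the symmetries is determined by its values at the distinguished
configurations, and the embedding realizes arbitrary values there. -/
theorem BlockData.eq_embed (h : BlockData a n b S Bs) (hq : q ≠ 0)
    {f : (ι → Fin 2) → ℂ} (hs : ∀ l L₁ i j L₂, S l = L₁ ++ i :: j :: L₂ → IsSymm q i j f)
    (hp : ∀ i j, .pair i j ∈ Bs → IsAnti q i j f) :
    f = embed q h.length Bs fun c => f (h.exists_canon c).choose := by
  rw [← sub_eq_zero]
  refine h.eq_zero_of_canon hq (fun l L₁ i j L₂ hS => (hs l L₁ i j L₂ hS).sub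
    (h.isSymm_embed hq l hS _)) (fun i j hij => (hp i j hij).sub (h.isAnti_embed hij _)) ?_
  intro e he
  obtain ⟨c1, c2⟩ := (h.exists_canon (weight h.length e)).choose_spec
  rw [Pi.sub_apply, embed_apply, blockWt_canon h.run he, one_mul, h.canon_unique c1 he c2, sub_self]

end

/-! ### The image of the fusion operators of the blocks -/

section

variable {ι : Type} [DecidableEq ι] {q : ℂ} {a : ι → ℤ}

theorem RunParam.adjacent {b : ℤ} {L L' : List ι} {i j : ι}
    (h : RunParam a b (L ++ i :: j :: L')) : a i = a j + 2 := by
  induction L generalizing b with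
  | nil =>
    obtain ⟨h1, h2, -⟩ := h
    rw [h1, h2, List.length_cons]
    push_cast
    ring
  | cons k L ih => exact ih h.2

theorem RunParam.lt {b : ℤ} {L : List ι} (h : RunParam a b L) :
    (∀ i ∈ L, a i ≤ b + L.length - 1) ∧ L.Pairwise fun i j => a j < a i := by
  induction L generalizing b with
  | nil => simp
  | cons i L ih =>
    obtain ⟨h1, h2⟩ := h
    obtain ⟨i1, i2⟩ := ih h2
    rw [List.length_cons]
    push_cast
    refine ⟨fun j hj => ?_, List.pairwise_cons.2 ⟨fun j hj => ?_, i2⟩⟩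
    · rw [List.mem_cons] at hj
      obtain rfl | hj := hj
      · omega
      · have := i1 j hj; omega
    · have := i1 j hj; omega

variable {κ : Type} {n : κ → ℕ} {b : κ → ℤ} {S : κ → List ι} {Bs : List (Block ι κ)}

theorem fusAll_eq {Bs : List (Block ι κ)} (hn : (allSites Bs).Nodup) {B : Block ι κ} (hB : B ∈ Bs) :
    ∃ T, fusAll q a Bs = fus q a B.sites * T := by
  induction Bs with
  | nil => simp at hB
  | cons B' Bs ih =>
    rw [allSites, List.flatMap_cons, List.nodup_append] at hn
    obtain ⟨n1, n2, n3⟩ := hn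
    rw [List.mem_cons] at hB
    obtain rfl | hB := hB
    · exact ⟨fusAll q a Bs, (localOn_fusAll q a (List.Subset.refl _)).fus fun j hj hj' =>
        n3 j hj j hj' rfl⟩
    · obtain ⟨T, hT⟩ := ih n2 hB
      exact ⟨T * fus q a B'.sites, by rw [fusAll, hT, mul_assoc]⟩

/-- The image is stable under `U'_q` acting in a single block, not only in the whole product. This
gives independent lowering operators for the runs. -/
theorem fusAll_intertwine_block (hq : q ≠ 0) (hx : ∀ i j, i ≠ j → q ^ (a i - a j) ≠ 1)
    {Bs : List (Block ι κ)} (hn : (allSites Bs).Nodup) {B : Block ι κ}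
    (hB : B ∈ Bs) (g : Gen) :
    fusAll q a Bs * act (vecSite q a) B.sites.reverse g =
      act (vecSite q a) B.sites g * fusAll q a Bs := by
  induction Bs with
  | nil => simp at hB
  | cons B' Bs ih =>
    rw [allSites, List.flatMap_cons, List.nodup_append] at hn
    obtain ⟨n1, n2, n3⟩ := hn
    rw [List.mem_cons] at hB
    obtain rfl | hB := hB
    · have c : fusAll q a Bs * act (vecSite q a) B.sites g =
          act (vecSite q a) B.sites g * fusAll q a Bs :=
        commute_act _ (fun i hi g => (localOn_fusAll q a (List.Subset.refl _)).vecSite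
          (fun h => n3 i hi i h rfl) g) g
      rw [fusAll, mul_assoc, fus_intertwine hq hx n1, ← mul_assoc, c, mul_assoc]
    · have c : fus q a B'.sites * act (vecSite q a) B.sites.reverse g =
          act (vecSite q a) B.sites.reverse g * fus q a B'.sites :=
        commute_act _ (fun i hi g => (localOn_fus q a (List.Subset.refl _)).vecSite
          (fun h => n3 i h i (List.mem_flatMap.2 ⟨B, hB, List.mem_reverse.1 hi⟩) rfl) g) g
      rw [fusAll, mul_assoc, c, ← mul_assoc, ih n2 hB, mul_assoc]

variable (h : BlockData a n b S Bs) (hq0 : q ≠ 0) (hq : ∀ k : ℕ, 0 < k → q ^ k ≠ 1)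
include h hq0 hq

/-- For adjacent boxes of a run, or the two boxes of a pair, the corresponding `R` can be moved to
the far left of `fusAll`, so the image has its symmetry. -/
theorem BlockData.fusAll_eq_embed (f : (ι → Fin 2) → ℂ) :
    fusAll q a Bs f =
      embed q h.length Bs fun c => fusAll q a Bs f (h.exists_canon c).choose := by
  have hq2 := hq 2 (by norm_num)
  have hx : ∀ i j, i ≠ j → q ^ (a i - a j) ≠ 1 := fun i j hij =>
    zpow_ne_one hq (sub_ne_zero.2 fun h' => hij (h.inj h'))
  refine h.eq_embed hq0 (fun l L₁ i j L₂ hS => ?_) fun i j hij => ?_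
  · obtain ⟨T, hT⟩ := fusAll_eq (q := q) (a := a) h.nodup (h.mem l)
    have hn : (S l).Nodup := h.nodup_sites (h.mem l)
    have hp := h.param l
    rw [hS] at hn hp
    obtain ⟨T', hT'⟩ := exists_fus_eq hq0 hx hn
    rw [hT, Block.sites, hS, hT']
    have hij : i ≠ j := by
      have := (List.nodup_append.1 hn).2.1
      rw [List.nodup_cons] at this
      rintro rfl
      exact this.1 (by simp)
    exact isSymm_rr hq0 hq2 hij hp.adjacent _
  · obtain ⟨T, hT⟩ := fusAll_eq (q := q) (a := a) h.nodup hij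
    rw [hT]
    simp only [Block.sites, fus, rowR, one_mul]
    exact isAnti_rr hq0 hq2 (h.ne_pair hij) (h.pair i j hij) _

omit h in
theorem rowR_eq_smul {i : ι} {L : List ι} (hi : i ∉ L) (hL : ∀ j ∈ L, a j < a i)
    {f : (ι → Fin 2) → ℂ} (hf : ∀ e, (∃ j ∈ i :: L, e j = 1) → f e = 0) :
    ∃ c : ℂ, c ≠ 0 ∧ rowR q a i L f = c • f := by
  induction L generalizing f with
  | nil => exact ⟨1, one_ne_zero, by simp [rowR]⟩
  | cons j L ih =>
    rw [List.mem_cons, not_or] at hi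
    have e1 : rr q a i j f = rDiag q (q ^ (a i - a j)) • f := by
      funext e
      have h0 : ∀ e : ι → Fin 2, (e i = 1 ∨ e j = 1) → f e = 0 := fun e he => by
        rcases he with he | he
        · exact hf e ⟨i, by simp, he⟩
        · exact hf e ⟨j, by simp, he⟩
      rw [rr, rop_apply _ _ hi.1, Pi.smul_apply, smul_eq_mul,
        h0 (Function.update (Function.update e i 1) j 0) (by simp [hi.1]),
        h0 (Function.update (Function.update e i 0) j 1) (by simp)]
      obtain h1 | h1 : e i = 0 ∨ e i = 1 := by omega
      all_goals obtain h2 | h2 : e j = 0 ∨ e j = 1 := by omega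
      · simp [h1, h2]
      · simp [h1, h2, h0 e (Or.inr h2)]
      · simp [h1, h2, h0 e (Or.inl h1)]
      · simp [h1, h2]
    obtain ⟨c, hc, hc'⟩ := ih hi.2 (fun k hk => hL k (by simp [hk])) (f := f)
      (fun e ⟨k, hk, hk'⟩ => hf e ⟨k, by
        rw [List.mem_cons] at hk ⊢; rw [List.mem_cons]; tauto, hk'⟩)
    refine ⟨rDiag q (q ^ (a i - a j)) * c,
      mul_ne_zero (rDiag_ne_zero hq0 hq (by have := hL j (by simp); omega)) hc, ?_⟩
    rw [rowR, Module.End.mul_apply, e1, map_smul, hc', smul_smul]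

omit h in
-- On vectors with `v_1` at every place of `L` each factor is its eigenvalue `rDiag`, which is
-- nonzero since the parameters decrease.
theorem fus_eq_smul {L : List ι} (hn : L.Nodup) (hL : L.Pairwise fun i j => a j < a i)
    {f : (ι → Fin 2) → ℂ} (hf : ∀ e, (∃ j ∈ L, e j = 1) → f e = 0) :
    ∃ c : ℂ, c ≠ 0 ∧ fus q a L f = c • f := by
  induction L generalizing f with
  | nil => exact ⟨1, one_ne_zero, by simp [fus]⟩
  | cons i L ih =>
    obtain ⟨h1, h2⟩ := List.nodup_cons.1 hn
    obtain ⟨h3, h4⟩ := List.pairwise_cons.1 hL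
    obtain ⟨c, hc, hc'⟩ := rowR_eq_smul hq0 hq h1 h3 hf
    obtain ⟨d, hd, hd'⟩ := ih h2 h4 (f := f) (fun e ⟨j, hj, hj'⟩ => hf e ⟨j, by simp [hj], hj'⟩)
    exact ⟨c * d, mul_ne_zero hc hd, by
      rw [fus, Module.End.mul_apply, hc', map_smul, hd', smul_smul]⟩

/-- The fusion operator does not annihilate the highest weight vector. -/
theorem BlockData.fusAll_highest {e₀ : ι → Fin 2} (he₀ : ∀ i j, .pair i j ∈ Bs → e₀ i = 0 ∧ e₀ j = 1)
    (Bs' : List (Block ι κ)) (hB : Bs' ⊆ Bs) (hn : (allSites Bs').Nodup) {f : (ι → Fin 2) → ℂ}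
    (h0 : ∀ e, (∃ l, ∃ i ∈ S l, e i = 1) → f e = 0)
    (h1 : ∀ i j, .pair i j ∈ Bs' → ∀ e, e i = 1 → f e = 0) (h2 : f e₀ ≠ 0) :
    (∀ e, (∃ l, ∃ i ∈ S l, e i = 1) → fusAll q a Bs' f e = 0) ∧ fusAll q a Bs' f e₀ ≠ 0 := by
  induction Bs' generalizing f with
  | nil => exact ⟨h0, h2⟩
  | cons B Bs' ih =>
    rw [List.cons_subset] at hB
    rw [allSites, List.flatMap_cons, List.nodup_append] at hn
    obtain ⟨n1, n2, n3⟩ := hn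
    rw [fusAll]
    simp only [Module.End.mul_apply]
    cases B with
    | run l L =>
      have := h.run l L hB.1
      subst this
      obtain ⟨c, hc, hc'⟩ := fus_eq_smul hq0 hq (f := f) n1 (h.param l).lt.2
        (fun e he => h0 e ⟨l, he⟩)
      rw [hc']
      refine ih hB.2 n2 (fun e he => ?_) (fun i j hij e he => ?_) ?_
      · simp [h0 e he]
      · simp [h1 i j (by simp [hij]) e he]
      · simpa using ⟨hc, h2⟩
    | pair i j =>
      have hq2 := hq 2 (by norm_num)
      have hne := h.ne_pair hB.1
      have hp := h.pair i j hB.1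
      simp only [Block.sites, fus, rowR, one_mul]
      refine ih hB.2 n2 (fun e he => ?_) (fun i' j' hij e he => ?_) ?_
      · obtain ⟨l, k, hk, hk'⟩ := he
        have hki : k ≠ i := by
          rintro rfl
          exact h.disjoint (h.mem l) hB.1 (by simp) hk (by simp [Block.sites])
        have hkj : k ≠ j := by
          rintro rfl
          exact h.disjoint (h.mem l) hB.1 (by simp) hk (by simp [Block.sites])
        have h0' : ∀ e : ι → Fin 2, e k = 1 → f e = 0 := fun e he => h0 e ⟨l, k, hk, he⟩
        rw [rr_apply_pair hq0 hq2 hne hp, h0' e hk', h0' _ (by simp [hki, hkj, hk']),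
          h0' _ (by simp [hki, hkj, hk'])]
        simp
      · have hki : i' ≠ i := fun h' => n3 i (by simp [Block.sites]) i'
          (List.mem_flatMap.2 ⟨_, hij, by simp [Block.sites]⟩) h'.symm
        have hkj : i' ≠ j := fun h' => n3 j (by simp [Block.sites]) i'
          (List.mem_flatMap.2 ⟨_, hij, by simp [Block.sites]⟩) h'.symm
        have h1' := h1 i' j' (by simp [hij])
        rw [rr_apply_pair hq0 hq2 hne hp, h1' e he, h1' _ (by simp [hki, hkj, he]),
          h1' _ (by simp [hki, hkj, he])]
        simp
      · obtain ⟨p1, p2⟩ := he₀ i j hB.1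
        rw [rr_apply_pair hq0 hq2 hne hp, p1, p2,
          h1 i j (by simp) (Function.update (Function.update e₀ i 1) j 0) (by simp [hne])]
        simpa using h2

variable [DecidableEq κ] [Fintype κ]

/-- The image contains the highest weight vector and is stable under `F_1` of each run; as `[k] ≠ 0`
for `k > 0`, these lowering operators reach every basis vector. -/
theorem BlockData.embed_mem_range (G : (∀ l, Fin (n l + 1)) → ℂ) :
    embed q h.length Bs G ∈ LinearMap.range (fusAll q a Bs) := by
  have hq2 := hq 2 (by norm_num)
  have hx : ∀ i j, i ≠ j → q ^ (a i - a j) ≠ 1 := fun i j hij =>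
    zpow_ne_one hq (sub_ne_zero.2 fun h' => hij (h.inj h'))
  have h3 : q - q⁻¹ ≠ 0 := fun h => hq2 (by field_simp at h; linear_combination h)
  obtain ⟨e₀, he₀, hw₀⟩ := h.exists_canon 0
  have hz : ∀ l, ∀ i ∈ S l, e₀ i = 0 := fun l =>
    ones_eq_zero.1 (Fin.ext_iff.1 (congrFun hw₀ l))
  have base : embed q h.length Bs (Pi.single 0 1) ∈ LinearMap.range (fusAll q a Bs) := by
    classical
    -- The image of this vector vanishes at every distinguished configuration other than `e₀`, hence
    -- it is a nonzero multiple of the highest weight vector.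
    let f : (ι → Fin 2) → ℂ := fun e => if e = e₀ then 1 else 0
    obtain ⟨f0, f1⟩ := h.fusAll_highest hq0 hq he₀.2 Bs (List.Subset.refl _) h.nodup (f := f)
      (fun e ⟨l, i, hi, hi'⟩ => if_neg fun he => by rw [he, hz l i hi] at hi'; simp at hi')
      (fun i j hij e hi => if_neg fun he => by rw [he, (he₀.2 i j hij).1] at hi; simp at hi)
      (by simp [f])
    refine ⟨(fusAll q a Bs f e₀)⁻¹ • f, ?_⟩
    rw [map_smul, h.fusAll_eq_embed hq0 hq f, ← map_smul]
    congr 1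
    funext c
    obtain ⟨c1, c2⟩ := (h.exists_canon c).choose_spec
    rw [Pi.smul_apply, smul_eq_mul, Pi.single_apply]
    split_ifs with hc
    · subst hc
      rw [h.canon_unique c1 he₀ (c2.trans hw₀.symm)]
      have : (h.exists_canon 0).choose = e₀ := h.canon_unique
        (h.exists_canon 0).choose_spec.1 he₀ ((h.exists_canon 0).choose_spec.2.trans hw₀.symm)
      rw [embed_apply, blockWt_canon h.run he₀, one_mul, hw₀, this]
      exact inv_mul_cancel₀ f1
    · obtain ⟨l, hl⟩ := Function.ne_iff.1 hc
      rw [f0, mul_zero]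
      refine ⟨l, ?_⟩
      by_contra! hcon
      have : ones (S l) (h.exists_canon c).choose = 0 := ones_eq_zero.2 fun i hi => by
        have := hcon i hi; omega
      apply hl
      rw [← c2]
      exact Fin.ext this
  have step : ∀ l G, embed q h.length Bs G ∈ LinearMap.range (fusAll q a Bs) →
      embed q h.length Bs (evalSite q n b l (.F 1) G) ∈ LinearMap.range (fusAll q a Bs) := by
    rintro l G ⟨f, hf⟩
    refine ⟨act (vecSite q a) (S l).reverse (.F 1) f, ?_⟩
    have := LinearMap.congr_fun (fusAll_intertwine_block hq0 hx h.nodup (h.mem l) (.F 1)) f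
    simp only [Module.End.mul_apply, Block.sites] at this
    rw [this, hf, h.embed_run hq0 hq2]
  -- Induction on the total weight: some entry of `c` is positive, and `c` is reached from `c'`,
  -- where that entry is lowered by one.
  have key : ∀ s : ℕ, ∀ c : ∀ l, Fin (n l + 1), ∑ l, (c l : ℕ) = s →
      embed q h.length Bs (Pi.single c 1) ∈ LinearMap.range (fusAll q a Bs) := by
    intro s
    induction s with
    | zero =>
      intro c hc
      have : c = 0 := by
        funext l
        exact Fin.ext (Finset.sum_eq_zero_iff.1 hc l (Finset.mem_univ l))
      rw [this]
      exact base
    | succ s ih =>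
      intro c hc
      obtain ⟨l, -, hl⟩ := Finset.exists_ne_zero_of_sum_ne_zero
        (by rw [hc]; omega : ∑ l, (c l : ℕ) ≠ 0)
      have hcl := (c l).2
      let c' : ∀ l, Fin (n l + 1) := Function.update c l ⟨(c l : ℕ) - 1, by omega⟩
      have hc' : ∑ l, (c' l : ℕ) = s := by
        rw [← Finset.add_sum_erase _ _ (Finset.mem_univ l)] at hc ⊢
        have : ∀ k ∈ Finset.univ.erase l, (c' k : ℕ) = c k := fun k hk => by
          simp only [c', Function.update_of_ne (Finset.ne_of_mem_erase hk)]
        rw [Finset.sum_congr rfl this]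
        simp only [c', Function.update_self]
        omega
      have hi : qInt q (c l : ℕ) ≠ 0 := by
        refine div_ne_zero (fun h' => ?_) h3
        have h4 : q ^ (((c l : ℕ) : ℤ) + (c l : ℕ)) ≠ 1 := zpow_ne_one hq (by omega)
        rw [zpow_neg, sub_eq_zero] at h'
        rw [zpow_add₀ hq0] at h4
        nth_rewrite 1 [h'] at h4
        exact h4 (inv_mul_cancel₀ (zpow_ne_zero _ hq0))
      have e1 : evalSite q n b l (.F 1) (Pi.single c' 1) = qInt q (c l : ℕ) • Pi.single c 1 := by
        funext d
        rw [evalSite_apply, Pi.smul_apply, smul_eq_mul]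
        simp only [evalZ]
        by_cases hd : 0 < (d l : ℕ)
        · have hdl := (d l).2
          have e2 := extend_coe d l (Pi.single c' (1 : ℂ)) ⟨(d l : ℕ) - 1, by omega⟩
          have e3 : (((d l : ℕ) - 1 : ℕ) : ℤ) = ((d l : ℕ) : ℤ) - 1 := by omega
          simp only [e3] at e2
          rw [e2, Pi.single_apply, Pi.single_apply]
          by_cases hdc : d = c
          · subst hdc
            simp [c']
          · rw [if_neg hdc, if_neg, mul_zero, mul_zero]
            intro h'
            apply hdc
            funext k
            have hk := congrFun h' k
            by_cases hkl : k = l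
            · subst hkl
              simp only [c', Function.update_self, Fin.ext_iff] at hk
              exact Fin.ext (by omega)
            · simpa only [c', Function.update_of_ne hkl] using hk
        · rw [extend, dif_neg (by omega), mul_zero, Pi.single_apply, if_neg, mul_zero]
          rintro rfl
          omega
      have := step l _ (ih c' hc')
      rw [e1, map_smul] at this
      have h5 := Submodule.smul_mem _ (qInt q (c l : ℕ))⁻¹ this
      rwa [smul_smul, inv_mul_cancel₀ hi, one_smul] at h5
  have hG : G = ∑ c, G c • Pi.single c 1 := by
    funext d
    simp [Finset.sum_apply, Pi.single_apply]
  rw [hG, map_sum]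
  refine Submodule.sum_mem _ fun c _ => ?_
  rw [map_smul]
  exact Submodule.smul_mem _ _ (key _ c rfl)

theorem BlockData.range_fusAll :
    LinearMap.range (fusAll q a Bs) = LinearMap.range (embed q h.length Bs) := by
  apply le_antisymm
  · rintro _ ⟨f, rfl⟩
    exact ⟨_, (h.fusAll_eq_embed hq0 hq f).symm⟩
  · rintro _ ⟨G, rfl⟩
    exact h.embed_mem_range hq0 hq G

end

/-! ### The fusion operator on tensors and on functions -/

section

variable {ι : Type} [DecidableEq ι]

theorem unitAt_single (k : ι) (α β : Fin 2) (e : ι → Fin 2) [DecidableEq (ι → Fin 2)] :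
    unitAt k α β (Pi.single e (1 : ℂ)) =
      if e k = β then Pi.single (Function.update e k α) 1 else 0 := by
  funext d
  rw [unitAt_apply, Pi.single_apply]
  have key : (d k = α ∧ Function.update d k β = e) ↔ (e k = β ∧ d = Function.update e k α) := by
    constructor
    · rintro ⟨rfl, rfl⟩; simp
    · rintro ⟨rfl, rfl⟩; simp
  by_cases h1 : e k = β
  · rw [if_pos h1, Pi.single_apply]
    by_cases h2 : d k = α
    · rw [if_pos h2]
      have : Function.update d k β = e ↔ d = Function.update e k α := by
        simpa [h1, h2] using key
      simp only [this]
    · rw [if_neg h2, if_neg]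
      rintro rfl
      exact h2 (by simp)
  · rw [if_neg h1, Pi.zero_apply]
    split_ifs with h2 h3
    · exact absurd (key.1 ⟨h2, h3⟩).1 h1
    · rfl
    · rfl

theorem comp_swap {i j : ι} (e : ι → Fin 2) :
    e ∘ Equiv.swap i j = Function.update (Function.update e i (e j)) j (e i) := by
  funext k
  rw [Function.comp_apply, Equiv.swap_apply_def]
  by_cases h1 : k = j
  · subst h1
    by_cases h2 : k = i
    · subst h2; simp
    · simp [h2]
  · by_cases h2 : k = i
    · subst h2; simp [h1]
    · simp [h1, h2]

theorem rop_single (q x : ℂ) {i j : ι} (h : i ≠ j) (e : ι → Fin 2) [DecidableEq (ι → Fin 2)] :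
    rop q x i j (Pi.single e (1 : ℂ)) = if e i = e j then rDiag q x • Pi.single e (1 : ℂ) else
      Pi.single e (1 : ℂ) + (if e i < e j then rOff q x * x else rOff q x) •
        Pi.single (e ∘ Equiv.swap i j) (1 : ℂ) := by
  have e0 : ∀ α, e i = α → Function.update e i α = e := fun α h => by
    rw [← h, Function.update_eq_self]
  have e1 : ∀ α, e j = α → Function.update e j α = e := fun α h => by
    rw [← h, Function.update_eq_self]
  rw [comp_swap]
  obtain hi | hi : e i = 0 ∨ e i = 1 := by omega
  all_goals obtain hj | hj : e j = 0 ∨ e j = 1 := by omega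
  all_goals
    simp [rop, unitAt_single, hi, hj, e0 _ hi, e1 _ hj, h, h.symm,
      apply_ite (unitAt _ _ _ : Module.End ℂ ((ι → Fin 2) → ℂ))]
  all_goals rw [Function.update_comm h]

end

section

variable {N : ℕ}

theorem coord_stdBasis (e : Fin N → Fin 2) :
    coord (fun _ : Fin N => Fin 2) (stdBasis N e) = Pi.single e (1 : ℂ) := by
  change (stdBasis N).equivFun (stdBasis N e) = _
  funext d
  rw [Module.Basis.equivFun_self, Pi.single_apply]
  simp [eq_comm]

theorem Rop_stdBasis {q x : ℂ} (hq : q ≠ 0) (hx : x ≠ 1) (i j : Fin N) (e : Fin N → Fin 2) :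
    Rop q i j x (stdBasis N e) = if e i = e j then rDiag q x • stdBasis N e else
      stdBasis N e + (if e i < e j then rOff q x * x else rOff q x) •
        stdBasis N (e ∘ Equiv.swap i j) := by
  have hx' := sub_ne_zero.2 hx
  have hs : (e ∘ Equiv.swap i j) ∘ Equiv.swap i j = e := by
    funext k; simp
  have hi : (e ∘ Equiv.swap i j) i = e j := by simp
  have hj : (e ∘ Equiv.swap i j) j = e i := by simp
  have he : e i = e j → e ∘ Equiv.swap i j = e := fun h => by
    funext k
    rw [Function.comp_apply, Equiv.swap_apply_def]
    split_ifs <;> simp_all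
  simp only [Rop, Module.End.mul_apply, permOp, Module.Basis.constr_basis, Sop, Sinv,
    LinearMap.smul_apply, LinearMap.sub_apply, Module.End.one_apply, heckeT, hi, hj, hs]
  rcases lt_trichotomy (e i) (e j) with h | h | h
  · rw [if_neg h.ne', if_neg h.not_gt, if_neg h.ne, if_pos h]
    simp only [rOff]
    match_scalars <;> field_simp <;> ring
  · rw [if_pos h.symm, if_pos h, he h]
    simp only [rDiag]
    match_scalars
    field_simp
    ring
  · rw [if_neg h.ne, if_pos h, if_neg h.ne', if_neg h.not_gt]
    simp only [rOff]
    match_scalars <;> field_simp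

theorem coord_Rop {q x : ℂ} (hq : q ≠ 0) (hx : x ≠ 1) {i j : Fin N} (hij : i ≠ j)
    (v : TensorV N) :
    coord (fun _ : Fin N => Fin 2) (Rop q i j x v) =
      rop q x i j (coord (fun _ : Fin N => Fin 2) v) := by
  have : (coord (fun _ : Fin N => Fin 2)).toLinearMap ∘ₗ Rop q i j x =
      rop q x i j ∘ₗ (coord (fun _ : Fin N => Fin 2)).toLinearMap := by
    refine (stdBasis N).ext fun e => ?_
    simp only [LinearMap.comp_apply, LinearEquiv.coe_coe, coord_stdBasis, Rop_stdBasis hq hx,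
      rop_single q x hij]
    split_ifs <;> simp only [map_add, map_smul, coord_stdBasis]
  exact LinearMap.congr_fun this v

theorem list_prod_intertwine {α M M' : Type*} [AddCommGroup M] [Module ℂ M] [AddCommGroup M']
    [Module ℂ M'] (φ : M → M') {f : α → Module.End ℂ M} {g : α → Module.End ℂ M'} {L : List α}
    (h : ∀ i ∈ L, ∀ x, φ (f i x) = g i (φ x)) (x : M) :
    φ ((L.map f).prod x) = (L.map g).prod (φ x) := by
  induction L with
  | nil => simp
  | cons i L ih =>
    simp only [List.map_cons, List.prod_cons, Module.End.mul_apply]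
    rw [h i (by simp), ih fun j hj => h j (by simp [hj])]

theorem rowR_eq (q : ℂ) (a : Fin N → ℤ) (i : Fin N) (L : List (Fin N)) :
    rowR q a i L = (L.reverse.map fun j => rr q a i j).prod := by
  induction L with
  | nil => rfl
  | cons j L ih => simp [rowR, ih]

/-- Compares the recursive order of factors with the prescribed one: the first row stands on the far
right, and within a row the smallest `j` does. -/
theorem fus_eq (q : ℂ) (a : Fin N → ℤ) {L : List (Fin N)} (hL : L.Pairwise (· < ·)) :
    fus q a L = (L.reverse.map fun i =>
      ((L.reverse.filter fun j => i < j).map fun j => rr q a i j).prod).prod := by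
  induction L with
  | nil => rfl
  | cons i L ih =>
    obtain ⟨h1, h2⟩ := List.pairwise_cons.1 hL
    rw [fus, ih h2, rowR_eq, List.reverse_cons, List.map_append, List.prod_append]
    congr 1
    · congr 1
      refine List.map_congr_left fun k hk => ?_
      have : ¬ k < i := (h1 k (List.mem_reverse.1 hk)).not_gt
      rw [List.filter_append, List.filter_cons_of_neg (by simpa using this), List.filter_nil,
        List.append_nil]
    · have e : L.reverse.filter (fun j => i < j) = L.reverse :=
        List.filter_eq_self.2 fun j hj => by simpa using h1 j (List.mem_reverse.1 hj)
      rw [List.map_singleton, List.prod_singleton, List.filter_append, e,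
        List.filter_cons_of_neg (by simp), List.filter_nil, List.append_nil]

theorem coord_fusionR {q : ℂ} (hq : q ≠ 0) {a : Fin N → ℤ}
    (hx : ∀ i j, i ≠ j → q ^ (a i - a j) ≠ 1) (v : TensorV N) :
    coord (fun _ : Fin N => Fin 2) (fusionR q a v) =
      fus q a (List.finRange N) (coord (fun _ : Fin N => Fin 2) v) := by
  rw [fus_eq q a (List.pairwise_lt_finRange N), fusionR]
  refine list_prod_intertwine _ (fun i _ x => ?_) v
  refine list_prod_intertwine _ (fun j hj x => ?_) x
  have hij : i ≠ j := by
    have := (List.mem_filter.1 hj).2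
    simp only [decide_eq_true_eq] at this
    exact this.ne
  exact coord_Rop hq (hx i j hij) hij x

theorem coord_piAction (q : ℂ) (a : Fin N → ℤ) (g : Gen) (v : TensorV N) :
    coord (fun _ : Fin N => Fin 2) (piAction q a g v) =
      act (vecSite q a) (List.finRange N) g (coord (fun _ : Fin N => Fin 2) v) := by
  have := coord_tensorAction (X := fun _ : Fin N => Fin 2) (fun k => vecAction q (a k))
    (List.pairwise_lt_finRange N) List.mem_finRange g v
  rw [piAction, this]
  have e : local_ (X := fun _ : Fin N => Fin 2) (fun k => vecAction q (a k)) = vecSite q a := by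
    funext k g
    rw [local_, toMatrix_vecAction]
    rfl
  rw [e]

end

/-! ### The isomorphism for a strip cut into blocks -/

/-- The theorem for a strip that has been cut into blocks. -/
theorem exists_rep_iso {q : ℂ} (hq0 : q ≠ 0) (hq : ∀ k : ℕ, 0 < k → q ^ k ≠ 1) {N : ℕ}
    {a : Fin N → ℤ} {κ : Type} [Fintype κ] [LinearOrder κ] {n : κ → ℕ} {b : κ → ℤ}
    {S : κ → List (Fin N)} {Bs : List (Block (Fin N) κ)} (h : BlockData a n b S Bs)
    (hBs : allSites Bs = List.finRange N) (hl : (labels Bs.reverse).Pairwise (· < ·))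
    (hl' : ∀ l, l ∈ labels Bs.reverse) :
    ∃ (ρ : UAff q →ₐ[ℂ] Module.End ℂ (TensorV N))
      (σ : UAff q →ₐ[ℂ] Module.End ℂ (⨂[ℂ] l : κ, (Fin (n l + 1) → ℂ))),
      (∀ g, ρ (UAff.of q g) = piAction q a g) ∧
      (∀ g, σ (UAff.of q g) = tensorAction (fun l : κ => evalAction q (n l) (b l)) g) ∧
      ∃ (hinv : ∀ (u : UAff q), ∀ x ∈ LinearMap.range (fusionR q a),
          ρ u x ∈ LinearMap.range (fusionR q a))
        (e : LinearMap.range (fusionR q a) ≃ₗ[ℂ] ⨂[ℂ] l : κ, (Fin (n l + 1) → ℂ)),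
        ∀ (u : UAff q) (x : LinearMap.range (fusionR q a)),
          e ⟨ρ u x, hinv u x x.2⟩ = σ u (e x) := by
  have hq2 := hq 2 (by norm_num)
  have hx : ∀ i j, i ≠ j → q ^ (a i - a j) ≠ 1 := fun i j hij =>
    zpow_ne_one hq (sub_ne_zero.2 fun h' => hij (h.inj h'))
  have hnd : (List.finRange N).Nodup := List.nodup_finRange N
  let cV := coord (fun _ : Fin N => Fin 2)
  let cW := coord (fun l : κ => Fin (n l + 1))
  let J : (⨂[ℂ] l : κ, (Fin (n l + 1) → ℂ)) →ₗ[ℂ] TensorV N :=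
    cV.symm.toLinearMap ∘ₗ crossAll q a Bs ∘ₗ embed q h.length Bs ∘ₗ cW.toLinearMap
  have hJ : ∀ y, cV (J y) = crossAll q a Bs (embed q h.length Bs (cW y)) := fun y => by
    simp [J]
  -- The embedding produces functions antisymmetric in all pairs, and on these the cross factors are
  -- injective.
  have hinj : Function.Injective J := by
    rw [← LinearMap.ker_eq_bot, LinearMap.ker_eq_bot']
    intro y hy
    have h1 := hJ y
    rw [hy, map_zero] at h1
    have hk := keeps_crossAll hq0 hq h.inj (P := fun i j => Block.pair i j ∈ Bs)
      (fun i j hij => ⟨h.ne_pair hij, h.pair i j hij⟩) h.nodup (fun _ _ h => h)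
      (fun l L hL j hj k k' hk => by
        constructor <;> rintro rfl
        · exact h.disjoint hL hk (by simp) hj (by simp [Block.sites])
        · exact h.disjoint hL hk (by simp) hj (by simp [Block.sites])) h.apart
    have h2 := (hk _ fun i j hij => h.isAnti_embed hij (cW y)).2 h1.symm
    have h3 := h.embed_injective (h2.trans (map_zero _).symm)
    exact cW.map_eq_zero_iff.1 h3
  have hrange : LinearMap.range J = LinearMap.range (fusionR q a) := by
    have hf := fus_allSites hq0 hx h.nodup
    have hr := h.range_fusAll hq0 hq
    apply le_antisymm
    · rintro _ ⟨y, rfl⟩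
      have : embed q h.length Bs (cW y) ∈ LinearMap.range (fusAll q a Bs) := hr ▸ ⟨_, rfl⟩
      obtain ⟨f, hf'⟩ := this
      refine ⟨cV.symm f, cV.injective ?_⟩
      rw [coord_fusionR hq0 hx, hJ, ← hf', ← hBs, hf]
      exact congrArg (fun z => crossAll q a Bs (fusAll q a Bs z)) (cV.apply_symm_apply f)
    · rintro _ ⟨v, rfl⟩
      have : fusAll q a Bs (cV v) ∈ LinearMap.range (embed q h.length Bs) := hr ▸ ⟨_, rfl⟩
      obtain ⟨G, hG⟩ := this
      refine ⟨cW.symm G, cV.injective ?_⟩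
      rw [hJ, cW.apply_symm_apply, hG, coord_fusionR hq0 hx, ← hBs, hf]
      rfl
  have hint : ∀ g y, J (tensorAction (fun l : κ => evalAction q (n l) (b l)) g y) =
      piAction q a g (J y) := by
    intro g y
    apply cV.injective
    have e1 := coord_tensorAction (X := fun l : κ => Fin (n l + 1))
      (fun l : κ => evalAction q (n l) (b l)) hl hl' g y
    have e2 := h.embed_act hq0 hq2 (Bs' := Bs.reverse) (fun B hB => List.mem_reverse.1 hB) g (cW y)
    -- No intertwining property of the cross factors by themselves is needed. On the image of
    -- `fusAll` it follows by comparing the intertwining relations of `fusAll` and of the full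
    -- fusion operator at a preimage `f`.
    obtain ⟨f, hf⟩ : embed q h.length Bs (cW y) ∈ LinearMap.range (fusAll q a Bs) :=
      h.range_fusAll hq0 hq ▸ ⟨_, rfl⟩
    have e3 := LinearMap.congr_fun (fusAll_intertwine hq0 hx h.nodup g) f
    have e4 := LinearMap.congr_fun (fus_intertwine hq0 hx h.nodup g) f
    rw [fus_allSites hq0 hx h.nodup] at e4
    simp only [Module.End.mul_apply] at e3 e4
    rw [hJ, e1, coord_piAction, hJ, ← hf, ← hBs, ← e4, e3, hf, e2]
    rfl
  have hρ' : ∀ ⦃x y : FreeAlgebra ℂ Gen⦄, Rel q x y →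
      FreeAlgebra.lift ℂ (piAction q a) x = FreeAlgebra.lift ℂ (piAction q a) y := by
    intro x y hxy
    have h1 := (isRep_act (vecSite q a) hq0 (isRep_vecSite a hq0 hq2)
      (fun i j hij g g' => vecSite_comm q a hij g g') hnd).lift_eq hq hq0 hxy
    have key : ∀ z v, cV (FreeAlgebra.lift ℂ (piAction q a) z v) =
        FreeAlgebra.lift ℂ (act (vecSite q a) (List.finRange N)) z (cV v) := by
      intro z
      induction z using FreeAlgebra.induction with
      | grade0 r => intro v; simp [Module.algebraMap_end_apply]
      | grade1 g => intro v; simp only [FreeAlgebra.lift_ι_apply]; exact coord_piAction q a g v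
      | mul x y hx hy => intro v; simp only [map_mul, Module.End.mul_apply, hx, hy]
      | add x y hx hy => intro v; simp only [map_add, LinearMap.add_apply, hx, hy]
    refine LinearMap.ext fun v => cV.injective ?_
    rw [key, key, h1]
  have hJlift : ∀ z y, J (FreeAlgebra.lift ℂ
      (tensorAction fun l : κ => evalAction q (n l) (b l)) z y) =
      FreeAlgebra.lift ℂ (piAction q a) z (J y) := by
    intro z
    induction z using FreeAlgebra.induction with
    | grade0 r => intro v; simp [Module.algebraMap_end_apply]
    | grade1 g => intro v; simp only [FreeAlgebra.lift_ι_apply]; exact hint g v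
    | mul x y hx hy => intro v; simp only [map_mul, Module.End.mul_apply, hx, hy]
    | add x y hx hy => intro v; simp only [map_add, LinearMap.add_apply, hx, hy]
  -- The relations on the evaluation side need no computation: `J` is injective and intertwines the
  -- generators with an action that satisfies them.
  have hσ' : ∀ ⦃x y : FreeAlgebra ℂ Gen⦄, Rel q x y →
      FreeAlgebra.lift ℂ (tensorAction fun l : κ => evalAction q (n l) (b l)) x =
      FreeAlgebra.lift ℂ (tensorAction fun l : κ => evalAction q (n l) (b l)) y := by
    intro x y hxy
    refine LinearMap.ext fun v => hinj ?_
    rw [hJlift, hJlift, hρ' hxy]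
  let ρ := RingQuot.liftAlgHom ℂ ⟨FreeAlgebra.lift ℂ (piAction q a), hρ'⟩
  let σ := RingQuot.liftAlgHom ℂ
    ⟨FreeAlgebra.lift ℂ (tensorAction fun l : κ => evalAction q (n l) (b l)), hσ'⟩
  have hρ : ∀ z, ρ (RingQuot.mkAlgHom ℂ (Rel q) z) = FreeAlgebra.lift ℂ (piAction q a) z :=
    fun z => RingQuot.liftAlgHom_mkAlgHom_apply ℂ _ _ z
  have hσ : ∀ z, σ (RingQuot.mkAlgHom ℂ (Rel q) z) =
      FreeAlgebra.lift ℂ (tensorAction fun l : κ => evalAction q (n l) (b l)) z :=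
    fun z => RingQuot.liftAlgHom_mkAlgHom_apply ℂ _ _ z
  have hJu : ∀ u y, J (σ u y) = ρ u (J y) := by
    intro u y
    obtain ⟨z, rfl⟩ := RingQuot.mkAlgHom_surjective ℂ (Rel q) u
    rw [hσ, hρ, hJlift]
  have hinv : ∀ (u : UAff q), ∀ x ∈ LinearMap.range (fusionR q a),
      ρ u x ∈ LinearMap.range (fusionR q a) := by
    intro u x hx
    rw [← hrange] at hx ⊢
    obtain ⟨y, rfl⟩ := hx
    exact ⟨σ u y, hJu u y⟩
  let e₁ := (LinearEquiv.ofInjective J hinj).trans (LinearEquiv.ofEq _ _ hrange)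
  have he₁ : ∀ y, ((e₁ y : LinearMap.range (fusionR q a)) : TensorV N) = J y := fun y => rfl
  refine ⟨ρ, σ, fun g => ?_, fun g => ?_, hinv, e₁.symm, fun u x => ?_⟩
  · rw [UAff.of, hρ, FreeAlgebra.lift_ι_apply]
  · rw [UAff.of, hσ, FreeAlgebra.lift_ι_apply]
  · rw [LinearEquiv.symm_apply_eq]
    apply Subtype.ext
    rw [he₁, hJu, ← he₁, LinearEquiv.apply_symm_apply]

/-! ### Combinatorics of the border strip -/

section

/-- The consecutive positions `s, …, s + n - 1`. -/
def segment (N s n : ℕ) : List (Fin N) := ((List.finRange N).drop s).take n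

theorem segment_succ {N s n : ℕ} (h : s < N) :
    segment N s (n + 1) = ⟨s, h⟩ :: segment N (s + 1) n := by
  rw [segment, List.drop_eq_getElem_cons (by simpa using h), List.take_succ_cons, segment]
  simp

theorem length_segment {N s n : ℕ} (h : s + n ≤ N) : (segment N s n).length = n := by
  rw [segment, List.length_take, List.length_drop, List.length_finRange]
  omega

theorem mem_segment {N s n : ℕ} (h : s + n ≤ N) (k : Fin N) :
    k ∈ segment N s n ↔ s ≤ k ∧ (k : ℕ) < s + n := by
  induction n generalizing s with
  | zero => simp [segment]
  | succ n ih =>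
    rw [segment_succ (by omega), List.mem_cons, ih (by omega), Fin.ext_iff]
    simp only
    omega

theorem pairwise_segment (N s n : ℕ) : (segment N s n).Pairwise (· < ·) :=
  (List.pairwise_lt_finRange N).sublist ((List.take_sublist _ _).trans (List.drop_sublist _ _))

theorem runParam_segment {N s n : ℕ} {a : Fin N → ℤ} {b : ℤ} (h : s + n ≤ N)
    (ha : ∀ k : Fin N, s ≤ k → (k : ℕ) < s + n → a k = 2 * ((N : ℤ) - 1 - (k : ℕ)))
    (hb : b = 2 * ((N : ℤ) - 1 - s) - n + 1) : RunParam a b (segment N s n) := by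
  induction n generalizing s b with
  | zero => simp [segment, RunParam]
  | succ n ih =>
    rw [segment_succ (by omega)]
    push_cast at hb
    refine ⟨?_, ih (by omega) (fun k h1 h2 => ha k (by omega) (by omega)) ?_⟩
    · rw [length_segment (by omega), ha _ (by simp) (by simp)]
      simp only
      linarith
    · push_cast
      linarith

variable {r : ℕ} (m : Fin r → ℕ)

/-- The number of boxes in the columns from `t` on. -/
def tailSum (t : ℕ) : ℕ := ∑ i : Fin r, if t ≤ i then m i else 0

theorem tailSum_zero : tailSum m 0 = ∑ i, m i := by simp [tailSum]

theorem tailSum_end : tailSum m r = 0 :=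
  Finset.sum_eq_zero fun i _ => if_neg (by have := i.2; omega)

theorem tailSum_anti {s t : ℕ} (h : s ≤ t) : tailSum m t ≤ tailSum m s := by
  refine Finset.sum_le_sum fun i _ => ?_
  split_ifs <;> omega

theorem tailSum_le (t : ℕ) : tailSum m t ≤ ∑ i, m i :=
  (tailSum_anti m (Nat.zero_le t)).trans (tailSum_zero m).le

theorem sum_Ioi_eq (j : Fin r) : ∑ i ∈ Finset.Ioi j, m i = tailSum m (j + 1) := by
  rw [tailSum, ← Finset.sum_filter]
  congr 1
  ext i
  simp only [Finset.mem_Ioi, Finset.mem_filter, Finset.mem_univ, true_and, Fin.lt_def]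
  omega

theorem tailSum_eq (j : Fin r) : tailSum m j = m j + tailSum m (j + 1) := by
  rw [← sum_Ioi_eq, ← Finset.sum_insert (by simp), tailSum, ← Finset.sum_filter]
  congr 1
  ext i
  simp only [Finset.mem_Ioi, Finset.mem_filter, Finset.mem_univ, true_and, Fin.lt_def,
    Finset.mem_insert, Fin.ext_iff]
  omega

theorem sum_Iio_add (j : Fin r) : ∑ i ∈ Finset.Iio j, m i + tailSum m j = ∑ i, m i := by
  have h : ∑ i ∈ Finset.Iio j, m i = ∑ i : Fin r, if i < j then m i else 0 := by
    rw [← Finset.sum_filter]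
    exact Finset.sum_congr (by ext i; simp only [Finset.mem_Iio, Finset.mem_filter,
      Finset.mem_univ, true_and]) fun _ _ => rfl
  rw [h, tailSum, ← Finset.sum_add_distrib]
  refine Finset.sum_congr rfl fun i _ => ?_
  simp only [Fin.lt_def]
  split_ifs <;> omega

theorem sum_Iio_cast (j : Fin r) :
    ∑ i ∈ Finset.Iio j, (m i : ℤ) = ((∑ i, m i : ℕ) : ℤ) - tailSum m j := by
  have := sum_Iio_add m j
  have h2 : ((∑ i ∈ Finset.Iio j, m i : ℕ) : ℤ) = ∑ i ∈ Finset.Iio j, (m i : ℤ) := by push_cast; rfl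
  omega

theorem stripParam_eq (j : Fin r) (l : ℕ) (hl : l < m j) (k : Fin (∑ i, m i))
    (hk : (k : ℕ) = l + tailSum m (j + 1)) :
    stripParam m k = 2 * ((l : ℤ) + ((∑ i, m i : ℕ) : ℤ) - tailSum m j) := by
  rw [stripParam_apply m j l hl k (by rw [sum_Ioi_eq, hk]), sum_Iio_cast]
  ring

theorem exists_column (k : ℕ) (hk : k < ∑ i, m i) :
    ∃ j : Fin r, tailSum m (j + 1) ≤ k ∧ k < tailSum m j := by
  have hex : ∃ t, tailSum m t ≤ k := ⟨r, by rw [tailSum_end]; omega⟩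
  classical
  -- `tailSum` decreases from the number of boxes to 0; the column of box `k` is the last one before
  -- `tailSum` drops to `k` or below, hence `t - 1`.
  obtain ⟨t, ht, hmin⟩ : ∃ t, tailSum m t ≤ k ∧ ∀ s < t, k < tailSum m s :=
    ⟨Nat.find hex, Nat.find_spec hex, fun s hs => not_le.1 (Nat.find_min hex hs)⟩
  have h0 : t ≠ 0 := by
    rintro rfl
    rw [tailSum_zero] at ht
    omega
  have hr : t ≤ r := by
    by_contra hr
    have := hmin r (by omega)
    rw [tailSum_end] at this
    omega
  refine ⟨⟨t - 1, by omega⟩, ?_, hmin _ (by simp only; omega)⟩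
  rwa [show t - 1 + 1 = t by omega]

variable {m}

theorem tailSum_run (l : Fin r) (p : ℕ) (hp : p ≤ runLength m l) :
    tailSum m l = tailSum m (l + p) + p := by
  obtain ⟨h1, h2, -⟩ := runLength_spec m l
  induction p with
  | zero => simp
  | succ p ih =>
    have hlt : (l : ℕ) + p < r := by omega
    have e := tailSum_eq m ⟨l + p, hlt⟩
    rw [h2 ⟨l + p, hlt⟩ (by simp [Fin.le_def]) (by simp only; omega)] at e
    simp only at e
    rw [ih (by omega), e, ← add_assoc (l : ℕ)]
    omega

theorem runLength_pos {l : Fin r} (hl : m l = 1) : 0 < runLength m l := by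
  by_contra h
  obtain ⟨-, -, h3⟩ := runLength_spec m l
  exact h3 l (by omega) hl

variable (m) in
/-- The positions of a run. -/
def runSites (l : RunStart m) : List (Fin (∑ i, m i)) :=
  segment _ (tailSum m (l.1 + runLength m l)) (runLength m l)

theorem runSites_bound (l : RunStart m) :
    tailSum m (l.1 + runLength m l) + runLength m l ≤ ∑ i, m i := by
  rw [← tailSum_run l.1 _ le_rfl]
  exact tailSum_le m _

theorem mem_runSites (l : RunStart m) (k : Fin (∑ i, m i)) :
    k ∈ runSites m l ↔ tailSum m (l.1 + runLength m l) ≤ k ∧ (k : ℕ) < tailSum m l.1 := by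
  rw [runSites, mem_segment (runSites_bound l), ← tailSum_run l.1 _ le_rfl]

/-- In a column of length one the number of boxes to the right is `N - 1 - k`, so along a run the
parameter is affine in `k` with slope `-2`. -/
theorem stripParam_run (l : RunStart m) {k : Fin (∑ i, m i)}
    (h1 : tailSum m (l.1 + runLength m l) ≤ k) (h2 : (k : ℕ) < tailSum m l.1) :
    stripParam m k = 2 * (((∑ i, m i : ℕ) : ℤ) - 1 - (k : ℕ)) := by
  obtain ⟨s1, s2, -⟩ := runLength_spec m l
  have e0 := tailSum_run (m := m) l.1 (runLength m l) le_rfl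
  obtain ⟨p, hp⟩ := Nat.exists_eq_add_of_lt h2
  have hpn : p < runLength m l := by omega
  have e1 := tailSum_run (m := m) l.1 p hpn.le
  have e2 := tailSum_run (m := m) l.1 (p + 1) hpn
  have hlt : (l.1 : ℕ) + p < r := by omega
  have hm := s2 ⟨l.1 + p, hlt⟩ (by simp [Fin.le_def]) (by simp only; omega)
  rw [← add_assoc (l.1 : ℕ) p 1] at e2
  rw [stripParam_eq m ⟨l.1 + p, hlt⟩ 0 (by omega) k ?_]
  all_goals simp only
  all_goals omega

variable (m) in
open Classical in
/-- The block that starts at a column, if there is one. -/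
def colBlock (j : Fin r) : List (Block (Fin (∑ i, m i)) (RunStart m)) :=
  if h : m j = 1 ∧ ∀ i : Fin r, (i : ℕ) + 1 = j → m i = 2 then
    [.run ⟨j, h⟩ (runSites m ⟨j, h⟩)]
  else if h : m j = 2 then
    [.pair ⟨tailSum m (j + 1), by
        have := tailSum_le m j; have := tailSum_eq m j; omega⟩
      ⟨tailSum m (j + 1) + 1, by
        have := tailSum_le m j; have := tailSum_eq m j; omega⟩]
  else []

variable (m) in
/-- The blocks of the strip, from left to right. -/
def stripBlocks : List (Block (Fin (∑ i, m i)) (RunStart m)) :=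
  ((List.finRange r).flatMap (colBlock m)).reverse

/-- The block `B` starts at the column `j` and has `n` columns. -/
structure StartsAt (m : Fin r → ℕ) (B : Block (Fin (∑ i, m i)) (RunStart m)) (j : Fin r) (n : ℕ) :
    Prop where
  mem : ∀ k, k ∈ B.sites ↔ tailSum m (j + n) ≤ k ∧ (k : ℕ) < tailSum m j
  sorted : B.sites.Pairwise (· < ·)
  le : ∀ k ∈ B.sites, stripParam m k ≤ 2 * (((∑ i, m i : ℕ) : ℤ) - 1 - tailSum m (j + n))
  ge : ∀ k ∈ B.sites, 2 * (((∑ i, m i : ℕ) : ℤ) - tailSum m j) ≤ stripParam m k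
  next : ∀ i : Fin r, j < i → (i : ℕ) < j + n →
    m i = 1 ∧ ∃ i' : Fin r, (i' : ℕ) + 1 = i ∧ m i' = 1
  start : ∀ l L, B = .run l L → j = l.1 ∧ n = runLength m l ∧ L = runSites m l
  pair : ∀ i k, B = .pair i k → m j = 2 ∧ stripParam m k = stripParam m i + 2

theorem startsAt_colBlock {j : Fin r} {B : Block (Fin (∑ i, m i)) (RunStart m)}
    (hB : B ∈ colBlock m j) : ∃ n, StartsAt m B j n := by
  rw [colBlock] at hB
  split_ifs at hB with h h'
  · rw [List.mem_singleton] at hB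
    subst hB
    have hmem := mem_runSites (⟨j, h⟩ : RunStart m)
    have hpar := fun k hk => stripParam_run (⟨j, h⟩ : RunStart m) ((hmem k).1 hk).1 ((hmem k).1 hk).2
    obtain ⟨s1, s2, -⟩ := runLength_spec m j
    refine ⟨runLength m j, hmem, pairwise_segment _ _ _, fun k hk => ?_, fun k hk => ?_,
      fun i hi hi' => ⟨s2 i hi.le hi', ?_⟩, ?_, ?_⟩
    · have := ((hmem k).1 hk).1
      rw [hpar k hk]
      simp only at this
      omega
    · have := ((hmem k).1 hk).2
      rw [hpar k hk]
      simp only at this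
      omega
    · rw [Fin.lt_def] at hi
      have := i.2
      exact ⟨⟨i - 1, by omega⟩, by simp only; omega, s2 _ (by simp only [Fin.le_def]; omega)
        (by simp only; omega)⟩
    · rintro l L hl
      obtain ⟨rfl, rfl⟩ := Block.run.inj hl
      exact ⟨rfl, rfl, rfl⟩
    · rintro i k hik
      cases hik
  · rw [List.mem_singleton] at hB
    subst hB
    have e := tailSum_eq m j
    have hle := tailSum_le m j
    have p1 := stripParam_eq m j 0 (by omega) ⟨tailSum m (j + 1), by omega⟩ (by simp)
    have p2 := stripParam_eq m j 1 (by omega) ⟨tailSum m (j + 1) + 1, by omega⟩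
      (by simp only; omega)
    refine ⟨1, fun k => ?_, ?_, fun k hk => ?_, fun k hk => ?_, fun i hi hi' => ?_, ?_, ?_⟩
    · simp only [Block.sites, List.mem_cons, List.not_mem_nil, or_false, Fin.ext_iff]
      omega
    · exact List.pairwise_pair.2 (Nat.lt_succ_self _)
    · simp only [Block.sites, List.mem_cons, List.not_mem_nil, or_false] at hk
      obtain rfl | rfl := hk
      · rw [p1]; omega
      · rw [p2]; omega
    · simp only [Block.sites, List.mem_cons, List.not_mem_nil, or_false] at hk
      obtain rfl | rfl := hk
      · rw [p1]; omega
      · rw [p2]; omega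
    · rw [Fin.lt_def] at hi
      omega
    · rintro l L hl
      cases hl
    · rintro i k hik
      obtain ⟨rfl, rfl⟩ := Block.pair.inj hik
      refine ⟨h', ?_⟩
      rw [p1, p2]
      omega
  · simp at hB

theorem col_start {j : Fin r} {B : Block (Fin (∑ i, m i)) (RunStart m)} (hB : B ∈ colBlock m j) :
    (m j = 1 ∧ ∀ i : Fin r, (i : ℕ) + 1 = j → m i = 2) ∨ m j = 2 := by
  rw [colBlock] at hB
  split_ifs at hB with h h'
  · exact Or.inl h
  · exact Or.inr h'
  · simp at hB

/-- Later columns start beyond the end of a block. -/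
theorem StartsAt.add_le {j j' : Fin r} {B B' : Block (Fin (∑ i, m i)) (RunStart m)} {n : ℕ}
    (h : StartsAt m B j n) (hB' : B' ∈ colBlock m j') (hj : j < j') : (j : ℕ) + n ≤ j' := by
  by_contra hcon
  obtain ⟨h1, i, hi, hi'⟩ := h.next j' hj (by omega)
  obtain ⟨-, h2⟩ | h2 := col_start hB'
  · have := h2 i hi
    omega
  · omega

theorem pairwise_stripBlocks {R : Block (Fin (∑ i, m i)) (RunStart m) →
    Block (Fin (∑ i, m i)) (RunStart m) → Prop}
    (h : ∀ j j' B B', j < j' → B ∈ colBlock m j → B' ∈ colBlock m j' → R B' B) :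
    (stripBlocks m).Pairwise R := by
  rw [stripBlocks, List.pairwise_reverse, List.pairwise_flatMap]
  refine ⟨fun j _ => ?_, (List.pairwise_lt_finRange r).imp fun hj B hB B' hB' =>
    h _ _ B B' hj hB hB'⟩
  rw [colBlock]
  split_ifs <;> simp

theorem mem_stripBlocks {B : Block (Fin (∑ i, m i)) (RunStart m)} :
    B ∈ stripBlocks m ↔ ∃ j, B ∈ colBlock m j := by
  simp [stripBlocks]

theorem run_mem_stripBlocks (l : RunStart m) : .run l (runSites m l) ∈ stripBlocks m := by
  refine mem_stripBlocks.2 ⟨l.1, ?_⟩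
  rw [colBlock, dif_pos l.2]
  exact List.mem_singleton.2 rfl

theorem sorted_sites : (allSites (stripBlocks m)).Pairwise (· < ·) := by
  rw [allSites, List.pairwise_flatMap]
  refine ⟨fun B hB => ?_, pairwise_stripBlocks fun j j' B B' hj hB hB' k hk k' hk' => ?_⟩
  · obtain ⟨j, hj⟩ := mem_stripBlocks.1 hB
    obtain ⟨n, hn⟩ := startsAt_colBlock hj
    exact hn.sorted
  · obtain ⟨n, hn⟩ := startsAt_colBlock hB
    obtain ⟨n', hn'⟩ := startsAt_colBlock hB'
    have h1 := ((hn.mem k').1 hk').1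
    have h2 := ((hn'.mem k).1 hk).2
    have h3 := tailSum_anti m (hn.add_le hB' hj)
    rw [Fin.lt_def]
    omega

/-- The run is found by going from `j` towards smaller columns as long as they have length one. -/
theorem exists_run (hm : ∀ i, m i = 1 ∨ m i = 2) (j : Fin r) (hj : m j = 1) :
    ∃ l : RunStart m, l.1 ≤ j ∧ (j : ℕ) < l.1 + runLength m l := by
  have hex : ∃ t : ℕ, ∀ i : Fin r, t ≤ (i : ℕ) → i ≤ j → m i = 1 := ⟨j, fun i h1 h2 => by
    rw [show i = j from le_antisymm h2 h1, hj]⟩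
  classical
  obtain ⟨t, ht, hmin⟩ : ∃ t : ℕ, (∀ i : Fin r, t ≤ (i : ℕ) → i ≤ j → m i = 1) ∧
      ∀ s < t, ¬ ∀ i : Fin r, s ≤ (i : ℕ) → i ≤ j → m i = 1 :=
    ⟨Nat.find hex, Nat.find_spec hex, fun s hs => Nat.find_min hex hs⟩
  have htj : t ≤ j := by
    by_contra h
    exact hmin j (by omega) fun i h1 h2 => by rw [show i = j from le_antisymm h2 h1, hj]
  have hjr := j.2
  let l : Fin r := ⟨t, by omega⟩
  have hl : m l = 1 ∧ ∀ i : Fin r, (i : ℕ) + 1 = l → m i = 2 := by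
    refine ⟨ht l le_rfl htj, fun i hi => ?_⟩
    have hi' : (i : ℕ) + 1 = t := hi
    refine (hm i).resolve_left fun h1 => hmin i (by omega) fun k hk hkj => ?_
    by_cases h : k = i
    · rw [h, h1]
    · refine ht k ?_ hkj
      have : (k : ℕ) ≠ i := fun h' => h (Fin.ext h')
      omega
  refine ⟨⟨l, hl⟩, htj, ?_⟩
  by_contra hcon
  obtain ⟨-, -, s3⟩ := runLength_spec m l
  have hcon' : t + runLength m l ≤ j := not_lt.1 hcon
  exact s3 ⟨t + runLength m l, by omega⟩ rfl (ht _ (by simp only; omega) hcon')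

theorem mem_sites (hm : ∀ i, m i = 1 ∨ m i = 2) (k : Fin (∑ i, m i)) :
    k ∈ allSites (stripBlocks m) := by
  obtain ⟨j, h1, h2⟩ := exists_column m k k.2
  rw [allSites, List.mem_flatMap]
  obtain hj | hj := hm j
  · obtain ⟨l, l1, l2⟩ := exists_run hm j hj
    refine ⟨_, run_mem_stripBlocks l, (mem_runSites l k).2 ⟨?_, ?_⟩⟩
    · exact (tailSum_anti m (by omega)).trans h1
    · exact h2.trans_le (tailSum_anti m l1)
  · have hB : ∃ B, B ∈ colBlock m j := by
      rw [colBlock, dif_neg (by omega), dif_pos hj]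
      exact ⟨_, List.mem_singleton.2 rfl⟩
    obtain ⟨B, hB⟩ := hB
    refine ⟨B, mem_stripBlocks.2 ⟨j, hB⟩, ?_⟩
    obtain ⟨n, hn⟩ := startsAt_colBlock hB
    refine (hn.mem k).2 ⟨?_, h2⟩
    cases n with
    -- A block with no columns would have no sites, but a pair has two.
    | zero =>
      rw [colBlock, dif_neg (by omega), dif_pos hj, List.mem_singleton] at hB
      subst hB
      have := (hn.mem ⟨tailSum m (j + 1), by
        have := tailSum_le m j; have := tailSum_eq m j; omega⟩).1 (by simp [Block.sites])
      have := tailSum_eq m j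
      simp only [add_zero] at *
      omega
    | succ n => exact (tailSum_anti m (by omega)).trans h1

theorem allSites_stripBlocks (hm : ∀ i, m i = 1 ∨ m i = 2) :
    allSites (stripBlocks m) = List.finRange (∑ i, m i) := by
  refine List.Perm.eq_of_pairwise (le := (· < ·)) (fun a b _ _ h1 h2 => absurd h2 h1.not_gt)
    sorted_sites (List.pairwise_lt_finRange _) ?_
  refine (List.perm_ext_iff_of_nodup (sorted_sites.imp fun h => h.ne) (List.nodup_finRange _)).2
    fun k => ?_
  simp [mem_sites hm k]

/-- The parameters of a block fill a range bounded by its positions (`StartsAt.le`, `StartsAt.ge`),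
and the ranges of successive blocks are disjoint and descend from left to right. -/
theorem apart_stripBlocks :
    (stripBlocks m).Pairwise (Block.Apart (stripParam m)) := by
  refine pairwise_stripBlocks fun j j' B B' hj hB hB' k hk k' hk' => ?_
  obtain ⟨n, hn⟩ := startsAt_colBlock hB
  obtain ⟨n', hn'⟩ := startsAt_colBlock hB'
  have h1 := hn'.ge k hk
  have h2 := hn.le k' hk'
  have hle := hn.add_le hB' hj
  have h3 := tailSum_anti m hle
  refine ⟨by omega, fun l L l' L' e e' => ?_⟩
  obtain ⟨rfl, rfl, rfl⟩ := hn'.start l L e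
  obtain ⟨rfl, rfl, rfl⟩ := hn.start l' L' e'
  obtain ⟨-, s2, s3⟩ := runLength_spec m l'.1
  have hlr := l.1.2
  have hne : (l'.1 : ℕ) + runLength m l'.1 ≠ l.1 := fun h => s3 l.1 h.symm l.2.1
  have hpos := runLength_pos l'.2.1
  have hi : (l.1 : ℕ) - 1 < r := by omega
  -- By maximality of the run `l'`, the column before `l` is not part of it. That column has two
  -- boxes, so the parameters of the two runs differ by at least 6.
  have hm2 := l.2.2 ⟨l.1 - 1, hi⟩ (by simp only; omega)
  have h4 := tailSum_eq m ⟨l.1 - 1, hi⟩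
  have h5 := tailSum_anti m (show (l'.1 : ℕ) + runLength m l'.1 ≤ l.1 - 1 by omega)
  rw [hm2] at h4
  simp only [show (l.1 : ℕ) - 1 + 1 = l.1 by omega] at h4
  omega

/-- Different blocks have disjoint ranges of parameters; inside a run the parameter is affine in the
position, and inside a pair the two values differ by 2. -/
theorem stripParam_injective (hm : ∀ i, m i = 1 ∨ m i = 2) :
    Function.Injective (stripParam m) := by
  intro i j hij
  obtain ⟨B, hB, hi⟩ := List.mem_flatMap.1 (mem_sites hm i)
  obtain ⟨B', hB', hj⟩ := List.mem_flatMap.1 (mem_sites hm j)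
  by_cases hBB : B = B'
  · subst hBB
    obtain ⟨t, ht⟩ := mem_stripBlocks.1 hB
    obtain ⟨n, hn⟩ := startsAt_colBlock ht
    cases B with
    | run l L =>
      obtain ⟨rfl, rfl, rfl⟩ := hn.start l L rfl
      have h1 := (hn.mem i).1 hi
      have h2 := (hn.mem j).1 hj
      rw [stripParam_run l h1.1 h1.2, stripParam_run l h2.1 h2.2] at hij
      exact Fin.ext (by omega)
    | pair k k' =>
      have := (hn.pair k k' rfl).2
      simp only [Block.sites, List.mem_cons, List.not_mem_nil, or_false] at hi hj
      obtain rfl | rfl := hi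
      all_goals obtain rfl | rfl := hj
      · rfl
      · omega
      · omega
      · rfl
  · exfalso
    let R : Block (Fin (∑ i, m i)) (RunStart m) → Block (Fin (∑ i, m i)) (RunStart m) → Prop :=
      fun B B' => ∀ i ∈ B.sites, ∀ j ∈ B'.sites, stripParam m i ≠ stripParam m j
    have hs : Std.Symm R := ⟨fun B B' h i hi j hj => (h j hj i hi).symm⟩
    have hp : (stripBlocks m).Pairwise R := apart_stripBlocks.imp
      fun h i hi j hj => (h i hi j hj).1.ne'
    exact hp.forall hB hB' hBB i hi j hj hij

theorem blockData_strip (hm : ∀ i, m i = 1 ∨ m i = 2) :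
    BlockData (stripParam m) (fun l : RunStart m => runLength m l) (fun l => runParam m l)
      (runSites m) (stripBlocks m) where
  inj := stripParam_injective hm
  nodup := sorted_sites.imp fun h => h.ne
  complete := mem_sites hm
  apart := apart_stripBlocks
  run l L h := by
    obtain ⟨j, hj⟩ := mem_stripBlocks.1 h
    obtain ⟨n, hn⟩ := startsAt_colBlock hj
    exact (hn.start l L rfl).2.2
  mem := run_mem_stripBlocks
  pair i k h := by
    obtain ⟨j, hj⟩ := mem_stripBlocks.1 h
    obtain ⟨n, hn⟩ := startsAt_colBlock hj
    exact (hn.pair i k rfl).2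
  param l := by
    have e := tailSum_run (m := m) l.1 (runLength m l) le_rfl
    refine runParam_segment (runSites_bound l) (fun k h1 h2 => stripParam_run l h1 (by omega)) ?_
    rw [runParam, sum_Iio_cast]
    omega
  length l := length_segment (runSites_bound l)

theorem labels_colBlock (j : Fin r) : labels (colBlock m j) =
    if h : m j = 1 ∧ ∀ i : Fin r, (i : ℕ) + 1 = j → m i = 2 then [⟨j, h⟩] else [] := by
  rw [colBlock]
  split_ifs <;> simp [labels]

theorem labels_stripBlocks :
    labels (stripBlocks m).reverse = (List.finRange r).flatMap fun j => labels (colBlock m j) := by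
  rw [stripBlocks, List.reverse_reverse, labels, List.flatMap_assoc]
  rfl

theorem sorted_labels : (labels (stripBlocks m).reverse).Pairwise (· < ·) := by
  rw [labels_stripBlocks, List.pairwise_flatMap]
  refine ⟨fun j _ => ?_, (List.pairwise_lt_finRange r).imp fun {j j'} hj l hl l' hl' => ?_⟩
  · rw [labels_colBlock]
    split_ifs <;> simp
  · rw [labels_colBlock] at hl hl'
    split_ifs at hl hl' with h h'
    · rw [List.mem_singleton] at hl hl'
      subst hl hl'
      exact hj
    all_goals simp at hl hl'

theorem mem_labels (l : RunStart m) : l ∈ labels (stripBlocks m).reverse := by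
  rw [labels_stripBlocks, List.mem_flatMap]
  refine ⟨l.1, List.mem_finRange _, ?_⟩
  rw [labels_colBlock, dif_pos l.2]
  exact List.mem_singleton.2 rfl

end

end QAffine

end

theorem mainTheorem2 (q : ℂ) (hq0 : q ≠ 0) (hq : ∀ k : ℕ, 0 < k → q ^ k ≠ 1)
    (r : ℕ) (m : Fin r → ℕ) (hm : ∀ i, m i = 1 ∨ m i = 2) :
    ∃ (ρ : UAff q →ₐ[ℂ] Module.End ℂ (TensorV (∑ i, m i)))
      (σ : UAff q →ₐ[ℂ] Module.End ℂ (⨂[ℂ] l : RunStart m, (Fin (runLength m l + 1) → ℂ))),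
      (∀ g, ρ (UAff.of q g) = piAction q (stripParam m) g) ∧
      (∀ g, σ (UAff.of q g) =
        tensorAction (fun l : RunStart m => evalAction q (runLength m l) (runParam m l)) g) ∧
      ∃ (hinv : ∀ (u : UAff q), ∀ x ∈ LinearMap.range (fusionR q (stripParam m)),
          ρ u x ∈ LinearMap.range (fusionR q (stripParam m)))
        (e : LinearMap.range (fusionR q (stripParam m)) ≃ₗ[ℂ]
          ⨂[ℂ] l : RunStart m, (Fin (runLength m l + 1) → ℂ)),
        ∀ (u : UAff q) (x : LinearMap.range (fusionR q (stripParam m))),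
          e ⟨ρ u x, hinv u x x.2⟩ = σ u (e x) :=
  exists_rep_iso hq0 hq (blockData_strip hm) (allSites_stripBlocks hm) sorted_labels mem_labels
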